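/- Let $(Y,D)$ and $(Y',D')$ be smooth complete (for example, smooth projective) toric threefold pairs over $\mathbb{C}$: $Y$ is the toric variety of a smooth complete fan in a lattice of rank $3$, $D=Y\setminus(\mathbb{C}^\times)^3$ is its reduced toric boundary, and similarly for $(Y',D')$. Suppose that the irreducible components of $D$ and of $D'$ are indexed by the same set, $D=\sum_v D_v$ and $D'=\sum_v D'_v$, in such a way that the dual complexes agree, $\Sigma_D=\Sigma_{D'}$: for every nonempty finite set $S$ of indices, $\bigcap_{v\in S}D_v\neq\emptyset$ if and only if $\bigcap_{v\in S}D'_v\neq\emptyset$. For an edge $e=vw$, write $D_e=D_v\cap D_w$ and $D'_e=D'_v\cap D'_w$ for the corresponding $1$-strata. Let $$\mu\colon \mathrm{Pic}(Y)\to\mathrm{Pic}(Y'),\qquad \mu_v\colon \mathrm{Pic}(D_v)\to\mathrm{Pic}(D'_v)\quad\text{(for every } v)$$ be group isomorphisms which are compatible with restriction, that is, $\mu(L)|_{D'_v}=\mu_v(L|_{D_v})$ for all $v$ and all $L\in\mathrm{Pic}(Y)$. Suppose moreover that - $\mu([D_v])=[D'_v]$ in $\mathrm{Pic}(Y')$ for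 every $v$, and $\mu_v([D_e])=[D'_e]$ in $\mathrm{Pic}(D'_v)$ for every $v$ and every edge $e$ containing $v$; - $\mu$ preserves the cubic form, $\mu(L)^3=L^3$ for all $L\in\mathrm{Pic}(Y)$, and every $\mu_v$ is an isometry for the intersection forms, $\mu_v(L)\cdot\mu_v(M)=L\cdot M$ for all $L,M\in\mathrm{Pic}(D_v)$. Then $\mu$ and the $\mu_v$ are induced by an isomorphism of pairs: there is an isomorphism $f\colon Y\to Y'$ over $\mathbb{C}$ that restricts to isomorphisms $f_v\colon D_v\to D'_v$ for all $v$, with $f^*(\mu(L))=L$ for all $L\in\mathrm{Pic}(Y)$ and $f_v^*(\mu_v(L))=L$ for all $v$ and all $L\in\mathrm{Pic}(D_v)$. -/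

import Mathlib

open CategoryTheory AlgebraicGeometry

namespace LogCY

/-! ### The Picard group as the first Cech cohomology group of the sheaf of units -/

/-- Pull-back of invertible functions along a morphism of schemes. -/
noncomputable def pullUnits {X Y : Scheme.{0}} (f : X ⟶ Y) (U : Y.Opens) (V : X.Opens)
    (h : V ≤ f ⁻¹ᵁ U) : Γ(Y, U)ˣ →* Γ(X, V)ˣ :=
  Units.map (f.appLE U V h).hom

/-- Restriction of invertible functions to a smaller open set. -/
noncomputable def resUnits {X : Scheme.{0}} {U V : X.Opens} (h : V ≤ U) : Γ(X, U)ˣ →* Γ(X, V)ˣ :=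
  Units.map (X.presheaf.map (homOfLE h).op).hom

theorem resUnits_resUnits {X : Scheme.{0}} {U V W : X.Opens} (h : V ≤ U) (h' : W ≤ V)
    (a : Γ(X, U)ˣ) : resUnits h' (resUnits h a) = resUnits (h'.trans h) a := by
  ext
  simp only [resUnits, Units.coe_map, MonoidHom.coe_coe]
  rw [← CommRingCat.comp_apply, ← Functor.map_comp]
  rfl

theorem resUnits_pullUnits {X Y : Scheme.{0}} (f : X ⟶ Y) {U : Y.Opens} {V W : X.Opens}
    (h : V ≤ f ⁻¹ᵁ U) (h' : W ≤ V) (a : Γ(Y, U)ˣ) :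
    resUnits h' (pullUnits f U V h a) = pullUnits f U W (h'.trans h) a := by
  ext
  simp only [resUnits, pullUnits, Units.coe_map, MonoidHom.coe_coe]
  rw [← CommRingCat.comp_apply, Scheme.Hom.appLE_map]

theorem pullUnits_resUnits {X Y : Scheme.{0}} (f : X ⟶ Y) {U U' : Y.Opens} {V : X.Opens}
    (h : U' ≤ U) (h' : V ≤ f ⁻¹ᵁ U') (a : Γ(Y, U)ˣ) :
    pullUnits f U' V h' (resUnits h a) =
      pullUnits f U V (h'.trans ((TopologicalSpace.Opens.map f.base).map (homOfLE h)).le) a := by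
  ext
  simp only [resUnits, pullUnits, Units.coe_map, MonoidHom.coe_coe]
  rw [← CommRingCat.comp_apply, Scheme.Hom.map_appLE]

/-- Gluing data for a line bundle on `X`: a trivialising open neighbourhood `U x` of every point
`x`, and transition functions `g x y`, invertible on `U x ⊓ U y`, that satisfy the cocycle
condition on triple overlaps. -/
structure Cocycle (X : Scheme.{0}) where
  U : X → X.Opens
  mem : ∀ x, x ∈ U x
  g : ∀ x y, Γ(X, U x ⊓ U y)ˣ
  cocycle : ∀ x y z,
    resUnits (V := U x ⊓ U y ⊓ U z) inf_le_left (g x y) *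
      resUnits (le_inf (inf_le_left.trans inf_le_right) inf_le_right) (g y z) =
    resUnits (le_inf (inf_le_left.trans inf_le_left) inf_le_right) (g x z)

namespace Cocycle

variable {X Y Z : Scheme.{0}}

/-- The transition function `g x y`, restricted to an open set `W` inside `U x ⊓ U y`. -/
noncomputable def gOn (c : Cocycle X) (x y : X) (W : X.Opens) (hx : W ≤ c.U x) (hy : W ≤ c.U y) :
    Γ(X, W)ˣ :=
  resUnits (le_inf hx hy) (c.g x y)

theorem res_gOn (c : Cocycle X) (x y : X) {W W' : X.Opens} (hx : W ≤ c.U x) (hy : W ≤ c.U y)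
    (h : W' ≤ W) : resUnits h (c.gOn x y W hx hy) = c.gOn x y W' (h.trans hx) (h.trans hy) :=
  resUnits_resUnits _ _ _

theorem gOn_mul_gOn (c : Cocycle X) (x y z : X) (W : X.Opens) (hx : W ≤ c.U x) (hy : W ≤ c.U y)
    (hz : W ≤ c.U z) : c.gOn x y W hx hy * c.gOn y z W hy hz = c.gOn x z W hx hz := by
  have := congrArg (resUnits (le_inf (le_inf hx hy) hz)) (c.cocycle x y z)
  simp only [map_mul, resUnits_resUnits] at this
  exact this

/-- Two cocycles define isomorphic line bundles: after shrinking the neighbourhoods, they differ by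
a coboundary. -/
def Equivalent (c d : Cocycle X) : Prop :=
  ∃ (W : X → X.Opens) (_ : ∀ x, x ∈ W x) (hc : ∀ x, W x ≤ c.U x) (hd : ∀ x, W x ≤ d.U x)
    (h : ∀ x, Γ(X, W x)ˣ), ∀ x y,
      d.gOn x y (W x ⊓ W y) (inf_le_left.trans (hd x)) (inf_le_right.trans (hd y)) *
          resUnits inf_le_right (h y) =
        resUnits inf_le_left (h x) *
          c.gOn x y (W x ⊓ W y) (inf_le_left.trans (hc x)) (inf_le_right.trans (hc y))

/-- Two cocycles that agree after restriction to smaller neighbourhoods are equivalent. -/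
theorem equivalent_of_gOn_eq {c d : Cocycle X} (W : X → X.Opens) (hW : ∀ x, x ∈ W x)
    (hc : ∀ x, W x ≤ c.U x) (hd : ∀ x, W x ≤ d.U x)
    (H : ∀ x y, d.gOn x y (W x ⊓ W y) (inf_le_left.trans (hd x)) (inf_le_right.trans (hd y)) =
      c.gOn x y (W x ⊓ W y) (inf_le_left.trans (hc x)) (inf_le_right.trans (hc y))) :
    Equivalent c d :=
  ⟨W, hW, hc, hd, fun _ => 1, fun x y => by rw [map_one, map_one, mul_one, one_mul, H]⟩

theorem Equivalent.refl (c : Cocycle X) : Equivalent c c :=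
  equivalent_of_gOn_eq c.U c.mem (fun _ => le_rfl) (fun _ => le_rfl) fun _ _ => rfl

theorem Equivalent.symm {c d : Cocycle X} (H : Equivalent c d) : Equivalent d c := by
  obtain ⟨W, hW, hc, hd, h, H⟩ := H
  refine ⟨W, hW, hd, hc, fun x => (h x)⁻¹, fun x y => ?_⟩
  rw [map_inv, map_inv, mul_inv_eq_iff_eq_mul, mul_assoc, H x y, inv_mul_cancel_left]

theorem Equivalent.trans {c d e : Cocycle X} (H : Equivalent c d) (H' : Equivalent d e) :
    Equivalent c e := by
  obtain ⟨W, hW, hc, hd, h, H⟩ := H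
  obtain ⟨W', hW', hd', he', h', H'⟩ := H'
  refine ⟨fun x => W x ⊓ W' x, fun x => ⟨hW x, hW' x⟩, fun x => inf_le_left.trans (hc x),
    fun x => inf_le_right.trans (he' x),
    fun x => resUnits inf_le_left (h x) * resUnits inf_le_right (h' x), fun x y => ?_⟩
  have l : (W x ⊓ W' x) ⊓ (W y ⊓ W' y) ≤ W x ⊓ W y := inf_le_inf inf_le_left inf_le_left
  have l' : (W x ⊓ W' x) ⊓ (W y ⊓ W' y) ≤ W' x ⊓ W' y := inf_le_inf inf_le_right inf_le_right
  have E := congrArg (resUnits l) (H x y)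
  have E' := congrArg (resUnits l') (H' x y)
  simp only [map_mul, resUnits_resUnits, res_gOn] at E E' ⊢
  rw [mul_comm (resUnits _ (h y)), ← mul_assoc, E', mul_assoc, E, ← mul_assoc,
    mul_comm (resUnits _ (h' x))]

instance setoid (X : Scheme.{0}) : Setoid (Cocycle X) :=
  ⟨Equivalent, Equivalent.refl, Equivalent.symm, Equivalent.trans⟩

/-- The trivial line bundle. -/
noncomputable def one (X : Scheme.{0}) : Cocycle X where
  U _ := ⊤
  mem _ := trivial
  g _ _ := 1
  cocycle _ _ _ := by simp

/-- The tensor product of line bundles. -/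
noncomputable def mul (c d : Cocycle X) : Cocycle X where
  U x := c.U x ⊓ d.U x
  mem x := ⟨c.mem x, d.mem x⟩
  g x y := c.gOn x y _ (inf_le_left.trans inf_le_left) (inf_le_right.trans inf_le_left) *
    d.gOn x y _ (inf_le_left.trans inf_le_right) (inf_le_right.trans inf_le_right)
  cocycle x y z := by
    simp only [map_mul, res_gOn]
    rw [mul_mul_mul_comm, gOn_mul_gOn, gOn_mul_gOn]

/-- The dual line bundle. -/
noncomputable def inv (c : Cocycle X) : Cocycle X where
  U := c.U
  mem := c.mem
  g x y := (c.g x y)⁻¹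
  cocycle x y z := by
    simp only [map_inv, ← mul_inv]
    rw [c.cocycle]

/-- The pull-back of a line bundle along a morphism. -/
noncomputable def pullback (f : X ⟶ Y) (c : Cocycle Y) : Cocycle X where
  U x := f ⁻¹ᵁ c.U (f x)
  mem x := c.mem (f x)
  g x y := pullUnits f (c.U (f x) ⊓ c.U (f y)) (f ⁻¹ᵁ c.U (f x) ⊓ f ⁻¹ᵁ c.U (f y)) le_rfl
    (c.g (f x) (f y))
  cocycle x y z := by
    have l : f ⁻¹ᵁ c.U (f x) ⊓ f ⁻¹ᵁ c.U (f y) ⊓ f ⁻¹ᵁ c.U (f z) ≤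
      f ⁻¹ᵁ (c.U (f x) ⊓ c.U (f y) ⊓ c.U (f z)) := le_rfl
    have := congrArg (pullUnits f _ _ l) (c.cocycle (f x) (f y) (f z))
    rw [map_mul, pullUnits_resUnits, pullUnits_resUnits, pullUnits_resUnits] at this
    exact (congrArg₂ _ (resUnits_pullUnits _ _ _ _) (resUnits_pullUnits _ _ _ _)).trans
      (this.trans (resUnits_pullUnits _ _ _ _).symm)

theorem one_gOn (x y : X) (W : X.Opens) (hx : W ≤ (one X).U x) (hy : W ≤ (one X).U y) :
    (one X).gOn x y W hx hy = 1 :=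
  map_one (resUnits _)

theorem mul_gOn (c d : Cocycle X) (x y : X) (W : X.Opens) (hx : W ≤ (c.mul d).U x)
    (hy : W ≤ (c.mul d).U y) :
    (c.mul d).gOn x y W hx hy =
      c.gOn x y W (hx.trans inf_le_left) (hy.trans inf_le_left) *
        d.gOn x y W (hx.trans inf_le_right) (hy.trans inf_le_right) :=
  (map_mul (resUnits _) _ _).trans (congrArg₂ _ (res_gOn _ _ _ _ _ _) (res_gOn _ _ _ _ _ _))

theorem inv_gOn (c : Cocycle X) (x y : X) (W : X.Opens) (hx : W ≤ c.inv.U x)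
    (hy : W ≤ c.inv.U y) : c.inv.gOn x y W hx hy = (c.gOn x y W hx hy)⁻¹ :=
  map_inv (resUnits _) _

theorem pullback_gOn (f : X ⟶ Y) (c : Cocycle Y) (x y : X) (W : X.Opens)
    (hx : W ≤ (c.pullback f).U x) (hy : W ≤ (c.pullback f).U y) :
    (c.pullback f).gOn x y W hx hy =
      pullUnits f (c.U (f x) ⊓ c.U (f y)) W (le_inf hx hy) (c.g (f x) (f y)) :=
  resUnits_pullUnits _ _ _ _

theorem pullUnits_gOn (f : X ⟶ Y) (c : Cocycle Y) (x y : X) (V : Y.Opens) (W : X.Opens)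
    (hx : V ≤ c.U (f x)) (hy : V ≤ c.U (f y)) (h : W ≤ f ⁻¹ᵁ V)
    (hx' : W ≤ (c.pullback f).U x) (hy' : W ≤ (c.pullback f).U y) :
    pullUnits f V W h (c.gOn (f x) (f y) V hx hy) = (c.pullback f).gOn x y W hx' hy' :=
  (pullUnits_resUnits _ _ _ _).trans (pullback_gOn f c x y W hx' hy').symm

theorem mul_equivalent {c c' d d' : Cocycle X} (H : Equivalent c c') (H' : Equivalent d d') :
    Equivalent (c.mul d) (c'.mul d') := by
  obtain ⟨W, hW, hc, hc', h, H⟩ := H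
  obtain ⟨W', hW', hd, hd', h', H'⟩ := H'
  refine ⟨fun x => W x ⊓ W' x, fun x => ⟨hW x, hW' x⟩, fun x => inf_le_inf (hc x) (hd x),
    fun x => inf_le_inf (hc' x) (hd' x),
    fun x => resUnits inf_le_left (h x) * resUnits inf_le_right (h' x), fun x y => ?_⟩
  have l : (W x ⊓ W' x) ⊓ (W y ⊓ W' y) ≤ W x ⊓ W y := inf_le_inf inf_le_left inf_le_left
  have l' : (W x ⊓ W' x) ⊓ (W y ⊓ W' y) ≤ W' x ⊓ W' y := inf_le_inf inf_le_right inf_le_right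
  have E := congrArg (resUnits l) (H x y)
  have E' := congrArg (resUnits l') (H' x y)
  simp only [map_mul, resUnits_resUnits, res_gOn] at E E' ⊢
  rw [mul_gOn, mul_gOn, mul_mul_mul_comm, E, E', mul_mul_mul_comm]

theorem inv_equivalent {c d : Cocycle X} (H : Equivalent c d) : Equivalent c.inv d.inv := by
  obtain ⟨W, hW, hc, hd, h, H⟩ := H
  refine ⟨W, hW, hc, hd, fun x => (h x)⁻¹, fun x y => ?_⟩
  rw [inv_gOn, inv_gOn, map_inv, map_inv, ← mul_inv, ← mul_inv, H x y]

theorem pullback_equivalent (f : X ⟶ Y) {c d : Cocycle Y} (H : Equivalent c d) :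
    Equivalent (c.pullback f) (d.pullback f) := by
  obtain ⟨W, hW, hc, hd, h, H⟩ := H
  refine ⟨fun x => f ⁻¹ᵁ W (f x), fun x => hW (f x), fun x => fun _ hx => hc (f x) hx,
    fun x => fun _ hx => hd (f x) hx, fun x => pullUnits f _ _ le_rfl (h (f x)), fun x y => ?_⟩
  have l : f ⁻¹ᵁ W (f x) ⊓ f ⁻¹ᵁ W (f y) ≤ f ⁻¹ᵁ (W (f x) ⊓ W (f y)) := le_rfl
  have E := congrArg (pullUnits f _ _ l) (H (f x) (f y))
  rw [map_mul, map_mul, pullUnits_resUnits, pullUnits_resUnits,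
    pullUnits_gOn (hx' := fun _ hw => hc _ (l hw).1) (hy' := fun _ hw => hc _ (l hw).2),
    pullUnits_gOn (hx' := fun _ hw => hd _ (l hw).1) (hy' := fun _ hw => hd _ (l hw).2)] at E
  refine Eq.trans (congrArg₂ _ rfl (resUnits_pullUnits _ _ _ _)) (E.trans ?_)
  exact congrArg₂ _ (resUnits_pullUnits _ _ _ _).symm rfl

end Cocycle

/-- The Picard group of `X`: isomorphism classes of line bundles under tensor product, that is,
the group `H¹(X, 𝒪ˣ)`. -/
def Pic (X : Scheme.{0}) : Type := Quotient (Cocycle.setoid X)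

namespace Pic

variable {X Y : Scheme.{0}}

/-- The class of a line bundle. -/
def mk (c : Cocycle X) : Pic X := Quotient.mk _ c

noncomputable instance (X : Scheme.{0}) : Mul (Pic X) :=
  ⟨Quotient.map₂ Cocycle.mul fun _ _ h _ _ h' => Cocycle.mul_equivalent h h'⟩

noncomputable instance (X : Scheme.{0}) : One (Pic X) := ⟨mk (Cocycle.one X)⟩

noncomputable instance (X : Scheme.{0}) : Inv (Pic X) :=
  ⟨Quotient.map Cocycle.inv fun _ _ h => Cocycle.inv_equivalent h⟩

noncomputable instance (X : Scheme.{0}) : CommGroup (Pic X) where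
  mul_assoc := by
    rintro ⟨a⟩ ⟨b⟩ ⟨c⟩
    refine Quotient.sound (Cocycle.equivalent_of_gOn_eq
      (fun x => a.U x ⊓ b.U x ⊓ c.U x) (fun x => ⟨⟨a.mem x, b.mem x⟩, c.mem x⟩) (fun _ => le_rfl)
      (fun _ => inf_assoc _ _ _ |>.le) fun x y => ?_)
    simp only [Cocycle.mul_gOn, mul_assoc]
  one_mul := by
    rintro ⟨a⟩
    refine Quotient.sound (Cocycle.equivalent_of_gOn_eq a.U a.mem
      (fun _ => le_inf le_top le_rfl) (fun _ => le_rfl) fun x y => ?_)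
    rw [Cocycle.mul_gOn, Cocycle.one_gOn, one_mul]
  mul_one := by
    rintro ⟨a⟩
    refine Quotient.sound (Cocycle.equivalent_of_gOn_eq a.U a.mem
      (fun _ => le_inf le_rfl le_top) (fun _ => le_rfl) fun x y => ?_)
    rw [Cocycle.mul_gOn, Cocycle.one_gOn, mul_one]
  inv_mul_cancel := by
    rintro ⟨a⟩
    refine Quotient.sound (Cocycle.equivalent_of_gOn_eq a.U a.mem
      (fun _ => le_inf le_rfl le_rfl) (fun _ => le_top) fun x y => ?_)
    rw [Cocycle.mul_gOn, Cocycle.one_gOn, Cocycle.inv_gOn, inv_mul_cancel]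
  mul_comm := by
    rintro ⟨a⟩ ⟨b⟩
    refine Quotient.sound (Cocycle.equivalent_of_gOn_eq
      (fun x => a.U x ⊓ b.U x) (fun x => ⟨a.mem x, b.mem x⟩) (fun _ => le_rfl)
      (fun _ => inf_comm _ _ |>.le) fun x y => ?_)
    rw [Cocycle.mul_gOn, Cocycle.mul_gOn, mul_comm]

/-- Pull-back of line bundles along a morphism `f`; restriction, if `f` is the inclusion of a
subscheme. -/
noncomputable def pullback (f : X ⟶ Y) : Pic Y →* Pic X :=
  MonoidHom.mk' (Quotient.map (Cocycle.pullback f) fun _ _ h => Cocycle.pullback_equivalent f h) <| by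
    rintro ⟨a⟩ ⟨b⟩
    refine Quotient.sound (Cocycle.equivalent_of_gOn_eq
      (fun x => ((a.mul b).pullback f).U x) ((a.mul b).pullback f).mem (fun _ => le_rfl)
      (fun _ => le_rfl) fun x y => ?_)
    rw [Cocycle.mul_gOn, Cocycle.pullback_gOn, Cocycle.pullback_gOn, Cocycle.pullback_gOn]
    refine Eq.symm ((map_mul (pullUnits f _ _ _) _ _).trans ?_)
    exact congrArg₂ _ (pullUnits_resUnits _ _ _ _) (pullUnits_resUnits _ _ _ _)

end Pic

/-! ### Divisors of rational sections and intersection numbers -/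

/-- A nonzero rational section of the line bundle given by the cocycle `c`: its local expressions
`s x` in the trivialisation over `U x` are nonzero rational functions that transform by the
transition functions. -/
structure RationalSection {X : Scheme.{0}} [IsIntegral X] (c : Cocycle X) where
  s : X → X.functionField
  ne_zero : ∀ x, s x ≠ 0
  transform : ∀ x y,
    s x = X.presheaf.germ (c.U x ⊓ c.U y) (genericPoint X)
      ⟨((genericPoint_spec X).mem_open_set_iff (c.U x).isOpen).mpr ⟨x, trivial, c.mem x⟩,
        ((genericPoint_spec X).mem_open_set_iff (c.U y).isOpen).mpr ⟨y, trivial, c.mem y⟩⟩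
      (c.g x y : Γ(X, c.U x ⊓ c.U y)) * s y

/-- The multiplicity of the divisor of a rational section along the prime divisor with generic
point `z` (and `0` if `z` is not a point of codimension one). -/
noncomputable def RationalSection.ord {X : Scheme.{0}} [IsIntegral X] [IsLocallyNoetherian X]
    {c : Cocycle X} (s : RationalSection c) (z : X) : ℤ :=
  Scheme.ord (s.s z) z

/-- `L` is the class of the line bundle `𝒪(Z)`, where the closed set `Z`, of pure codimension one,
is regarded as a reduced divisor: `L` has a rational section that vanishes to order one along every
component of `Z` and has no other zeros or poles. -/
def IsClassOfDivisor {X : Scheme.{0}} [IsIntegral X] [IsLocallyNoetherian X] (Z : Set X)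
    (L : Pic X) : Prop :=
  ∃ (c : Cocycle X) (s : RationalSection c), Pic.mk c = L ∧
    ∀ z, Order.coheight z = 1 → (z ∈ Z → s.ord z = 1) ∧ (z ∉ Z → s.ord z = 0)

/-- For an `n`-dimensional integral proper scheme `X` over an algebraically closed field,
`IsIntersectionNumber n X L k` says that `k` is the intersection number of the `n` line bundles
`L 0, …, L (n - 1)` on `X`, that is, the degree of `c₁(L 0) ∩ ⋯ ∩ c₁(L (n - 1)) ∩ [X]`. For `n = 0`
this is the degree `1` of a point; for positive `n` one chooses a rational section `s` of `L 0`,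
and adds up, over the prime divisors `V` of `X`, the multiplicity of `V` in the divisor of `s`
times the intersection number of the restrictions of the other line bundles to `V`. -/
def IsIntersectionNumber : (n : ℕ) → (X : Scheme.{0}) → [IsIntegral X] → [IsLocallyNoetherian X] →
    (Fin n → Pic X) → ℤ → Prop
  | 0, _, _, _, _, k => k = 1
  | n + 1, X, _, _, L, k =>
    ∃ (c : Cocycle X) (s : RationalSection c) (m : X → ℤ), Pic.mk c = L 0 ∧
      (∀ z, s.ord z ≠ 0 →
        ∃ (V : Scheme.{0}) (_ : IsIntegral V) (_ : IsLocallyNoetherian V) (i : V ⟶ X),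
          IsClosedImmersion i ∧ i (genericPoint V) = z ∧
          IsIntersectionNumber n V (fun j => Pic.pullback i (L j.succ)) (m z)) ∧
      k = ∑ᶠ z, s.ord z * m z

/-! ### Pairs -/

/-- A pair `(Y, D)` over `ℂ`: a smooth proper variety `Y` with a reduced divisor `D = ∑ D_v`, whose
components `D_v`, with their reduced scheme structure, are indexed by `I`. -/
structure BoundaryPair (I : Type*) where
  Y : Scheme.{0}
  str : Y ⟶ Spec (CommRingCat.of ℂ)
  isIntegral : IsIntegral Y
  isProper : IsProper str
  smooth : Smooth str
  /-- the components `D_v` -/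
  comp : I → Scheme.{0}
  /-- the inclusions of the components in `Y` -/
  incl : ∀ v, comp v ⟶ Y
  comp_isIntegral : ∀ v, IsIntegral (comp v)
  isClosedImmersion : ∀ v, IsClosedImmersion (incl v)
  codim_one : ∀ v, Order.coheight (incl v (genericPoint (comp v))) = 1
  range_injective : Function.Injective fun v => Set.range (incl v)

namespace BoundaryPair

variable {I : Type*} (P : BoundaryPair I)

instance : IsIntegral P.Y := P.isIntegral

instance : IsProper P.str := P.isProper

instance (v : I) : IsIntegral (P.comp v) := P.comp_isIntegral v

instance (v : I) : IsClosedImmersion (P.incl v) := P.isClosedImmersion v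

instance : IsLocallyNoetherian P.Y := LocallyOfFiniteType.isLocallyNoetherian P.str

instance (v : I) : IsLocallyNoetherian (P.comp v) :=
  LocallyOfFiniteType.isLocallyNoetherian (P.incl v)

/-- The stratum `⋂ D_v` of the divisor, where `v` runs through `S`. -/
def stratum (S : Finset I) : Set P.Y := ⋂ v ∈ S, Set.range (P.incl v)

/-- The dual complex `Σ_D`: its vertices are the components of `D`, and a finite set of components
spans a simplex if and only if the components have a common point. (This is the dual complex
of a simple normal crossing divisor all of whose nonempty strata are irreducible, such as the
boundary of a smooth toric variety.) -/
def dualComplex : Set (Finset I) := {S | S.Nonempty ∧ (P.stratum S).Nonempty}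

/-- The double curve `D_v ∩ D_w`, as a subset of the component `D_v`. -/
def doubleCurve (v w : I) : Set (P.comp v) := P.incl v ⁻¹' Set.range (P.incl w)

end BoundaryPair

/-- An isomorphism of pairs `f : (Y, D) ⟶ (Y', D')` over `ℂ` that maps the component `D_v` to the
component `D'_v`, for every `v`; it consists of `f` and the restrictions `f_v : D_v ⟶ D'_v`. -/
structure PairIso {I : Type*} (P P' : BoundaryPair I) where
  f : P.Y ≅ P'.Y
  f_str : f.hom ≫ P'.str = P.str
  comp : ∀ v, P.comp v ≅ P'.comp v
  comp_incl : ∀ v, (comp v).hom ≫ P'.incl v = P.incl v ≫ f.hom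

/-! ### Toric varieties -/

/-- The cone in `ℝ³` spanned by a finite set of vectors in `ℤ³`. -/
def coneSpan (σ : Finset (Fin 3 → ℤ)) : Set (Fin 3 → ℝ) :=
  {x | ∃ a : (Fin 3 → ℤ) → ℝ, (∀ v ∈ σ, 0 ≤ a v) ∧ x = ∑ v ∈ σ, a v • fun i => (v i : ℝ)}

/-- A smooth complete fan in the lattice `N = ℤ³`. Every cone is spanned by a part of a basis of
`N`, and it is recorded by this set of primitive generators; the faces of the cone are then the
cones that are spanned by the subsets. -/
structure SmoothCompleteFan where
  cones : Finset (Finset (Fin 3 → ℤ))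
  smooth : ∀ σ ∈ cones, ∃ b : Module.Basis (Fin 3) ℤ (Fin 3 → ℤ), ∀ v ∈ σ, v ∈ Set.range b
  face_mem : ∀ σ ∈ cones, ∀ τ ⊆ σ, τ ∈ cones
  inter : ∀ σ ∈ cones, ∀ τ ∈ cones, coneSpan σ ∩ coneSpan τ = coneSpan (σ ∩ τ)
  complete : ∀ x, ∃ σ ∈ cones, x ∈ coneSpan σ

/-- The semigroup `S_σ` of those `m` in the dual lattice `M = ℤ³` that are nonnegative on the
cone `σ`. -/
def dualSemigroup (σ : Finset (Fin 3 → ℤ)) : AddSubmonoid (Fin 3 → ℤ) where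
  carrier := {m | ∀ v ∈ σ, 0 ≤ m ⬝ᵥ v}
  zero_mem' _ _ := by simp
  add_mem' ha hb v hv := by
    rw [add_dotProduct]
    exact add_nonneg (ha v hv) (hb v hv)

theorem dualSemigroup_anti {σ τ : Finset (Fin 3 → ℤ)} (h : τ ⊆ σ) :
    dualSemigroup σ ≤ dualSemigroup τ :=
  fun _ hm v hv => hm v (h hv)

/-- The affine toric variety `U_σ = Spec ℂ[S_σ]`; for `σ = ∅` (the zero cone) it is the torus. -/
noncomputable def affineChart (σ : Finset (Fin 3 → ℤ)) : Scheme.{0} :=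
  Spec (CommRingCat.of (AddMonoidAlgebra ℂ (dualSemigroup σ)))

/-- The structure morphism of `U_σ` over `ℂ`. -/
noncomputable def affineChartStr (σ : Finset (Fin 3 → ℤ)) :
    affineChart σ ⟶ Spec (CommRingCat.of ℂ) :=
  Spec.map (CommRingCat.ofHom (algebraMap ℂ (AddMonoidAlgebra ℂ (dualSemigroup σ))))

/-- The inclusion of `U_τ` in `U_σ`, for a face `τ` of `σ`. -/
noncomputable def affineChartMap {σ τ : Finset (Fin 3 → ℤ)} (h : τ ⊆ σ) :
    affineChart τ ⟶ affineChart σ :=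
  Spec.map (CommRingCat.ofHom
    (AddMonoidAlgebra.mapDomainRingHom ℂ (AddSubmonoid.inclusion (dualSemigroup_anti h))))

/-- The data that present `Y` as the toric variety of the fan `F`: an open covering of `Y` by the
affine toric varieties `U_σ` of the cones of `F`, where `U_σ` and `U_τ` are glued
along `U_{σ ∩ τ}`. -/
structure ToricAtlas (F : SmoothCompleteFan) {Y : Scheme.{0}}
    (str : Y ⟶ Spec (CommRingCat.of ℂ)) where
  chart : ∀ σ ∈ F.cones, affineChart σ ⟶ Y
  isOpenImmersion : ∀ σ hσ, IsOpenImmersion (chart σ hσ)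
  chart_str : ∀ σ hσ, chart σ hσ ≫ str = affineChartStr σ
  chart_face : ∀ σ hσ τ (h : τ ⊆ σ),
    affineChartMap h ≫ chart σ hσ = chart τ (F.face_mem σ hσ τ h)
  chart_inter : ∀ σ hσ τ hτ, Set.range (chart σ hσ) ∩ Set.range (chart τ hτ) =
    Set.range (chart (σ ∩ τ) (F.face_mem σ hσ _ Finset.inter_subset_left))
  covers : ∀ y : Y, ∃ σ hσ, y ∈ Set.range (chart σ hσ)

theorem SmoothCompleteFan.empty_mem (F : SmoothCompleteFan) : ∅ ∈ F.cones := by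
  obtain ⟨σ, hσ, -⟩ := F.complete 0
  exact F.face_mem σ hσ ∅ (Finset.empty_subset σ)

/-- `(Y, D)` is a toric pair of dimension three: `Y` is the toric variety of a smooth complete fan
in `ℤ³`, and `D` is its toric boundary, the complement of the torus. -/
def BoundaryPair.IsToricThreefold {I : Type*} (P : BoundaryPair I) : Prop :=
  ∃ (F : SmoothCompleteFan) (A : ToricAtlas F P.str),
    ⋃ v, Set.range (P.incl v) = (Set.range (A.chart ∅ F.empty_mem))ᶜ

end LogCY

/-! The Picard group of a smooth complete toric variety is `ℤ^I / M`. Here `I` indexes the boundary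
components, and the character lattice `M` embeds in `ℤ^I` by the orders of vanishing of its
characters; the embedding is injective because the fan is complete. Since `μ` sends each `[D_v]` to
`[D'_v]`, the two maps from `ℤ^I` to the Picard groups have the same kernel. So the lattices `M` and
`M'` have the same image in `ℤ^I` and are isomorphic compatibly with all rays
(`exists_addEquiv_lattice`). The cones are the simplices of the dual complex (`mem_cones_iff`), so
both varieties carry an atlas for one and the same fan. Gluing the identities of the charts gives
`f` and the `f_v` (`exists_pairIso`).

Pull-back along `f` sends `[D'_v]` to `[D_v]`. As these classes generate (`toricCls_surjective`), it
is inverse to `μ`. The same argument applies to every `D_v`: it is toric for the star of `v`, its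
character lattice is the kernel of the pairing with `v`, and its Picard group is generated by the
double curves. The notion `TAtlas` leaves the dimension open so that it serves `Y` and the `D_v`
alike.

The main work is the presentation of the Picard group. Line bundles given by cocycles are turned
into Cartier divisors (`cls`). On a chart such a divisor is principal because the coordinate ring is
a unique factorization domain (`exists_locUnit_mul`, `IsSmoothCone.uniqueFactorizationMonoid`).
Rational functions without zeros or poles on the torus are monomials (`exists_single_of_isUnit`), so
the equations on different charts differ by characters up to units. -/

namespace LogCY

/-! ### Line bundles as Cartier divisors on an integral scheme. -/

section Cartier

variable {X : Scheme.{0}} [IsIntegral X]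

/-- The rational functions that are invertible at the point `x`. -/
noncomputable def unitsAt (x : X) : Subgroup (X.functionField)ˣ :=
  (Units.map (algebraMap (X.presheaf.stalk x) X.functionField).toMonoidHom).range

theorem genericPoint_mem {U : X.Opens} {x : X} (hx : x ∈ U) : genericPoint X ∈ U :=
  ((genericPoint_spec X).mem_open_set_iff U.isOpen).mpr ⟨x, trivial, hx⟩

theorem genericPoint_mem_inf {U V : X.Opens} (hU : genericPoint X ∈ U) (hV : genericPoint X ∈ V) :
    genericPoint X ∈ U ⊓ V := ⟨hU, hV⟩

/-- An invertible function on a nonempty open set, as a rational function. -/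
noncomputable def germUnits (U : X.Opens) (h : genericPoint X ∈ U) :
    Γ(X, U)ˣ →* (X.functionField)ˣ :=
  Units.map (X.presheaf.germ U (genericPoint X) h).hom

theorem germUnits_resUnits {U V : X.Opens} (h : V ≤ U) (hV : genericPoint X ∈ V) (a : Γ(X, U)ˣ) :
    germUnits V hV (resUnits h a) = germUnits U (h hV) a := by
  ext
  exact X.presheaf.germ_res_apply (homOfLE h) _ hV _

theorem germUnits_injective (U : X.Opens) (h : genericPoint X ∈ U) :
    Function.Injective (germUnits U h) := by
  intro a b hab
  ext
  exact germ_injective_of_isIntegral X (U := U) _ h (congrArg Units.val hab)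

theorem germUnits_mem_unitsAt {U : X.Opens} (h : genericPoint X ∈ U) (a : Γ(X, U)ˣ) {x : X}
    (hx : x ∈ U) : germUnits U h a ∈ unitsAt x := by
  refine ⟨Units.map (X.presheaf.germ U x hx).hom a, ?_⟩
  ext
  have : Nonempty U := ⟨⟨x, hx⟩⟩
  exact Scheme.algebraMap_germ_eq_germToFunctionField X hx _

/-- A unit of the stalk is the germ of a section, and this section is invertible on its basic open
set. -/
theorem exists_germUnits_of_mem_unitsAt {x : X} {k : (X.functionField)ˣ} (hk : k ∈ unitsAt x) :
    ∃ (U : X.Opens) (hx : x ∈ U) (a : Γ(X, U)ˣ), germUnits U (genericPoint_mem hx) a = k := by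
  obtain ⟨u, rfl⟩ := hk
  obtain ⟨U, hx, a, ha⟩ := X.presheaf.exists_germ_eq (x := x) (u : X.presheaf.stalk x)
  have hu : IsUnit (X.presheaf.germ U x hx a) := ha ▸ u.isUnit
  have hxV : x ∈ X.basicOpen a := (Scheme.mem_basicOpen X a x hx).2 hu
  have hb := RingedSpace.isUnit_res_basicOpen X.toRingedSpace a
  refine ⟨X.basicOpen a, hxV, hb.unit, ?_⟩
  ext
  have : Nonempty (X.basicOpen a) := ⟨⟨x, hxV⟩⟩
  have : Nonempty U := ⟨⟨x, hx⟩⟩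
  refine (X.presheaf.germ_res_apply (homOfLE (X.basicOpen_le a)) _ _ _).trans ?_
  refine (Scheme.algebraMap_germ_eq_germToFunctionField X hx a).symm.trans ?_
  rw [ha]
  rfl

theorem exists_open_unitsAt {x : X} {k : (X.functionField)ˣ} (hk : k ∈ unitsAt x) :
    ∃ U : X.Opens, x ∈ U ∧ ∀ y ∈ U, k ∈ unitsAt y := by
  obtain ⟨U, hx, a, rfl⟩ := exists_germUnits_of_mem_unitsAt hk
  exact ⟨U, hx, fun y hy => germUnits_mem_unitsAt _ a hy⟩

theorem unitsAt_mono {x y : X} (h : y ⤳ x) : unitsAt x ≤ unitsAt y := by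
  intro k hk
  obtain ⟨U, hx, hU⟩ := exists_open_unitsAt hk
  exact hU y (h.mem_open U.isOpen hx)

/-- A rational function that is invertible at every point of `U` is an invertible function
on `U`. -/
theorem exists_germUnits_eq {U : X.Opens} (h : genericPoint X ∈ U) {k : (X.functionField)ˣ}
    (hk : ∀ x ∈ U, k ∈ unitsAt x) : ∃ a : Γ(X, U)ˣ, germUnits U h a = k := by
  -- Gluing only produces a section; applied to `k` and to `k⁻¹` it produces two mutually inverse
  -- ones.
  suffices H : ∀ k : (X.functionField)ˣ, (∀ x ∈ U, k ∈ unitsAt x) →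
      ∃ a : Γ(X, U), X.presheaf.germ U _ h a = (k : X.functionField) by
    obtain ⟨a, ha⟩ := H k hk
    obtain ⟨b, hb⟩ := H k⁻¹ fun x hx => inv_mem (hk x hx)
    have hab : a * b = 1 := by
      apply germ_injective_of_isIntegral X (U := U) _ h
      rw [map_mul, ha, hb, map_one, Units.mul_inv]
    exact ⟨Units.mkOfMulEqOne a b hab, Units.ext ha⟩
  intro k hk
  choose V hxV a ha using fun x : U => exists_germUnits_of_mem_unitsAt (hk x x.2)
  let W : U → X.Opens := fun x => V x ⊓ U
  obtain ⟨s, hs, -⟩ := TopCat.Sheaf.existsUnique_gluing' X.sheaf W U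
    (fun x => homOfLE inf_le_right)
    (fun x hx => TopologicalSpace.Opens.mem_iSup.2 ⟨⟨x, hx⟩, hxV ⟨x, hx⟩, hx⟩)
    (fun x => (resUnits (inf_le_left : W x ≤ V x) (a x) : Γ(X, W x))) (by
      intro x y
      have hη : genericPoint X ∈ W x ⊓ W y :=
        ⟨⟨genericPoint_mem (hxV x), h⟩, ⟨genericPoint_mem (hxV y), h⟩⟩
      have e := (germUnits_injective _ hη).eq_iff.1 (show
        germUnits _ hη (resUnits (inf_le_left : W x ⊓ W y ≤ W x) (resUnits inf_le_left (a x))) =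
        germUnits _ hη (resUnits (inf_le_right : W x ⊓ W y ≤ W y) (resUnits inf_le_left (a y))) by
          simp only [germUnits_resUnits, ha])
      exact congrArg Units.val e)
  refine ⟨s, ?_⟩
  let x : U := ⟨_, h⟩
  have hη : genericPoint X ∈ W x := ⟨hxV x, h⟩
  have := congrArg (X.presheaf.germ (W x) _ hη) (hs x)
  refine (X.presheaf.germ_res_apply (homOfLE inf_le_right) _ hη s).symm.trans (this.trans ?_)
  exact (congrArg Units.val (germUnits_resUnits inf_le_left hη (a x))).trans
    (congrArg Units.val (ha x))

/-- Cartier divisors: families of local equations. -/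
noncomputable def CDiv (X : Scheme.{0}) [IsIntegral X] : Subgroup (X → (X.functionField)ˣ) where
  carrier := {D | ∀ x, ∃ U : X.Opens, x ∈ U ∧ ∀ y ∈ U, D y / D x ∈ unitsAt y}
  one_mem' x := ⟨⊤, trivial, fun y _ => by simp⟩
  mul_mem' {D E} hD hE x := by
    obtain ⟨U, hx, hU⟩ := hD x
    obtain ⟨V, hx', hV⟩ := hE x
    refine ⟨U ⊓ V, ⟨hx, hx'⟩, fun y hy => ?_⟩
    rw [Pi.mul_apply, Pi.mul_apply, mul_div_mul_comm]
    exact mul_mem (hU y hy.1) (hV y hy.2)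
  inv_mem' {D} hD x := by
    obtain ⟨U, hx, hU⟩ := hD x
    refine ⟨U, hx, fun y hy => ?_⟩
    rw [Pi.inv_apply, Pi.inv_apply, inv_div_inv, ← inv_div]
    exact inv_mem (hU y hy)

/-- The family `D` of rational functions is a rational section of `c`. -/
def IsSec (c : Cocycle X) (D : X → (X.functionField)ˣ) : Prop :=
  ∀ x y, D x = germUnits (c.U x ⊓ c.U y)
    (genericPoint_mem_inf (genericPoint_mem (c.mem x)) (genericPoint_mem (c.mem y))) (c.g x y) * D y

namespace IsSec

variable {c d : Cocycle X} {D E : X → (X.functionField)ˣ}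

theorem germUnits_gOn (h : IsSec c D) (x y : X) {W : X.Opens} (hx : W ≤ c.U x) (hy : W ≤ c.U y)
    (hW : genericPoint X ∈ W) : germUnits W hW (c.gOn x y W hx hy) = D x / D y := by
  rw [Cocycle.gOn, germUnits_resUnits, eq_div_iff_mul_eq']
  exact (h x y).symm

theorem mem_cDiv (h : IsSec c D) : D ∈ CDiv X := fun x => ⟨c.U x, c.mem x, fun y hy => by
  rw [h y x, mul_div_cancel_right]
  exact germUnits_mem_unitsAt _ _ ⟨c.mem y, hy⟩⟩

theorem mul (h : IsSec c D) (h' : IsSec d E) : IsSec (c.mul d) (D * E) := by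
  intro x y
  have hW : genericPoint X ∈ (c.mul d).U x ⊓ (c.mul d).U y :=
    genericPoint_mem_inf (genericPoint_mem ((c.mul d).mem x)) (genericPoint_mem ((c.mul d).mem y))
  have e := h.germUnits_gOn x y (inf_le_left.trans inf_le_left) (inf_le_right.trans inf_le_left) hW
  have e' := h'.germUnits_gOn x y (inf_le_left.trans inf_le_right)
    (inf_le_right.trans inf_le_right) hW
  rw [eq_div_iff_mul_eq'] at e e'
  refine Eq.trans ?_ (congrArg (· * (D y * E y)) (map_mul (germUnits _ hW) _ _).symm)
  refine Eq.trans ?_ (mul_mul_mul_comm _ _ _ _).symm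
  exact congrArg₂ (· * ·) e.symm e'.symm

theorem one : IsSec (Cocycle.one X) 1 := fun x y => by
  change _ = germUnits _ _ 1 * _
  rw [map_one, one_mul]
  rfl

/-- A nonzero rational section, as it occurs in the definition of divisor classes. -/
noncomputable def toRationalSection (h : IsSec c D) : RationalSection c where
  s x := D x
  ne_zero x := (D x).ne_zero
  transform x y := congrArg Units.val (h x y)

end IsSec

/-- The transition functions to the trivialisation at the generic point form a rational section: the
transformation rule is the cocycle condition with the generic point as third index. -/
theorem Cocycle.exists_isSec (c : Cocycle X) : ∃ D, IsSec c D := by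
  refine ⟨fun x => germUnits (c.U x ⊓ c.U (genericPoint X))
    (genericPoint_mem_inf (genericPoint_mem (c.mem x)) (c.mem _)) (c.g x (genericPoint X)), fun x y => ?_⟩
  have hW : genericPoint X ∈ c.U x ⊓ c.U y ⊓ c.U (genericPoint X) :=
    genericPoint_mem_inf (genericPoint_mem_inf (genericPoint_mem (c.mem x))
      (genericPoint_mem (c.mem y))) (c.mem _)
  have := congrArg (germUnits _ hW) (c.cocycle x y (genericPoint X))
  simp only [map_mul, germUnits_resUnits] at this
  exact this.symm

/-- The quotients `D x / D y` are invertible at all points of the overlaps, hence are invertible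
sections there. The cocycle condition can be checked in the function field. -/
theorem exists_cocycle_isSec {D : X → (X.functionField)ˣ} (hD : D ∈ CDiv X) :
    ∃ c, IsSec c D := by
  choose U hU h using hD
  have hη : ∀ x, genericPoint X ∈ U x := fun x => genericPoint_mem (hU x)
  have key : ∀ x y, ∃ a : Γ(X, U x ⊓ U y)ˣ,
      germUnits (U x ⊓ U y) (genericPoint_mem_inf (hη x) (hη y)) a = D x / D y := by
    intro x y
    refine exists_germUnits_eq _ fun z hz => ?_
    rw [← div_div_div_cancel_left]
    exact div_mem (h y z hz.2) (h x z hz.1)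
  choose g hg using key
  refine ⟨⟨U, hU, g, fun x y z => ?_⟩, fun x y => ?_⟩
  · apply germUnits_injective _ (genericPoint_mem_inf (genericPoint_mem_inf (hη x) (hη y)) (hη z))
    simp only [map_mul, germUnits_resUnits, hg]
    rw [div_mul_div_cancel]
  · exact (div_eq_iff_eq_mul.1 (hg x y).symm)

/-- In the function field the coboundary relation says that `D x / E x * h x` does not depend on
`x`. Its inverse is the required global `f`, and conversely `h x` is the inverse of `D x / E x * f`.
-/
theorem IsSec.equivalent_iff {c d : Cocycle X} {D E : X → (X.functionField)ˣ} (hc : IsSec c D)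
    (hd : IsSec d E) : Cocycle.Equivalent c d ↔ ∃ f, ∀ x, D x / E x * f ∈ unitsAt x := by
  constructor
  · rintro ⟨W, hW, hWc, hWd, h, H⟩
    have hη : ∀ x, genericPoint X ∈ W x := fun x => genericPoint_mem (hW x)
    have key : ∀ x y, D x / E x * germUnits _ (hη x) (h x) = D y / E y * germUnits _ (hη y) (h y) := by
      intro x y
      have := congrArg (germUnits _ (genericPoint_mem_inf (hη x) (hη y))) (H x y)
      simp only [map_mul, germUnits_resUnits, hc.germUnits_gOn, hd.germUnits_gOn] at this
      rw [div_mul_eq_mul_div, mul_comm (germUnits _ _ _), div_mul_eq_mul_div,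
        div_eq_div_iff_mul_eq_mul] at this
      rw [div_mul_eq_mul_div, div_mul_eq_mul_div, div_eq_div_iff_mul_eq_mul]
      rw [← this]
      simp only [mul_comm, mul_left_comm]
    refine ⟨(D (genericPoint X) / E (genericPoint X) * germUnits _ (hη _) (h (genericPoint X)))⁻¹,
      fun x => ?_⟩
    rw [← key x, mul_inv, mul_inv_cancel_left]
    exact inv_mem (germUnits_mem_unitsAt _ _ (hW x))
  · rintro ⟨f, hf⟩
    have key : ∀ x, ∃ W : X.Opens, x ∈ W ∧ W ≤ c.U x ∧ W ≤ d.U x ∧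
        ∀ y ∈ W, D x / E x * f ∈ unitsAt y := by
      intro x
      obtain ⟨W, hW, h⟩ := exists_open_unitsAt (hf x)
      exact ⟨W ⊓ (c.U x ⊓ d.U x), ⟨hW, c.mem x, d.mem x⟩, inf_le_right.trans inf_le_left,
        inf_le_right.trans inf_le_right, fun y hy => h y hy.1⟩
    choose W hW hWc hWd h using key
    have hη : ∀ x, genericPoint X ∈ W x := fun x => genericPoint_mem (hW x)
    choose u hu using fun x => exists_germUnits_eq (hη x) (h x)
    refine ⟨W, hW, hWc, hWd, fun x => (u x)⁻¹, fun x y => ?_⟩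
    apply germUnits_injective _ (genericPoint_mem_inf (hη x) (hη y))
    simp only [map_mul, map_inv, germUnits_resUnits, hc.germUnits_gOn, hd.germUnits_gOn, hu,
      mul_inv, inv_div]
    rw [← mul_assoc, div_mul_div_cancel, mul_right_comm, div_mul_div_cancel]

/-- The line bundle of a Cartier divisor. -/
noncomputable def cls : CDiv X →* Pic X :=
  MonoidHom.mk' (fun D => Pic.mk (exists_cocycle_isSec D.2).choose) fun D E => by
    refine Quotient.sound (((exists_cocycle_isSec (D * E).2).choose_spec.equivalent_iff
      ((exists_cocycle_isSec D.2).choose_spec.mul (exists_cocycle_isSec E.2).choose_spec)).2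
      ⟨1, fun x => ?_⟩)
    simp

theorem IsSec.cls_eq {c : Cocycle X} {D : CDiv X} (h : IsSec c D.1) : cls D = Pic.mk c :=
  Quotient.sound (((exists_cocycle_isSec D.2).choose_spec.equivalent_iff h).2
    ⟨1, fun x => by simp⟩)

theorem cls_surjective : Function.Surjective (cls : CDiv X →* Pic X) := by
  rintro ⟨c⟩
  obtain ⟨D, hD⟩ := c.exists_isSec
  exact ⟨⟨D, hD.mem_cDiv⟩, hD.cls_eq⟩

theorem cls_eq_one_iff {D : CDiv X} : cls D = 1 ↔ ∃ f, ∀ x, D.1 x * f ∈ unitsAt x := by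
  obtain ⟨c, hc⟩ := exists_cocycle_isSec D.2
  rw [hc.cls_eq]
  refine Iff.trans ⟨fun h => Quotient.exact h, fun h => Quotient.sound h⟩
    ((hc.equivalent_iff IsSec.one).trans ?_)
  simp

theorem cls_eq_cls {D E : CDiv X} (h : ∃ f, ∀ x, D.1 x / E.1 x * f ∈ unitsAt x) :
    cls D = cls E := by
  rw [← div_eq_one, ← map_div, cls_eq_one_iff]
  exact h

theorem isClassOfDivisor_cls [IsLocallyNoetherian X] {Z : Set X} {D : CDiv X}
    (h : ∀ z, Order.coheight z = 1 →
      (z ∈ Z → Scheme.ord (D.1 z : X.functionField) z = 1) ∧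
      (z ∉ Z → Scheme.ord (D.1 z : X.functionField) z = 0)) : IsClassOfDivisor Z (cls D) := by
  obtain ⟨c, hc⟩ := exists_cocycle_isSec D.2
  exact ⟨c, hc.toRationalSection, hc.cls_eq.symm, h⟩

end Cartier

/-! ### Pull-back of Cartier divisors along dominant morphisms. -/

section Pullback

variable {X Y : Scheme.{0}} [IsIntegral X] [IsIntegral Y] (f : X ⟶ Y)
  (hf : f (genericPoint X) = genericPoint Y)

/-- Pull-back of rational functions along a dominant morphism. -/
noncomputable def pullFun : Y.functionField →+* X.functionField :=
  (Y.presheaf.stalkSpecializes (specializes_of_eq hf) ≫ f.stalkMap (genericPoint X)).hom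

theorem pullFun_germ {U : Y.Opens} {V : X.Opens} (h : V ≤ f ⁻¹ᵁ U) (hV : genericPoint X ∈ V)
    (hU : genericPoint Y ∈ U) (a : Γ(Y, U)) :
    pullFun f hf (Y.presheaf.germ U _ hU a) = X.presheaf.germ V _ hV (f.appLE U V h a) := by
  have : Y.presheaf.germ U _ hU ≫ Y.presheaf.stalkSpecializes (specializes_of_eq hf) ≫
      f.stalkMap (genericPoint X) = f.appLE U V h ≫ X.presheaf.germ V _ hV := by
    rw [← Category.assoc, TopCat.Presheaf.germ_stalkSpecializes, Scheme.Hom.germ_stalkMap,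
      Scheme.Hom.appLE, Category.assoc, TopCat.Presheaf.germ_res]
  exact congr($this a)

theorem IsSec.pullback {c : Cocycle Y} {D : Y → (Y.functionField)ˣ} (h : IsSec c D) :
    IsSec (c.pullback f) fun x => Units.map (pullFun f hf).toMonoidHom (D (f x)) := by
  intro x y
  refine (congrArg _ (h (f x) (f y))).trans ((map_mul _ _ _).trans ?_)
  congr 1
  ext
  exact pullFun_germ f hf _ _ _ _

theorem pullback_cls {D : CDiv Y} {E : CDiv X}
    (h : ∀ x, Units.map (pullFun f hf).toMonoidHom (D.1 (f x)) = E.1 x) :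
    Pic.pullback f (cls D) = cls E := by
  obtain ⟨c, hc⟩ := exists_cocycle_isSec D.2
  have := hc.pullback f hf
  rw [hc.cls_eq, IsSec.cls_eq (c := c.pullback f) (D := E) (by convert! this using 1; ext1 x; exact (h x).symm)]
  rfl

end Pullback

/-! ### Locally principal divisors over a unique factorization domain. -/

section LocallyPrincipal

variable {R K : Type*} [CommRing R] [Field K] [Algebra R K]

/-- The element `k` of the fraction field is invertible in the local ring at `P`. -/
def LocUnit (P : PrimeSpectrum R) (k : K) : Prop :=
  ∃ a b, a ∉ P.asIdeal ∧ b ∉ P.asIdeal ∧ k * algebraMap R K b = algebraMap R K a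

/-- The element `k` of the fraction field belongs to the local ring at `P`. -/
def LocReg (P : PrimeSpectrum R) (k : K) : Prop :=
  ∃ a b, b ∉ P.asIdeal ∧ k * algebraMap R K b = algebraMap R K a

theorem mul_notMem {P : PrimeSpectrum R} {a b : R} (ha : a ∉ P.asIdeal) (hb : b ∉ P.asIdeal) :
    a * b ∉ P.asIdeal :=
  fun h => (P.isPrime.mem_or_mem h).elim ha hb

theorem LocUnit.locReg {P : PrimeSpectrum R} {k : K} (h : LocUnit P k) : LocReg P k := by
  obtain ⟨a, b, -, hb, e⟩ := h
  exact ⟨a, b, hb, e⟩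

theorem LocReg.mul {P : PrimeSpectrum R} {k l : K} (hk : LocReg P k) (hl : LocReg P l) :
    LocReg P (k * l) := by
  obtain ⟨a, b, hb, e⟩ := hk
  obtain ⟨a', b', hb', e'⟩ := hl
  exact ⟨a * a', b * b', mul_notMem hb hb', by rw [map_mul, map_mul, ← e, ← e']; ring⟩

theorem locReg_algebraMap (P : PrimeSpectrum R) (a : R) : LocReg P (algebraMap R K a) :=
  ⟨a, 1, P.isPrime.one_notMem, by rw [map_one, mul_one]⟩

/-- The ideal of denominators of `k` is contained in no maximal ideal, so it contains `1`. -/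
theorem exists_eq_of_locReg {k : K} (h : ∀ P : PrimeSpectrum R, LocReg P k) :
    ∃ r, algebraMap R K r = k := by
  let I : Ideal R :=
    { carrier := {b | ∃ a, k * algebraMap R K b = algebraMap R K a}
      zero_mem' := ⟨0, by simp⟩
      add_mem' := by
        rintro a b ⟨c, hc⟩ ⟨d, hd⟩
        exact ⟨c + d, by rw [map_add, map_add, mul_add, hc, hd]⟩
      smul_mem' := by
        rintro c b ⟨a, ha⟩
        exact ⟨c * a, by rw [smul_eq_mul, map_mul, map_mul, mul_left_comm, ha]⟩ }
  have hI : I = ⊤ := by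
    by_contra H
    obtain ⟨P, hP, hle⟩ := Ideal.exists_le_maximal I H
    obtain ⟨a, b, hb, e⟩ := h ⟨P, hP.isPrime⟩
    exact hb (hle ⟨a, e⟩)
  obtain ⟨a, ha⟩ := (Ideal.eq_top_iff_one I).1 hI
  exact ⟨a, by rw [← ha, map_one, mul_one]⟩

variable [IsFractionRing R K]

theorem algebraMap_ne_zero {a : R} (ha : a ≠ 0) : algebraMap R K a ≠ 0 :=
  (map_ne_zero_iff _ (IsFractionRing.injective R K)).2 ha

variable [IsDomain R]

/-- By quasi-compactness finitely many of the `D Q` describe the divisor up to local units; the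
product of their denominators clears all of them. -/
theorem exists_denominator {D : PrimeSpectrum R → K}
    (hD : ∀ P, ∃ U : Set (PrimeSpectrum R), IsOpen U ∧ P ∈ U ∧ ∀ Q ∈ U, LocUnit Q (D Q / D P))
    (h0 : ∀ P, D P ≠ 0) : ∃ b : R, b ≠ 0 ∧ ∀ P, LocReg P (D P * algebraMap R K b) := by
  classical
  choose U hU hPU H using hD
  obtain ⟨t, ht⟩ := isCompact_univ.elim_finite_subcover U hU
    fun P _ => Set.mem_iUnion.2 ⟨P, hPU P⟩
  choose n d hd hnd using fun P => IsFractionRing.div_surjective (A := R) (D P)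
  refine ⟨∏ Q ∈ t, d Q, Finset.prod_ne_zero_iff.2 fun Q _ => nonZeroDivisors.ne_zero (hd Q),
    fun P => ?_⟩
  obtain ⟨Q, hQt, hPQ⟩ := Set.mem_iUnion₂.1 (ht (Set.mem_univ P))
  have e : D P * algebraMap R K (∏ Q ∈ t, d Q) =
      D P / D Q * algebraMap R K (n Q * ∏ Q ∈ t.erase Q, d Q) := by
    rw [← Finset.mul_prod_erase t d hQt, map_mul, map_mul]
    have hdQ : algebraMap R K (d Q) ≠ 0 := algebraMap_ne_zero (nonZeroDivisors.ne_zero (hd Q))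
    have : D Q * algebraMap R K (d Q) = algebraMap R K (n Q) := by
      rw [← hnd Q, div_mul_cancel₀ _ hdQ]
    rw [← this]
    field_simp [h0 Q]
  rw [e]
  exact (H Q P hPQ).locReg.mul (locReg_algebraMap _ _)

/-- Over a unique factorization domain, locally principal divisors are principal. -/
theorem exists_locUnit_mul [UniqueFactorizationMonoid R] {D : PrimeSpectrum R → K}
    (hD : ∀ P, ∃ U : Set (PrimeSpectrum R), IsOpen U ∧ P ∈ U ∧ ∀ Q ∈ U, LocUnit Q (D Q / D P))
    (h0 : ∀ P, D P ≠ 0) : ∃ f : K, f ≠ 0 ∧ ∀ P, LocUnit P (D P * f) := by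
  classical
  obtain ⟨b, hb0, hb⟩ := exists_denominator hD h0
  obtain ⟨c, hc0, hc⟩ : ∃ c : R, c ≠ 0 ∧ ∀ P, LocReg P ((D P)⁻¹ * algebraMap R K c) := by
    refine exists_denominator (D := fun P => (D P)⁻¹) (fun P => ?_) fun P => inv_ne_zero (h0 P)
    obtain ⟨U, hU, hP, H⟩ := hD P
    refine ⟨U, hU, hP, fun Q hQ => ?_⟩
    obtain ⟨x, y, hx, hy, e⟩ := H Q hQ
    refine ⟨y, x, hy, hx, ?_⟩
    rw [← e]
    have := h0 P
    have := h0 Q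
    field_simp
  -- The product `b * c` is split as `f * g`, where dividing `D * b` by `f` must keep it regular. A
  -- minimal `g` means that as much as possible has been divided out; what remains should be a unit
  -- everywhere.
  let G : Set R := {g | ∃ f, f * g = b * c ∧ ∀ P, LocReg P (D P * algebraMap R K b /
    algebraMap R K f)}
  have hG : G.Nonempty := ⟨b * c, 1, one_mul _, fun P => by simpa using hb P⟩
  obtain ⟨g, ⟨f, hfg, hf⟩, hmin⟩ := WellFounded.has_min
    (IsWellFounded.wf (r := DvdNotUnit (α := R))) G hG
  have hfg0 : f * g ≠ 0 := hfg ▸ mul_ne_zero hb0 hc0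
  have hf0 := algebraMap_ne_zero (K := K) (left_ne_zero_of_mul hfg0)
  have hbK := algebraMap_ne_zero (K := K) hb0
  set E : PrimeSpectrum R → K := fun P => D P * algebraMap R K b / algebraMap R K f with hE
  have hE0 : ∀ P, E P ≠ 0 := fun P => div_ne_zero (mul_ne_zero (h0 P) hbK) hf0
  have hEq : ∀ P Q, E Q / E P = D Q / D P := fun P Q => by
    have := h0 P
    simp only [hE]
    field_simp
  -- An open set around `P` contains all generisations of `P`, so local equations can be compared
  -- there.
  have hgen : ∀ P Q, Q ≤ P → LocUnit Q (E Q / E P) := fun P Q h => by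
    obtain ⟨U, hU, hP, H⟩ := hD P
    rw [hEq]
    exact H Q (((PrimeSpectrum.le_iff_specializes Q P).1 h).mem_open hU hP)
  refine ⟨algebraMap R K b / algebraMap R K f, div_ne_zero hbK hf0, fun P => ?_⟩
  rw [← mul_div_assoc]
  obtain ⟨α, β, hβ, hα⟩ := hf P
  by_contra H
  have hαP : α ∈ P.asIdeal := by
    by_contra h
    exact H ⟨α, β, h, hβ, hα⟩
  have hβ0 : β ≠ 0 := fun h => hβ (h ▸ zero_mem _)
  have hα0 : α ≠ 0 := by
    rintro rfl
    rw [map_zero] at hα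
    exact mul_ne_zero (hE0 P) (algebraMap_ne_zero hβ0) hα
  -- If `E P` is not a unit at `P`, its numerator lies in `P`, and then so does one of its prime
  -- factors.
  obtain ⟨π, hπ, hπP, α', rfl⟩ : ∃ π, Prime π ∧ π ∈ P.asIdeal ∧ π ∣ α := by
    obtain ⟨s, hs, u, hu⟩ := UniqueFactorizationMonoid.exists_prime_factors α hα0
    have : s.prod ∈ P.asIdeal := by
      rw [← hu] at hαP
      exact (P.isPrime.mem_or_mem hαP).resolve_right
        fun h => P.isPrime.ne_top (Ideal.eq_top_of_isUnit_mem _ h u.isUnit)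
    obtain ⟨π, hπs, hπP⟩ := (P.isPrime.multiset_prod_mem_iff_exists_mem s).1 this
    exact ⟨π, hs π hπs, hπP, (Multiset.dvd_prod hπs).trans (Dvd.intro _ hu)⟩
  have hπ0 := algebraMap_ne_zero (K := K) hπ.ne_zero
  let ϖ : PrimeSpectrum R := ⟨Ideal.span {π}, (Ideal.span_singleton_prime hπ.ne_zero).2 hπ⟩
  have hϖ : ∀ {Q : PrimeSpectrum R}, π ∈ Q.asIdeal → ϖ ≤ Q := fun {Q} h =>
    (Ideal.span_singleton_le_iff_mem _).2 h
  -- The prime `π` can be divided out at every `Q`, not only at `P`. If `Q` contains `π`, then `P`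
  -- and `Q` share the generisation `(π)`; the equations at `P` and `Q` agree there up to units, so
  -- `π` also divides the numerator at `Q`. Elsewhere `π` is a local unit.
  have hfπ : ∀ Q, LocReg Q (E Q / algebraMap R K π) := by
    intro Q
    obtain ⟨α'', β', hβ', hα''⟩ := hf Q
    by_cases hπQ : π ∈ Q.asIdeal
    · obtain ⟨a₁, b₁, ha₁, hb₁, e₁⟩ := hgen P ϖ (hϖ hπP)
      obtain ⟨a₂, b₂, ha₂, hb₂, e₂⟩ := hgen Q ϖ (hϖ hπQ)
      have hβϖ : β ∉ ϖ.asIdeal := fun h => hβ (hϖ hπP h)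
      have key : α'' * (a₂ * b₁ * β) = π * (α' * a₁ * b₂ * β') := by
        apply IsFractionRing.injective R K
        have h1 := hE0 P
        have h2 := hE0 Q
        have h3 := hE0 ϖ
        simp only [map_mul] at *
        rw [div_mul_eq_mul_div, div_eq_iff h1] at e₁
        rw [div_mul_eq_mul_div, div_eq_iff h2] at e₂
        apply mul_left_cancel₀ h3
        linear_combination (- E ϖ * (algebraMap R K) a₂ * (algebraMap R K) b₁ * (algebraMap R K) β) * hα'' +
          (E ϖ * (algebraMap R K) a₁ * (algebraMap R K) b₂ * (algebraMap R K) β') * hα +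
          (- E ϖ * (algebraMap R K) b₁ * (algebraMap R K) β * (algebraMap R K) β') * e₂ +
          (E ϖ * (algebraMap R K) b₂ * (algebraMap R K) β * (algebraMap R K) β') * e₁
      have : π ∣ α'' := by
        refine (hπ.dvd_or_dvd (Dvd.intro _ key.symm)).resolve_right fun h => ?_
        exact mul_notMem (mul_notMem ha₂ hb₁) hβϖ (Ideal.mem_span_singleton.2 h)
      obtain ⟨γ, rfl⟩ := this
      refine ⟨γ, β', hβ', ?_⟩
      rw [div_mul_eq_mul_div, hα'', map_mul, mul_div_cancel_left₀ _ hπ0]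
    · refine ⟨α'', β' * π, mul_notMem hβ' hπQ, ?_⟩
      change E Q * _ = _ at hα''
      rw [← hα'', map_mul]
      field_simp
  -- The element `c` bounds what can be divided out: `b * c / (f * π)` is the product of the regular
  -- functions `c / D` and `E / π`. It is a proper divisor of `g`, against minimality.
  obtain ⟨g', hg'⟩ : ∃ g', algebraMap R K g' = algebraMap R K (b * c) / algebraMap R K (f * π) := by
    refine exists_eq_of_locReg fun Q => ?_
    have e : algebraMap R K (b * c) / algebraMap R K (f * π) =
        (D Q)⁻¹ * algebraMap R K c * (E Q / algebraMap R K π) := by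
      have := h0 Q
      simp only [hE, map_mul]
      field_simp
    rw [e]
    exact (hc Q).mul (hfπ Q)
  have hg'' : f * π * g' = b * c := by
    apply IsFractionRing.injective R K
    rw [map_mul _ (f * π), hg', mul_div_cancel₀]
    exact algebraMap_ne_zero (mul_ne_zero (left_ne_zero_of_mul hfg0) hπ.ne_zero)
  refine hmin g' ⟨f * π, hg'', fun Q => ?_⟩ ⟨?_, π, hπ.not_isUnit, ?_⟩
  · rw [map_mul, ← div_div]
    exact hfπ Q
  · rintro rfl
    rw [mul_zero] at hg''
    exact mul_ne_zero hb0 hc0 hg''.symm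
  · apply mul_left_cancel₀ (left_ne_zero_of_mul hfg0)
    rw [hfg, ← hg'', mul_assoc, mul_comm π]

end LocallyPrincipal

/-! ### Semigroup rings of smooth cones. -/

section CoordRing

variable {J J' : Type*} {M M' : Type} [AddCommGroup M] [AddCommGroup M']

/-- The semigroup of lattice points that are nonnegative on the rays of the cone `s`. -/
def dualSG (p : J → M →+ ℤ) (s : Finset J) : AddSubmonoid M where
  carrier := {m | ∀ j ∈ s, 0 ≤ p j m}
  zero_mem' _ _ := by simp
  add_mem' ha hb j hj := by
    rw [map_add]
    exact add_nonneg (ha j hj) (hb j hj)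

theorem mem_dualSG {p : J → M →+ ℤ} {s : Finset J} {m : M} :
    m ∈ dualSG p s ↔ ∀ j ∈ s, 0 ≤ p j m :=
  Iff.rfl

theorem dualSG_anti (p : J → M →+ ℤ) {s t : Finset J} (h : t ⊆ s) : dualSG p s ≤ dualSG p t :=
  fun _ hm j hj => hm j (h hj)

/-- The coordinate ring of the affine toric variety of the cone `s`. -/
abbrev CoordRing (p : J → M →+ ℤ) (s : Finset J) : Type := AddMonoidAlgebra ℂ (dualSG p s)

/-- The cone `s` is spanned by a part of a basis of the lattice. -/
def IsSmoothCone (p : J → M →+ ℤ) (s : Finset J) : Prop :=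
  ∃ (ι : Type) (_ : Finite ι) (b : M ≃+ (ι → ℤ)) (i : s → ι), Function.Injective i ∧
    ∀ (j : s) (m), p j m = b m (i j)

/-- The rays are distinct coordinates in a suitable basis, so their values can be prescribed; the
remaining coordinates are set to `0`. -/
theorem IsSmoothCone.exists_eq {p : J → M →+ ℤ} {s : Finset J} (hs : IsSmoothCone p s)
    (a : J → ℤ) : ∃ m, ∀ j ∈ s, p j m = a j := by
  classical
  obtain ⟨ι, hι, b, i, hi, hb⟩ := hs
  refine ⟨b.symm fun k => if h : ∃ j, i j = k then a h.choose else 0, fun j hj => ?_⟩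
  have h : ∃ j', i j' = i ⟨j, hj⟩ := ⟨_, rfl⟩
  rw [hb ⟨j, hj⟩, b.apply_symm_apply, dif_pos h, hi h.choose_spec]

theorem IsSmoothCone.exists_dual [DecidableEq J] {p : J → M →+ ℤ} {s : Finset J}
    (hs : IsSmoothCone p s) (j : J) : ∃ e, ∀ k ∈ s, p k e = if k = j then 1 else 0 :=
  hs.exists_eq _

/-- The unique sums property of `ℤ^ι` is what makes the semigroup rings domains and their units
monomials. -/
theorem IsSmoothCone.twoUniqueSums {p : J → M →+ ℤ} {s : Finset J} (hs : IsSmoothCone p s) :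
    TwoUniqueSums M := by
  obtain ⟨ι, hι, b, -⟩ := hs
  exact TwoUniqueSums.of_injective_addHom b.toAddMonoidHom.toAddHom b.injective inferInstance

theorem twoUniqueSums_submonoid [TwoUniqueSums M] (S : AddSubmonoid M) : TwoUniqueSums S :=
  TwoUniqueSums.of_injective_addHom S.subtype.toAddHom Subtype.val_injective inferInstance

theorem IsSmoothCone.isDomain {p : J → M →+ ℤ} {s : Finset J} (hs : IsSmoothCone p s)
    (t : Finset J) : IsDomain (CoordRing p t) := by
  have := hs.twoUniqueSums
  have := twoUniqueSums_submonoid (dualSG p t)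
  exact NoZeroDivisors.to_isDomain _

/-- The character `m`, as a function on the affine toric variety of `s`. -/
noncomputable def chi (p : J → M →+ ℤ) (s : Finset J) (m : M) (hm : m ∈ dualSG p s) :
    CoordRing p s :=
  AddMonoidAlgebra.single ⟨m, hm⟩ 1

theorem chi_mul_chi {p : J → M →+ ℤ} {s : Finset J} {m n : M} (hm : m ∈ dualSG p s)
    (hn : n ∈ dualSG p s) : chi p s m hm * chi p s n hn = chi p s (m + n) (add_mem hm hn) := by
  simp only [chi, AddMonoidAlgebra.single_mul_single, mul_one]
  rfl

theorem chi_zero {p : J → M →+ ℤ} {s : Finset J} : chi p s 0 (zero_mem _) = 1 := rfl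

theorem isUnit_chi {p : J → M →+ ℤ} {s : Finset J} {m : M} (hm : ∀ j ∈ s, p j m = 0)  :
    IsUnit (chi p s m fun j hj => (hm j hj).ge) := by
  have h1 : m ∈ dualSG p s := fun j hj => (hm j hj).ge
  have h2 : -m ∈ dualSG p s := fun j hj => by rw [map_neg, hm j hj, neg_zero]
  refine IsUnit.of_mul_eq_one (chi p s (-m) h2) ((chi_mul_chi h1 h2).trans ?_)
  simp only [add_neg_cancel]
  rfl

/-- The invertible elements of the algebra of a semigroup with unique sums are monomials. -/
theorem exists_single_of_isUnit {A : Type*} [AddCommMonoid A] [TwoUniqueSums A]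
    {u : AddMonoidAlgebra ℂ A} (hu : IsUnit u) :
    ∃ m c, c ≠ 0 ∧ u = AddMonoidAlgebra.single m c := by
  classical
  obtain ⟨v, hv⟩ := hu.exists_right_inv
  have hu0 : u ≠ 0 := by rintro rfl; simp at hv
  have hv0 : v ≠ 0 := by rintro rfl; simp at hv
  have hus : u.coeff.support.Nonempty := by
    rw [Finsupp.support_nonempty_iff]; simpa using hu0
  have hvs : v.coeff.support.Nonempty := by
    rw [Finsupp.support_nonempty_iff]; simpa using hv0
  -- A uniquely represented sum contributes a nonzero coefficient to `u * v = 1`, so it must be `0`.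
  -- Two different uniquely represented pairs would then have the same sum, which is impossible;
  -- hence both supports are singletons.
  have key : ∀ a ∈ u.coeff.support, ∀ b ∈ v.coeff.support,
      UniqueAdd u.coeff.support v.coeff.support a b → a + b = 0 := by
    intro a ha b hb h
    by_contra hab
    have := AddMonoidAlgebra.coeff_mul_add_of_uniqueAdd h
    rw [hv, AddMonoidAlgebra.one_def, AddMonoidAlgebra.coeff_single, Finsupp.single_apply,
      if_neg (Ne.symm hab)] at this
    exact mul_ne_zero (Finsupp.mem_support_iff.1 ha) (Finsupp.mem_support_iff.1 hb) this.symm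
  by_cases h : 1 < u.coeff.support.card * v.coeff.support.card
  · obtain ⟨x, hx, y, hy, hxy, h₁, h₂⟩ := TwoUniqueSums.uniqueAdd_of_one_lt_card h
    rw [Finset.mem_product] at hx hy
    have e₁ := key _ hx.1 _ hx.2 h₁
    have e₂ := key _ hy.1 _ hy.2 h₂
    have := h₁ hy.1 hy.2 (e₂.trans e₁.symm)
    exact (hxy (Prod.ext this.1.symm this.2.symm)).elim
  · have h1 : u.coeff.support.card = 1 := by
      have := hus.card_pos
      have := hvs.card_pos
      nlinarith
    obtain ⟨m, c, hc, e⟩ := Finsupp.card_support_eq_one'.1 h1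
    exact ⟨m, c, hc, by ext1; exact e⟩

/-- Restriction to the open subvariety that corresponds to a face. -/
noncomputable def resMap (p : J → M →+ ℤ) {s t : Finset J} (h : t ⊆ s) :
    CoordRing p s →+* CoordRing p t :=
  AddMonoidAlgebra.mapDomainRingHom ℂ (AddSubmonoid.inclusion (dualSG_anti p h))

theorem resMap_single {p : J → M →+ ℤ} {s t : Finset J} (h : t ⊆ s) (m : dualSG p s) (c : ℂ) :
    resMap p h (AddMonoidAlgebra.single m c) =
      AddMonoidAlgebra.single ⟨m, dualSG_anti p h m.2⟩ c := by
  simp only [resMap, AddMonoidAlgebra.mapDomainRingHom_apply, AddMonoidAlgebra.mapDomain_single]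
  rfl

theorem resMap_chi {p : J → M →+ ℤ} {s t : Finset J} (h : t ⊆ s) {m : M} (hm : m ∈ dualSG p s) :
    resMap p h (chi p s m hm) = chi p t m (dualSG_anti p h hm) :=
  resMap_single h _ _

theorem resMap_injective {p : J → M →+ ℤ} {s t : Finset J} (h : t ⊆ s) :
    Function.Injective (resMap p h) :=
  AddMonoidAlgebra.mapDomain_injective (AddSubmonoid.inclusion_injective _)

/-- Removing one ray from a cone inverts the corresponding coordinate. -/
theorem isLocalization_resMap [DecidableEq J] {p : J → M →+ ℤ} {s t : Finset J} {j : J} (h : t ⊆ s)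
    (hst : ∀ k ∈ s, k = j ∨ k ∈ t) (hj : j ∉ t) {e : M} (he : ∀ k ∈ s, p k e = if k = j then 1 else 0)
    (heS : e ∈ dualSG p s) :
    letI := (resMap p h).toAlgebra
    IsLocalization.Away (chi p s e heS) (CoordRing p t) := by
  let _ := (resMap p h).toAlgebra
  have hu : IsUnit (resMap p h (chi p s e heS)) := by
    rw [resMap_chi]
    refine isUnit_chi (m := e) fun k hk => ?_
    rw [he k (h hk), if_neg]
    rintro rfl
    exact hj hk
  have hpow : ∀ n : ℕ, chi p s e heS ^ n = chi p s (n • e) (nsmul_mem heS n) := by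
    intro n
    induction n with
    | zero => rw [pow_zero, ← chi_zero]; congr 1; simp
    | succ n ih => rw [pow_succ, ih, chi_mul_chi]; congr 1; rw [succ_nsmul]
  have hsurj : ∀ z : CoordRing p t, ∃ n : ℕ, ∃ a, z * resMap p h (chi p s e heS ^ n) =
      resMap p h a := by
    intro z
    induction z using AddMonoidAlgebra.induction_linear with
    | zero => exact ⟨0, 0, by simp⟩
    | add a b ha hb =>
      obtain ⟨n, a', ha'⟩ := ha
      obtain ⟨m, b', hb'⟩ := hb
      refine ⟨n + m, a' * chi p s e heS ^ m + b' * chi p s e heS ^ n, ?_⟩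
      simp only [map_add, map_mul, map_pow, pow_add] at ha' hb' ⊢
      rw [← ha', ← hb']
      ring
    | single m c =>
      -- Adding multiples of `e` changes only the value on the ray `j`, and `|p j m|` of them
      -- suffice to make it nonnegative.
      have hm : (m : M) + (p j m).natAbs • e ∈ dualSG p s := by
        intro k hk
        rw [map_add, map_nsmul, he k hk]
        rcases hst k hk with rfl | hkt
        · rw [if_pos rfl, nsmul_one]
          have := neg_le_abs (p k m)
          rw [Int.natCast_natAbs]
          linarith
        · exact add_nonneg (m.2 k hkt) (nsmul_nonneg (by split_ifs <;> decide) _)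
      refine ⟨(p j m).natAbs, AddMonoidAlgebra.single ⟨_, hm⟩ c, ?_⟩
      rw [hpow, resMap_chi, resMap_single, chi, AddMonoidAlgebra.single_mul_single, mul_one]
      rfl
  refine ⟨?_, ?_, ?_⟩
  · rintro ⟨_, n, rfl⟩
    rw [RingHom.algebraMap_toAlgebra, map_pow]
    exact hu.pow n
  · intro z
    obtain ⟨n, a, ha⟩ := hsurj z
    exact ⟨⟨a, ⟨_, n, rfl⟩⟩, ha⟩
  · intro a b hab
    exact ⟨1, by rw [resMap_injective h hab]⟩

/-- The isomorphism of semigroups given by an isomorphism of lattices. -/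
def dualSGEquiv {p : J → M →+ ℤ} {p' : J' → M' →+ ℤ} (B : M' ≃+ M) {s : Finset J} {s' : Finset J'}
    (h : ∀ m, B m ∈ dualSG p s ↔ m ∈ dualSG p' s') : dualSG p' s' ≃+ dualSG p s where
  toFun m := ⟨B m, (h m).2 m.2⟩
  invFun m := ⟨B.symm m, (h _).1 (by rw [B.apply_symm_apply]; exact m.2)⟩
  left_inv m := by simp
  right_inv m := by simp
  map_add' m n := by simp

/-- The isomorphism of coordinate rings given by an isomorphism of lattices. -/
noncomputable def coordRingEquiv {p : J → M →+ ℤ} {p' : J' → M' →+ ℤ} (B : M' ≃+ M) {s : Finset J}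
    {s' : Finset J'} (h : ∀ m, B m ∈ dualSG p s ↔ m ∈ dualSG p' s') :
    CoordRing p' s' ≃+* CoordRing p s :=
  AddMonoidAlgebra.mapDomainRingEquiv ℂ (dualSGEquiv B h)

theorem coordRingEquiv_single {p : J → M →+ ℤ} {p' : J' → M' →+ ℤ} (B : M' ≃+ M) {s : Finset J}
    {s' : Finset J'} (h : ∀ m, B m ∈ dualSG p s ↔ m ∈ dualSG p' s') (m : dualSG p' s') (c : ℂ) :
    coordRingEquiv B h (AddMonoidAlgebra.single m c) =
      AddMonoidAlgebra.single ⟨B m, (h m).2 m.2⟩ c :=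
  AddMonoidAlgebra.mapDomainRingEquiv_single ..

/-- Induction on the number of coordinates outside `s`. If there are none, the semigroup is `ℕ^ι`
and the ring is a polynomial ring; dropping a coordinate from `s` is a localization, which preserves
unique factorization. -/
theorem uniqueFactorizationMonoid_eval {ι : Type} [Finite ι] (s : Finset ι) :
    UniqueFactorizationMonoid (CoordRing (fun i => Pi.evalAddMonoidHom (fun _ : ι => ℤ) i) s) := by
  classical
  have := Fintype.ofFinite ι
  set p : ι → (ι → ℤ) →+ ℤ := fun i => Pi.evalAddMonoidHom (fun _ : ι => ℤ) i with hp
  have hsm : ∀ s, IsSmoothCone p s := fun s =>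
    ⟨ι, inferInstance, AddEquiv.refl _, Subtype.val, Subtype.val_injective, fun _ _ => rfl⟩
  have hdom := fun s => (hsm s).isDomain s
  induction hn : sᶜ.card generalizing s with
  | zero =>
    have hs : s = Finset.univ := by simpa using hn
    subst hs
    let e : dualSG p Finset.univ ≃+ (ι →₀ ℕ) :=
      { toFun := fun m => Finsupp.equivFunOnFinite.symm fun i => (m.1 i).toNat
        invFun := fun n => ⟨fun i => n i, fun i _ => Int.natCast_nonneg _⟩
        left_inv := fun m => by
          ext i
          simpa [hp] using m.2 i (Finset.mem_univ i)
        right_inv := fun n => by ext i; simp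
        map_add' := fun m n => by
          ext i
          exact Int.toNat_add (m.2 i (Finset.mem_univ i)) (n.2 i (Finset.mem_univ i)) }
    let E : CoordRing p Finset.univ ≃+* MvPolynomial ι ℂ :=
      AddMonoidAlgebra.mapDomainRingEquiv ℂ e
    exact E.toMulEquiv.symm.uniqueFactorizationMonoid inferInstance
  | succ n ih =>
    obtain ⟨j, hj⟩ : sᶜ.Nonempty := Finset.card_pos.1 (by omega)
    have hjs : j ∉ s := Finset.mem_compl.1 hj
    have := ih (insert j s) (by
      rw [Finset.compl_insert, Finset.card_erase_of_mem hj, hn, Nat.add_sub_cancel])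
    obtain ⟨e, he⟩ := (hsm (insert j s)).exists_dual j
    have heS : e ∈ dualSG p (insert j s) := fun k hk => by
      rw [he k hk]
      split_ifs <;> decide
    let _ := (resMap p (Finset.subset_insert j s)).toAlgebra
    have := isLocalization_resMap (Finset.subset_insert j s)
      (fun k hk => Finset.mem_insert.1 hk) hjs he heS
    exact UniqueFactorizationMonoid.of_isLocalization (Submonoid.powers (chi p (insert j s) e heS)) _

theorem IsSmoothCone.uniqueFactorizationMonoid {p : J → M →+ ℤ} {s : Finset J}
    (hs : IsSmoothCone p s) : UniqueFactorizationMonoid (CoordRing p s) := by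
  classical
  obtain ⟨ι, hι, b, i, hi, hb⟩ := hs
  have hB : ∀ m, b m ∈ dualSG (fun i => Pi.evalAddMonoidHom (fun _ : ι => ℤ) i)
      (Finset.univ.image i) ↔ m ∈ dualSG p s := by
    intro m
    simp only [mem_dualSG, Finset.forall_mem_image]
    exact ⟨fun h j hj => (hb ⟨j, hj⟩ m).ge.trans' (h (Finset.mem_univ _)),
      fun h j _ => (h j.1 j.2).trans (hb j m).le⟩
  exact (coordRingEquiv b hB).toMulEquiv.symm.uniqueFactorizationMonoid
    (uniqueFactorizationMonoid_eval _)

/-- The restriction of the pairing to the lattice of the orbit closure of the ray `v`. -/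
def kerPairing (p : J → M →+ ℤ) (v : J) : J → (p v).ker →+ ℤ :=
  fun j => (p j).comp (p v).ker.subtype

/-- In the adapted basis `p v` is one of the coordinates, so its kernel has the other coordinates as
a basis. These still include the rays of `t`. -/
theorem IsSmoothCone.kerPairing [DecidableEq J] {p : J → M →+ ℤ} {v : J} {t : Finset J}
    (hs : IsSmoothCone p (insert v t)) (hv : v ∉ t) : IsSmoothCone (kerPairing p v) t := by
  classical
  obtain ⟨ι, hι, b, i, hi, hb⟩ := hs
  set k : ι := i ⟨v, Finset.mem_insert_self v t⟩
  have hk : ∀ m, p v m = b m k := hb ⟨v, Finset.mem_insert_self v t⟩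
  have hne : ∀ j : t, i ⟨j, Finset.mem_insert_of_mem j.2⟩ ≠ k := fun j h => by
    have : (j : J) = v := congrArg Subtype.val (hi h)
    exact hv (this ▸ j.2)
  refine ⟨{l // l ≠ k}, inferInstance,
    { toFun := fun m l => b m l
      invFun := fun f => ⟨b.symm fun l => if h : l = k then 0 else f ⟨l, h⟩, ?_⟩
      left_inv := fun m => ?_
      right_inv := fun f => ?_
      map_add' := fun m n => ?_ }, fun j => ⟨_, hne j⟩, fun j j' h => ?_, fun j m => ?_⟩
  · rw [AddMonoidHom.mem_ker, hk, b.apply_symm_apply, dif_pos rfl]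
  · ext
    refine b.injective (funext fun l => ?_)
    rw [b.apply_symm_apply]
    split_ifs with h
    · rw [h, ← hk]
      exact (AddMonoidHom.mem_ker.1 m.2).symm
    · rfl
  · funext l
    dsimp only
    rw [b.apply_symm_apply, dif_neg l.2]
  · funext l
    exact congrFun (map_add b (m : M) n) l
  · exact Subtype.ext (Subtype.mk.inj (hi (congrArg Subtype.val h)))
  · exact hb ⟨j, Finset.mem_insert_of_mem j.2⟩ m

section Face

variable [DecidableEq J] (p : J → M →+ ℤ) (v : J) {s t : Finset J} (hs : s = insert v t)

theorem mem_dualSG_insert (h : s = insert v t) {m : (p v).ker} (hm : m ∈ dualSG (kerPairing p v) t) :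
    (m : M) ∈ dualSG p s := by
  intro j hj
  rcases Finset.mem_insert.1 (h ▸ hj) with rfl | hj
  · exact (AddMonoidHom.mem_ker.1 m.2).ge
  · exact hm j hj

open Classical in
/-- Restriction of functions to the orbit closure of the ray `v`: the characters that vanish there
are mapped to zero. -/
noncomputable def faceMap : CoordRing p s →+* CoordRing (kerPairing p v) t :=
  (AddMonoidAlgebra.lift ℂ (CoordRing (kerPairing p v) t) (dualSG p s)
    { toFun := fun m => if h : p v m.toAdd = 0 then
        chi _ _ ⟨m.toAdd, AddMonoidHom.mem_ker.2 h⟩ (fun j hj => m.toAdd.2 j (hs ▸ Finset.mem_insert_of_mem hj)) else 0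
      map_one' := by
        rw [dif_pos (by simp)]
        rfl
      map_mul' := by
        intro m n
        have hm := m.toAdd.2 v (hs ▸ Finset.mem_insert_self v t)
        have hn := n.toAdd.2 v (hs ▸ Finset.mem_insert_self v t)
        have e : p v ((m * n).toAdd : M) = p v m.toAdd + p v n.toAdd := map_add _ _ _
        by_cases h1 : p v m.toAdd = 0
        · by_cases h2 : p v n.toAdd = 0
          · rw [dif_pos h1, dif_pos h2, dif_pos (by rw [e, h1, h2, add_zero])]
            exact (chi_mul_chi (p := kerPairing p v) (s := t)
              (m := ⟨m.toAdd, AddMonoidHom.mem_ker.2 h1⟩) (n := ⟨n.toAdd, AddMonoidHom.mem_ker.2 h2⟩)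
              (fun j hj => m.toAdd.2 j (hs ▸ Finset.mem_insert_of_mem hj))
              (fun j hj => n.toAdd.2 j (hs ▸ Finset.mem_insert_of_mem hj))).symm
          · rw [dif_neg h2, mul_zero, dif_neg (by omega)]
        · rw [dif_neg h1, zero_mul, dif_neg (by omega)] }).toRingHom

variable {p v}

theorem faceMap_single (m : dualSG p s) (c : ℂ) (h : p v m = 0) :
    faceMap p v hs (AddMonoidAlgebra.single m c) = AddMonoidAlgebra.single
      ⟨⟨m, AddMonoidHom.mem_ker.2 h⟩, fun j hj => m.2 j (hs ▸ Finset.mem_insert_of_mem hj)⟩ c := by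
  refine (AddMonoidAlgebra.lift_single _ _ _).trans ?_
  change c • dite _ _ _ = _
  rw [dif_pos (show p v (Multiplicative.ofAdd m).toAdd = 0 from h)]
  refine (AddMonoidAlgebra.smul_single _ _ _).trans ?_
  rw [smul_eq_mul, mul_one]
  rfl

theorem faceMap_single_of_ne (m : dualSG p s) (c : ℂ) (h : p v m ≠ 0) :
    faceMap p v hs (AddMonoidAlgebra.single m c) = 0 := by
  refine (AddMonoidAlgebra.lift_single _ _ _).trans ?_
  change c • dite _ _ _ = _
  rw [dif_neg (show p v (Multiplicative.ofAdd m).toAdd ≠ 0 from h), smul_zero]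

theorem faceMap_surjective : Function.Surjective (faceMap p v hs) := by
  intro a
  induction a using AddMonoidAlgebra.induction_linear with
  | zero => exact ⟨0, map_zero _⟩
  | add a b ha hb =>
    obtain ⟨a, rfl⟩ := ha
    obtain ⟨b, rfl⟩ := hb
    exact ⟨a + b, map_add _ _ _⟩
  | single m c =>
    exact ⟨AddMonoidAlgebra.single ⟨m.1, mem_dualSG_insert p v hs m.2⟩ c,
      faceMap_single hs _ _ (AddMonoidHom.mem_ker.1 m.1.2)⟩

/-- A monomial either is positive on `v`, and then divisible by the coordinate `e`, or is zero on
`v`, and then recovered from its restriction by the semigroup inclusion `ι`. So every `a` is a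
multiple of the coordinate plus a lift of its restriction. -/
theorem mem_ker_faceMap_iff (hv : v ∉ t) {e : M} (he : ∀ k ∈ s, p k e = if k = v then 1 else 0)
    (heS : e ∈ dualSG p s) {a : CoordRing p s} :
    faceMap p v hs a = 0 ↔ chi p s e heS ∣ a := by
  have hvs : v ∈ s := hs ▸ Finset.mem_insert_self v t
  constructor
  · intro ha
    let ι : dualSG (kerPairing p v) t →+ dualSG p s :=
      { toFun := fun m => ⟨m.1, mem_dualSG_insert p v hs m.2⟩
        map_zero' := rfl
        map_add' := fun _ _ => rfl }
    have key : ∀ a : CoordRing p s, ∃ b,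
        a = chi p s e heS * b + AddMonoidAlgebra.mapDomainRingHom ℂ ι (faceMap p v hs a) := by
      intro a
      induction a using AddMonoidAlgebra.induction_linear with
      | zero => exact ⟨0, by simp⟩
      | add a b ha hb =>
        obtain ⟨a', ha⟩ := ha
        obtain ⟨b', hb⟩ := hb
        refine ⟨a' + b', ?_⟩
        rw [map_add, map_add]
        nth_rw 1 [ha, hb]
        ring
      | single m c =>
        by_cases h : p v m = 0
        · refine ⟨0, ?_⟩
          rw [faceMap_single hs m c h, mul_zero, zero_add,
            AddMonoidAlgebra.mapDomainRingHom_apply, AddMonoidAlgebra.mapDomain_single]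
          rfl
        · have hm : (m : M) - e ∈ dualSG p s := by
            intro k hk
            have h0 := m.2 k hk
            rw [map_sub, he k hk]
            split_ifs with hkv
            · subst hkv
              omega
            · rwa [sub_zero]
          refine ⟨AddMonoidAlgebra.single ⟨_, hm⟩ c, ?_⟩
          rw [faceMap_single_of_ne hs m c h, map_zero, add_zero, chi,
            AddMonoidAlgebra.single_mul_single, one_mul]
          congr 1
          ext
          exact (add_sub_cancel _ _).symm
    obtain ⟨b, hb⟩ := key a
    rw [ha, map_zero, add_zero] at hb
    exact ⟨b, hb⟩
  · rintro ⟨b, rfl⟩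
    rw [map_mul, chi, faceMap_single_of_ne, zero_mul]
    rw [he v hvs, if_pos rfl]
    exact one_ne_zero

end Face

/-- The value at the distinguished point of the orbit of the cone `s`. -/
theorem exists_ringHom_chi_eq_zero (p : J → M →+ ℤ) (s : Finset J) :
    ∃ φ : CoordRing p s →+* ℂ, ∀ m hm, (∃ j ∈ s, p j m ≠ 0) → φ (chi p s m hm) = 0 := by
  classical
  refine ⟨(AddMonoidAlgebra.lift ℂ ℂ (dualSG p s)
    { toFun := fun m => if ∀ j ∈ s, p j m.toAdd = 0 then 1 else 0
      map_one' := if_pos fun j _ => by simp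
      map_mul' := fun m n => ?_ }).toRingHom, ?_⟩
  · have e : ∀ j, p j ((m * n).toAdd : M) = p j m.toAdd + p j n.toAdd := fun j => map_add _ _ _
    simp only [e]
    rw [ite_zero_mul_ite_zero, one_mul]
    congr 1
    rw [← forall₂_and]
    refine propext (forall₂_congr fun j hj => ?_)
    have h1 := m.toAdd.2 j hj
    have h2 := n.toAdd.2 j hj
    omega
  · rintro m hm ⟨j, hj, h⟩
    refine (AddMonoidAlgebra.lift_single _ _ _).trans ?_
    change (1 : ℂ) • ite _ _ _ = 0
    rw [if_neg, smul_zero]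
    exact fun H => h (H j hj)

end CoordRing

/-! ### Orders of vanishing in codimension one. -/

section Order

variable {X : Scheme.{0}} [IsIntegral X] [IsLocallyNoetherian X]

theorem ord_eq_zero_of_mem_unitsAt {z : X} {k : (X.functionField)ˣ} (hk : k ∈ unitsAt z) :
    Scheme.ord (k : X.functionField) z = 0 := by
  obtain ⟨U, hz, a, rfl⟩ := exists_germUnits_of_mem_unitsAt hk
  have : Nonempty U := ⟨⟨z, hz⟩⟩
  exact Scheme.ord_of_isUnit a.isUnit hz

/-- The order is the length of the stalk modulo `t`; modulo the maximal ideal this is a simple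
module. -/
theorem ord_eq_one_of_maximalIdeal_eq {z : X} (hz : Order.coheight z = 1)
    {t : X.presheaf.stalk z} (ht : t ≠ 0)
    (h : IsLocalRing.maximalIdeal (X.presheaf.stalk z) = Ideal.span {t}) :
    Scheme.ord (algebraMap (X.presheaf.stalk z) X.functionField t) z = 1 := by
  have : Ring.KrullDimLE 1 (X.presheaf.stalk z) := krullDimLE_of_coheight_le hz.le
  have ht' : algebraMap (X.presheaf.stalk z) X.functionField t ≠ 0 :=
    (map_ne_zero_iff _ (IsFractionRing.injective _ _)).2 ht
  rw [Scheme.ord_eq_iff hz ht']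
  refine (Ring.ordFrac_eq_ord (X.presheaf.stalk z) ht).trans ?_
  refine Ring.ordMonoidWithZeroHom_eq_coe _ (n := 1) (mem_nonZeroDivisors_of_ne_zero ht) ?_
  rw [Ring.ord, ← h, Nat.cast_one, Module.length_eq_one_iff, isSimpleModule_iff_isCoatom]
  exact (IsLocalRing.maximalIdeal.isMaximal _).out

end Order

/-! ### Affine open charts, their stalks and the function field. -/

section ToStalk

variable {R : Type} [CommRing R] (P : PrimeSpectrum R)

theorem exists_toStalk_eq (u : (Spec.structureSheaf R).presheaf.stalk P) :
    ∃ a b, b ∉ P.asIdeal ∧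
      u * algebraMap R ((Spec.structureSheaf R).presheaf.stalk P) b =
        algebraMap R ((Spec.structureSheaf R).presheaf.stalk P) a := by
  obtain ⟨⟨a, b⟩, h⟩ := IsLocalization.surj P.asIdeal.primeCompl u
  exact ⟨a, b, b.2, h⟩

theorem isUnit_toStalk_iff (a : R) : IsUnit (StructureSheaf.toStalk R P a) ↔ a ∉ P.asIdeal :=
  IsLocalization.AtPrime.isUnit_to_map_iff
    ((Spec.structureSheaf R).presheaf.stalk P) P.asIdeal a

theorem toStalk_injective [IsDomain R] : Function.Injective (StructureSheaf.toStalk R P) :=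
  IsLocalization.injective ((Spec.structureSheaf R).presheaf.stalk P)
    P.asIdeal.primeCompl_le_nonZeroDivisors

end ToStalk

section OpenChart

variable {X : Scheme.{0}} {R : Type} [CommRing R] (i : Spec (CommRingCat.of R) ⟶ X)
  [IsOpenImmersion i]

/-- A function on an affine open subscheme, as a section over its image. -/
noncomputable def chartSec : R →+* Γ(X, i ''ᵁ ⊤) :=
  ((Scheme.ΓSpecIso (CommRingCat.of R)).inv ≫ (i.appIso ⊤).inv).hom

theorem appLE_chartSec (a : R) (h : ⊤ ≤ i ⁻¹ᵁ (i ''ᵁ ⊤)) :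
    i.appLE (i ''ᵁ ⊤) ⊤ h (chartSec i a) = (Scheme.ΓSpecIso (CommRingCat.of R)).inv a := by
  have : ((Scheme.ΓSpecIso (CommRingCat.of R)).inv ≫ (i.appIso ⊤).inv) ≫
      i.appLE (i ''ᵁ ⊤) ⊤ h = (Scheme.ΓSpecIso (CommRingCat.of R)).inv := by
    rw [Category.assoc, Scheme.Hom.appIso_inv_appLE]
    exact (congrArg _ ((Spec (CommRingCat.of R)).presheaf.map_id _)).trans (Category.comp_id _)
  exact congr($this a)

theorem mem_chartOpen (P : Spec (CommRingCat.of R)) : i P ∈ i ''ᵁ ⊤ := ⟨P, trivial, rfl⟩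

/-- A function on an affine open subscheme, as a germ. -/
noncomputable def chartGerm (P : Spec (CommRingCat.of R)) : R →+* X.presheaf.stalk (i P) :=
  (X.presheaf.germ _ (i P) (mem_chartOpen i P)).hom.comp (chartSec i)

theorem stalkMap_chartGerm (P : Spec (CommRingCat.of R)) (a : R) :
    i.stalkMap P (chartGerm i P a) = StructureSheaf.toStalk R P a := by
  refine (Scheme.Hom.germ_stalkMap_apply i _ P (mem_chartOpen i P) _).trans ?_
  have h : ⊤ ≤ i ⁻¹ᵁ (i ''ᵁ ⊤) := (i.preimage_image_eq ⊤).ge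
  have := congrArg ((Spec (CommRingCat.of R)).presheaf.germ ⊤ P trivial) (appLE_chartSec i a h)
  rw [Scheme.Hom.appLE] at this
  refine Eq.trans ?_ this
  refine (TopCat.Presheaf.germ_res_apply (Spec (CommRingCat.of R)).presheaf (homOfLE h) P trivial
    _).symm.trans ?_
  rfl

theorem exists_chartGerm_eq (P : Spec (CommRingCat.of R)) (u : X.presheaf.stalk (i P)) :
    ∃ a b, b ∉ P.asIdeal ∧ u * chartGerm i P b = chartGerm i P a := by
  obtain ⟨a, b, hb, h⟩ := exists_toStalk_eq P (i.stalkMap P u)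
  refine ⟨a, b, hb, ?_⟩
  apply (ConcreteCategory.bijective_of_isIso (i.stalkMap P)).1
  rw [map_mul, stalkMap_chartGerm, stalkMap_chartGerm]
  exact h

theorem isUnit_chartGerm_iff (P : Spec (CommRingCat.of R)) (a : R) :
    IsUnit (chartGerm i P a) ↔ a ∉ P.asIdeal := by
  rw [← isUnit_map_iff (i.stalkMap P).hom]
  exact (Eq.to_iff (congrArg IsUnit (stalkMap_chartGerm i P a))).trans (isUnit_toStalk_iff P a)

theorem chartGerm_injective [IsDomain R] (P : Spec (CommRingCat.of R)) :
    Function.Injective (chartGerm i P) := by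
  intro a b hab
  have := congrArg (i.stalkMap P) hab
  rw [stalkMap_chartGerm, stalkMap_chartGerm] at this
  exact toStalk_injective P this

variable [IsIntegral X] [IsDomain R]

theorem genericPoint_mem_chartOpen : genericPoint X ∈ i ''ᵁ ⊤ :=
  genericPoint_mem (mem_chartOpen i (⊥ : PrimeSpectrum R))

/-- A function on an affine open subscheme, as a rational function. -/
noncomputable def chartFun : R →+* X.functionField :=
  (X.presheaf.germ _ _ (genericPoint_mem_chartOpen i)).hom.comp (chartSec i)

theorem algebraMap_chartGerm (P : Spec (CommRingCat.of R)) (a : R) :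
    algebraMap (X.presheaf.stalk (i P)) X.functionField (chartGerm i P a) = chartFun i a := by
  have : Nonempty (i ''ᵁ (⊤ : (Spec (CommRingCat.of R)).Opens)) := ⟨⟨_, mem_chartOpen i P⟩⟩
  exact Scheme.algebraMap_germ_eq_germToFunctionField X (mem_chartOpen i P) _

theorem chartFun_injective : Function.Injective (chartFun i) := by
  intro a b hab
  rw [← algebraMap_chartGerm i (⊥ : PrimeSpectrum R), ← algebraMap_chartGerm i
    (⊥ : PrimeSpectrum R)] at hab
  exact chartGerm_injective i _ (IsFractionRing.injective _ _ hab)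

/-- Rational functions are fractions of elements of a stalk, and those are fractions of functions on
the chart. The stalk at the zero ideal is used. -/
theorem isFractionRing_chartFun :
    letI := (chartFun i).toAlgebra
    IsFractionRing R X.functionField := by
  let _ := (chartFun i).toAlgebra
  have : FaithfulSMul R X.functionField :=
    (faithfulSMul_iff_algebraMap_injective _ _).2 (chartFun_injective i)
  refine IsFractionRing.of_field R X.functionField fun z => ?_
  let P : Spec (CommRingCat.of R) := (⊥ : PrimeSpectrum R)
  obtain ⟨x, y, hy, rfl⟩ := IsFractionRing.div_surjective (A := X.presheaf.stalk (i P)) z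
  obtain ⟨a, b, hb, hab⟩ := exists_chartGerm_eq i P x
  obtain ⟨c, d, hd, hcd⟩ := exists_chartGerm_eq i P y
  have hab' := congrArg (algebraMap (X.presheaf.stalk (i P)) X.functionField) hab
  have hcd' := congrArg (algebraMap (X.presheaf.stalk (i P)) X.functionField) hcd
  simp only [map_mul, algebraMap_chartGerm] at hab' hcd'
  have hb0 : chartFun i b ≠ 0 := (map_ne_zero_iff _ (chartFun_injective i)).2
    fun h => hb (h ▸ zero_mem _)
  have hd0 : chartFun i d ≠ 0 := (map_ne_zero_iff _ (chartFun_injective i)).2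
    fun h => hd (h ▸ zero_mem _)
  have hy0 : algebraMap (X.presheaf.stalk (i P)) X.functionField y ≠ 0 :=
    (map_ne_zero_iff _ (IsFractionRing.injective _ _)).2 (nonZeroDivisors.ne_zero hy)
  refine ⟨a * d, c * b, ?_⟩
  change _ = chartFun i (a * d) / chartFun i (c * b)
  rw [map_mul, map_mul, ← hab', ← hcd']
  field_simp

/-- This translates invertibility at a point of the scheme into the algebraic condition `LocUnit`,
for which the factorization argument was made. -/
theorem mem_unitsAt_iff (P : Spec (CommRingCat.of R)) (k : (X.functionField)ˣ) :
    letI := (chartFun i).toAlgebra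
    k ∈ unitsAt (i P) ↔ LocUnit (R := R) P (k : X.functionField) := by
  let _ := (chartFun i).toAlgebra
  constructor
  · rintro ⟨u, rfl⟩
    obtain ⟨a, b, hb, h⟩ := exists_chartGerm_eq i P u
    refine ⟨a, b, ?_, hb, ?_⟩
    · rw [← isUnit_chartGerm_iff i, ← h]
      exact u.isUnit.mul ((isUnit_chartGerm_iff i P b).2 hb)
    · have := congrArg (algebraMap (X.presheaf.stalk (i P)) X.functionField) h
      rw [map_mul, algebraMap_chartGerm, algebraMap_chartGerm] at this
      exact this
  · rintro ⟨a, b, ha, hb, h⟩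
    have ha' := (isUnit_chartGerm_iff i P a).2 ha
    have hb' := (isUnit_chartGerm_iff i P b).2 hb
    refine ⟨ha'.unit / hb'.unit, ?_⟩
    rw [map_div, div_eq_iff_eq_mul]
    ext
    change algebraMap (X.presheaf.stalk (i P)) X.functionField (chartGerm i P a) =
      k * algebraMap (X.presheaf.stalk (i P)) X.functionField (chartGerm i P b)
    rw [algebraMap_chartGerm, algebraMap_chartGerm]
    exact h.symm

theorem mem_unitsAt_of_notMem {P : Spec (CommRingCat.of R)} {k : (X.functionField)ˣ} {a : R}
    (hk : (k : X.functionField) = chartFun i a) (ha : a ∉ P.asIdeal) : k ∈ unitsAt (i P) := by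
  rw [mem_unitsAt_iff]
  let _ := (chartFun i).toAlgebra
  refine ⟨a, 1, ha, P.isPrime.one_notMem, ?_⟩
  rw [map_one, mul_one]
  exact hk

theorem notMem_of_mem_unitsAt {P : Spec (CommRingCat.of R)} {k : (X.functionField)ˣ} {a : R}
    (hk : (k : X.functionField) = chartFun i a) (h : k ∈ unitsAt (i P)) : a ∉ P.asIdeal := by
  obtain ⟨u, rfl⟩ := h
  rw [← isUnit_chartGerm_iff i]
  convert! u.isUnit
  apply IsFractionRing.injective _ X.functionField
  rw [algebraMap_chartGerm]
  exact hk.symm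

/-- Locally principal divisors are principal on the spectrum of a unique factorization domain. -/
theorem exists_mul_mem_unitsAt [UniqueFactorizationMonoid R] {D : X → (X.functionField)ˣ}
    (hD : D ∈ CDiv X) : ∃ f, ∀ P, D (i P) * f ∈ unitsAt (i P) := by
  let _ := (chartFun i).toAlgebra
  have := isFractionRing_chartFun i
  have h : ∀ P : PrimeSpectrum R, ∃ U : Set (PrimeSpectrum R), IsOpen U ∧ P ∈ U ∧
      ∀ Q ∈ U, LocUnit Q ((D (i Q) : X.functionField) / D (i P)) := by
    intro P
    obtain ⟨U, hU, H⟩ := hD (i P)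
    refine ⟨i ⁻¹' U, U.isOpen.preimage i.continuous, hU, fun Q hQ => ?_⟩
    have := (mem_unitsAt_iff i Q _).1 (H (i Q) hQ)
    rwa [Units.val_div_eq_div_val] at this
  obtain ⟨f, hf0, hf⟩ := exists_locUnit_mul h fun P => (D (i P)).ne_zero
  refine ⟨Units.mk0 f hf0, fun P => ?_⟩
  rw [mem_unitsAt_iff]
  exact hf P

/-- A rational function that is invertible on an affine open subscheme is an invertible function
on it. -/
theorem exists_isUnit_chartFun_eq {k : (X.functionField)ˣ} (h : ∀ P, k ∈ unitsAt (i P)) :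
    ∃ u, IsUnit u ∧ (k : X.functionField) = chartFun i u := by
  let _ := (chartFun i).toAlgebra
  have := isFractionRing_chartFun i
  obtain ⟨u, hu⟩ := exists_eq_of_locReg (R := R) (k := (k : X.functionField))
    fun P => ((mem_unitsAt_iff i P k).1 (h P)).locReg
  obtain ⟨v, hv⟩ := exists_eq_of_locReg (R := R) (k := ((k⁻¹ : (X.functionField)ˣ) : X.functionField))
    fun P => ((mem_unitsAt_iff i P k⁻¹).1 (inv_mem (h P))).locReg
  refine ⟨u, IsUnit.of_mul_eq_one v (chartFun_injective i ?_), hu.symm⟩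
  have : algebraMap R X.functionField (u * v) = 1 := by rw [map_mul, hu, hv, Units.mul_inv]
  exact this.trans (map_one _).symm

/-- If the prime element `t` generates the prime ideal of a point of codimension one, then it
vanishes there to order one. -/
theorem ord_eq_one_of_asIdeal_eq [IsLocallyNoetherian X] {P : Spec (CommRingCat.of R)}
    (hP : Order.coheight (i P) = 1) {t : R} (ht : t ≠ 0) (h : P.asIdeal = Ideal.span {t}) :
    Scheme.ord (chartFun i t) (i P) = 1 := by
  rw [← algebraMap_chartGerm i P]
  refine ord_eq_one_of_maximalIdeal_eq hP
    ((map_ne_zero_iff _ (chartGerm_injective i P)).2 ht) (le_antisymm (fun u hu => ?_) ?_)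
  · obtain ⟨a, b, hb, hab⟩ := exists_chartGerm_eq i P u
    have hb' := (isUnit_chartGerm_iff i P b).2 hb
    have ha : a ∈ P.asIdeal := by
      by_contra ha
      rw [← isUnit_chartGerm_iff i, ← hab] at ha
      exact (IsLocalRing.mem_maximalIdeal _).1 hu (isUnit_of_mul_isUnit_left ha)
    rw [h] at ha
    obtain ⟨c, rfl⟩ := Ideal.mem_span_singleton.1 ha
    rw [Ideal.mem_span_singleton, ← hb'.dvd_mul_right, hab, map_mul]
    exact dvd_mul_right _ _
  · rw [Ideal.span_singleton_le_iff_mem, IsLocalRing.mem_maximalIdeal, mem_nonunits_iff,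
      isUnit_chartGerm_iff, not_not, h]
    exact Ideal.mem_span_singleton_self t

/-- Compatibility of coordinate functions with pull-back. -/
theorem pullFun_chartFun {X' : Scheme.{0}} [IsIntegral X'] {R' : Type} [CommRing R'] [IsDomain R']
    (i' : Spec (CommRingCat.of R') ⟶ X') [IsOpenImmersion i'] (f : X' ⟶ X)
    (hf : f (genericPoint X') = genericPoint X) (φ : R →+* R')
    (h : i' ≫ f = Spec.map (CommRingCat.ofHom φ) ≫ i) (a : R) :
    pullFun f hf (chartFun i a) = chartFun i' (φ a) := by
  have hle : i' ''ᵁ ⊤ ≤ f ⁻¹ᵁ (i ''ᵁ ⊤) := by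
    rintro _ ⟨P, -, rfl⟩
    refine ⟨Spec.map (CommRingCat.ofHom φ) P, trivial, ?_⟩
    exact congr($(h.symm) P)
  refine (pullFun_germ f hf hle (genericPoint_mem_chartOpen i') _ _).trans ?_
  refine congrArg (X'.presheaf.germ _ _ (genericPoint_mem_chartOpen i')) ?_
  apply (ConcreteCategory.bijective_of_isIso (i'.appIso ⊤).hom).1
  rw [Scheme.Hom.appIso_hom', appLE_chartSec]
  have e : f.appLE (i ''ᵁ ⊤) (i' ''ᵁ ⊤) hle ≫ i'.appLE (i' ''ᵁ ⊤) ⊤ (i'.preimage_image_eq ⊤).ge =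
      i.appLE (i ''ᵁ ⊤) ⊤ (i.preimage_image_eq ⊤).ge ≫
        (Spec.map (CommRingCat.ofHom φ)).appLE ⊤ ⊤ le_top := by
    refine (Scheme.Hom.appLE_comp_appLE _ _ _ _ _ _ _).trans
      (Eq.trans ?_ (Scheme.Hom.appLE_comp_appLE _ _ _ _ _ _ _).symm)
    simp only [h]
  refine (congr($e (chartSec i a))).trans ?_
  change (Spec.map (CommRingCat.ofHom φ)).appLE ⊤ ⊤ le_top
    (i.appLE (i ''ᵁ ⊤) ⊤ (i.preimage_image_eq ⊤).ge (chartSec i a)) = _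
  rw [appLE_chartSec]
  have e' := Scheme.ΓSpecIso_inv_naturality (CommRingCat.ofHom φ)
  have := congr($e' a)
  refine Eq.trans ?_ this.symm
  exact congr($(Scheme.Hom.appLE_eq_app (Spec.map (CommRingCat.ofHom φ)) (U := ⊤))
    ((Scheme.ΓSpecIso (CommRingCat.of R)).inv a))

end OpenChart

/-! ### Toric atlases, orbits and the Picard group. -/

/-- An atlas of `X` by the affine toric varieties of the cones in `C`, where a cone is given by the
set of its rays, and `p j m` is the value of the lattice point `m` on the ray `j`. -/
structure TAtlas {J : Type*} [DecidableEq J] {M : Type} [AddCommGroup M] (p : J → M →+ ℤ)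
    (C : Set (Finset J)) (X : Scheme.{0}) where
  chart : ∀ s ∈ C, Spec (CommRingCat.of (CoordRing p s)) ⟶ X
  isOpenImmersion : ∀ s hs, IsOpenImmersion (chart s hs)
  smooth : ∀ s ∈ C, IsSmoothCone p s
  face_mem : ∀ s ∈ C, ∀ t ⊆ s, t ∈ C
  chart_face : ∀ s hs t (h : t ⊆ s), Spec.map (CommRingCat.ofHom (resMap p h)) ≫ chart s hs =
    chart t (face_mem s hs t h)
  chart_inter : ∀ s hs t ht, Set.range (chart s hs) ∩ Set.range (chart t ht) ⊆
    Set.range (chart (s ∩ t) (face_mem s hs _ Finset.inter_subset_left))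
  covers : ∀ x, ∃ s hs, x ∈ Set.range (chart s hs)

namespace TAtlas

variable {J : Type*} [DecidableEq J] {M : Type} [AddCommGroup M] {p : J → M →+ ℤ}
  {C : Set (Finset J)} {X : Scheme.{0}} (A : TAtlas p C X)

instance (s : Finset J) (hs : s ∈ C) : IsOpenImmersion (A.chart s hs) := A.isOpenImmersion s hs

theorem range_chart_mono {s t : Finset J} (hs : s ∈ C) (ht : t ∈ C) (h : t ⊆ s) :
    Set.range (A.chart t ht) ⊆ Set.range (A.chart s hs) := by
  rintro _ ⟨P, rfl⟩
  exact ⟨Spec.map (CommRingCat.ofHom (resMap p h)) P, congr($(A.chart_face s hs t h) P)⟩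

/-- A cone of least cardinality among those whose chart contains `x`; intersecting it with any other
such cone gives a chart around `x` again, so it cannot get smaller. -/
theorem exists_coneAt (x : X) : ∃ s, (∃ hs, x ∈ Set.range (A.chart s hs)) ∧
    ∀ t ht, x ∈ Set.range (A.chart t ht) → s ⊆ t := by
  classical
  have h : ∃ n s, Finset.card s = n ∧ ∃ hs, x ∈ Set.range (A.chart s hs) := by
    obtain ⟨s, hs, hx⟩ := A.covers x
    exact ⟨_, s, rfl, hs, hx⟩
  obtain ⟨s, hn, hs, hx⟩ := Nat.find_spec h
  refine ⟨s, ⟨hs, hx⟩, fun t ht hxt => ?_⟩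
  have := Nat.find_min' h ⟨s ∩ t, rfl, _, A.chart_inter s hs t ht ⟨hx, hxt⟩⟩
  rw [← hn] at this
  exact Finset.inter_eq_left.1 (Finset.eq_of_subset_of_card_le Finset.inter_subset_left this)

/-- The cone whose orbit contains the point `x`. -/
noncomputable def coneAt (x : X) : Finset J := (A.exists_coneAt x).choose

theorem coneAt_mem (x : X) : A.coneAt x ∈ C := (A.exists_coneAt x).choose_spec.1.1

theorem mem_range_coneAt (x : X) : x ∈ Set.range (A.chart (A.coneAt x) (A.coneAt_mem x)) :=
  (A.exists_coneAt x).choose_spec.1.2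

theorem mem_range_chart_iff {s : Finset J} (hs : s ∈ C) {x : X} :
    x ∈ Set.range (A.chart s hs) ↔ A.coneAt x ⊆ s :=
  ⟨(A.exists_coneAt x).choose_spec.2 s hs,
    fun h => A.range_chart_mono hs (A.coneAt_mem x) h (A.mem_range_coneAt x)⟩

theorem coneAt_chart_subset {s : Finset J} (hs : s ∈ C) (P) : A.coneAt (A.chart s hs P) ⊆ s :=
  (A.mem_range_chart_iff hs).1 ⟨P, rfl⟩

/-- The point `P` of the chart of `s` lies on the divisor of the ray `j` if and only if the
coordinate `e` vanishes there. -/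
theorem mem_coneAt_chart_iff {s : Finset J} (hs : s ∈ C) {j : J} (hj : j ∈ s) {e : M}
    (he : ∀ k ∈ s, p k e = if k = j then 1 else 0) (heS : e ∈ dualSG p s)
    (P : PrimeSpectrum (CoordRing p s)) :
    j ∈ A.coneAt (A.chart s hs P) ↔ chi p s e heS ∈ P.asIdeal := by
  constructor
  · intro h
    by_contra hP
    -- Where the coordinate does not vanish, `P` lies in the smaller chart obtained by inverting it,
    -- and the cones of points in that chart do not contain `j`.
    let _ := (resMap p (Finset.erase_subset j s)).toAlgebra
    have := isLocalization_resMap (Finset.erase_subset j s) (fun k hk => by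
      by_cases hkj : k = j
      · exact Or.inl hkj
      · exact Or.inr (Finset.mem_erase.2 ⟨hkj, hk⟩)) (Finset.notMem_erase j s) he heS
    obtain ⟨Q, hQ⟩ : P ∈ Set.range (PrimeSpectrum.comap (algebraMap (CoordRing p s)
        (CoordRing p (s.erase j)))) := by
      rw [PrimeSpectrum.localization_away_comap_range _ (chi p s e heS)]
      exact hP
    have e1 : A.chart s hs P = A.chart _ (A.face_mem s hs _ (Finset.erase_subset j s)) Q := by
      rw [← A.chart_face s hs _ (Finset.erase_subset j s), ← hQ]
      rfl
    rw [e1] at h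
    exact Finset.notMem_erase j s (A.coneAt_chart_subset _ Q h)
  · intro hP
    by_contra h
    -- Conversely, on the chart of a face without `j` the coordinate is an invertible character.
    set t := A.coneAt (A.chart s hs P) with ht
    have hts : t ⊆ s := A.coneAt_chart_subset hs P
    obtain ⟨Q, hQ⟩ := A.mem_range_coneAt (A.chart s hs P)
    have e1 : Spec.map (CommRingCat.ofHom (resMap p hts)) Q = P := by
      apply (A.chart s hs).isOpenEmbedding.injective
      rw [← hQ]
      exact congr($(A.chart_face s hs t hts) Q)
    rw [← e1] at hP
    have hP' : resMap p hts (chi p s e heS) ∈ Q.asIdeal := hP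
    rw [resMap_chi] at hP'
    refine Q.isPrime.ne_top (Ideal.eq_top_of_isUnit_mem _ hP' (isUnit_chi fun k hk => ?_))
    rw [he k (hts hk), if_neg]
    rintro rfl
    exact h hk

theorem dual_mem {s : Finset J} {j : J} {e : M} (he : ∀ k ∈ s, p k e = if k = j then 1 else 0) :
    e ∈ dualSG p s := fun k hk => by
  rw [he k hk]
  split_ifs <;> decide

/-- Every orbit has a point. -/
theorem exists_coneAt_eq {s : Finset J} (hs : s ∈ C) : ∃ x, A.coneAt x = s := by
  obtain ⟨φ, hφ⟩ := exists_ringHom_chi_eq_zero p s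
  let P : PrimeSpectrum (CoordRing p s) := ⟨RingHom.ker φ, RingHom.ker_isPrime φ⟩
  refine ⟨A.chart s hs P, (A.coneAt_chart_subset hs P).antisymm fun j hj => ?_⟩
  obtain ⟨e, he⟩ := (A.smooth s hs).exists_dual j
  rw [A.mem_coneAt_chart_iff hs hj he (dual_mem he)]
  refine hφ e _ ⟨j, hj, ?_⟩
  rw [he j hj, if_pos rfl]
  exact one_ne_zero

/-- The chart of the cone of `x` is open, so it contains all generisations of `x`. -/
theorem coneAt_subset_of_specializes {x y : X} (h : y ⤳ x) : A.coneAt y ⊆ A.coneAt x := by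
  rw [← A.mem_range_chart_iff (A.coneAt_mem x)]
  exact h.mem_open (A.chart _ (A.coneAt_mem x)).isOpenEmbedding.isOpen_range (A.mem_range_coneAt x)

/-- The generic point of the divisor of the ray `j`, in a chart. -/
theorem exists_prime_ray {s : Finset J} (hs : s ∈ C) {j : J} (hj : j ∈ s) {e : M}
    (he : ∀ k ∈ s, p k e = if k = j then 1 else 0) (heS : e ∈ dualSG p s) :
    ∃ Q : PrimeSpectrum (CoordRing p s), Q.asIdeal = Ideal.span {chi p s e heS} ∧
      A.coneAt (A.chart s hs Q) = {j} := by
  have hsj : s = insert j (s.erase j) := (Finset.insert_erase hj).symm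
  have hsm : IsSmoothCone p s := A.smooth s hs
  have := hsm.twoUniqueSums
  have : TwoUniqueSums (p j).ker :=
    TwoUniqueSums.of_injective_addHom (p j).ker.subtype.toAddHom Subtype.val_injective inferInstance
  have := twoUniqueSums_submonoid (dualSG (kerPairing p j) (s.erase j))
  have : IsDomain (CoordRing (kerPairing p j) (s.erase j)) := NoZeroDivisors.to_isDomain _
  -- Restriction to the orbit closure maps to a domain, so its kernel is prime. Coordinates of the
  -- other rays restrict to nonzero monomials, so `j` is the only ray of this point.
  let Q : PrimeSpectrum (CoordRing p s) :=
    ⟨RingHom.ker (faceMap p j hsj), RingHom.ker_isPrime _⟩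
  refine ⟨Q, ?_, ?_⟩
  · ext a
    rw [Ideal.mem_span_singleton, ← mem_ker_faceMap_iff hsj (Finset.notMem_erase j s) he heS]
    rfl
  · ext k
    rw [Finset.mem_singleton]
    constructor
    · intro hk
      by_contra hkj
      have hks := A.coneAt_chart_subset hs Q hk
      obtain ⟨d, hd⟩ := hsm.exists_dual k
      rw [A.mem_coneAt_chart_iff hs hks hd (dual_mem hd)] at hk
      have hk' : faceMap p j hsj (chi p s d (dual_mem hd)) = 0 := hk
      rw [chi, faceMap_single _ _ _ (by
        change p j d = 0
        rw [hd j hj, if_neg (Ne.symm hkj)]), AddMonoidAlgebra.single_eq_zero] at hk'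
      exact one_ne_zero hk'
    · rintro rfl
      rw [A.mem_coneAt_chart_iff hs hj he heS]
      exact (mem_ker_faceMap_iff hsj (Finset.notMem_erase k s) he heS).2 dvd_rfl

theorem exists_chart_eq (x : X) : ∃ P : PrimeSpectrum (CoordRing p (A.coneAt x)),
    A.chart _ (A.coneAt_mem x) P = x :=
  A.mem_range_coneAt x

theorem mem_coneAt_iff_of_chart_eq {x : X} {s : Finset J} (hs : s ∈ C)
    {P : PrimeSpectrum (CoordRing p s)} (hP : A.chart s hs P = x) {j : J} (hj : j ∈ s) {e : M}
    (he : ∀ k ∈ s, p k e = if k = j then 1 else 0) (heS : e ∈ dualSG p s) :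
    j ∈ A.coneAt x ↔ chi p s e heS ∈ P.asIdeal := by
  subst hP
  exact A.mem_coneAt_chart_iff hs hj he heS P

theorem chart_specializes {x : X} {s : Finset J} (hs : s ∈ C)
    {P Q : PrimeSpectrum (CoordRing p s)} (hP : A.chart s hs P = x) {t : CoordRing p s}
    (hQ : Q.asIdeal = Ideal.span {t}) (ht : t ∈ P.asIdeal) : A.chart s hs Q ⤳ x := by
  subst hP
  refine Specializes.map ?_ (A.chart _ hs).continuous
  refine (PrimeSpectrum.le_iff_specializes Q P).1 ?_
  change Q.asIdeal ≤ P.asIdeal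
  rwa [hQ, Ideal.span_singleton_le_iff_mem]

/-- Every point of the divisor of the ray `j` is a specialisation of a point that lies on no other
divisor. -/
theorem exists_specializes_coneAt_eq {x : X} {j : J} (hj : j ∈ A.coneAt x) :
    ∃ y, y ⤳ x ∧ A.coneAt y = {j} := by
  have hs := A.coneAt_mem x
  obtain ⟨e, he⟩ := (A.smooth _ hs).exists_dual j
  obtain ⟨Q, hQ, hQj⟩ := A.exists_prime_ray hs hj he (dual_mem he)
  refine ⟨_, ?_, hQj⟩
  obtain ⟨P, hP⟩ := A.exists_chart_eq x
  exact A.chart_specializes hs hP hQ ((A.mem_coneAt_iff_of_chart_eq hs hP hj he (dual_mem he)).1 hj)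

theorem exists_localEq (a : J → ℤ) (x : X) : ∃ m, ∀ j ∈ A.coneAt x, p j m = a j :=
  (A.smooth _ (A.coneAt_mem x)).exists_eq a

/-- A point of codimension one has no proper generisation but the generic point. -/
theorem eq_of_specializes_of_coheight_eq_one {X : Scheme.{0}} [IsIntegral X] {y z : X}
    (hz : Order.coheight z = 1) (h : y ⤳ z) (hy : y ≠ genericPoint X) : y = z := by
  by_contra hne
  have hlt : z < y := lt_of_le_not_ge (Scheme.le_iff_specializes.2 h) fun h' =>
    hne (h.antisymm (Scheme.le_iff_specializes.1 h')).eq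
  have hlt' : y < genericPoint X :=
    lt_of_le_not_ge (Scheme.le_iff_specializes.2 (genericPoint_specializes y)) fun h' =>
      hy ((Scheme.le_iff_specializes.1 h').antisymm (genericPoint_specializes y)).eq
  have h1 := Order.coheight_add_one_le hlt
  have h2 := Order.coheight_add_one_le hlt'
  rw [hz] at h1
  have h3 : (1 : ℕ∞) ≤ Order.coheight y := le_trans le_add_self h2
  have h4 : (1 : ℕ∞) + 1 ≤ 1 := le_trans (by gcongr) h1
  exact absurd h4 (by decide)

section Integral

variable [IsIntegral X]

theorem empty_mem (A : TAtlas p C X) : ∅ ∈ C := by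
  obtain ⟨s, hs, -⟩ := A.covers (genericPoint X)
  exact A.face_mem s hs ∅ (Finset.empty_subset s)

theorem isDomain (A : TAtlas p C X) (s : Finset J) : IsDomain (CoordRing p s) :=
  (A.smooth ∅ A.empty_mem).isDomain s

theorem coneAt_genericPoint : A.coneAt (genericPoint X) = ∅ := by
  obtain ⟨x, hx⟩ := A.exists_coneAt_eq A.empty_mem
  have := A.coneAt_subset_of_specializes (genericPoint_specializes x)
  rw [hx] at this
  exact Finset.subset_empty.1 this

/-- A function on a chart, as a rational function. -/
noncomputable def fn (s : Finset J) (hs : s ∈ C) : CoordRing p s →+* X.functionField :=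
  haveI := A.isDomain s
  chartFun (A.chart s hs)

theorem pullFun_fn {J' : Type*} [DecidableEq J'] {M' : Type} [AddCommGroup M']
    {p' : J' → M' →+ ℤ} {C' : Set (Finset J')} {X' : Scheme.{0}} [IsIntegral X']
    (A' : TAtlas p' C' X') (f : X' ⟶ X) (hf : f (genericPoint X') = genericPoint X)
    {s : Finset J} {s' : Finset J'} (hs : s ∈ C) (hs' : s' ∈ C') (φ : CoordRing p s →+* CoordRing p' s')
    (h : A'.chart s' hs' ≫ f = Spec.map (CommRingCat.ofHom φ) ≫ A.chart s hs) (a : CoordRing p s) :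
    pullFun f hf (A.fn s hs a) = A'.fn s' hs' (φ a) :=
  haveI := A.isDomain s
  haveI := A'.isDomain s'
  pullFun_chartFun _ _ f hf φ h a

/-- Both sides are the pull-back of the same function along the identity of `X`, expressed once in
the chart of `s` and once in that of `t`. -/
theorem fn_resMap {s t : Finset J} (hs : s ∈ C) (ht : t ∈ C) (h : t ⊆ s) (a : CoordRing p s) :
    A.fn t ht (resMap p h a) = A.fn s hs a := by
  have hid : pullFun (𝟙 X) rfl (A.fn s hs a) = A.fn s hs a := by
    refine (A.pullFun_fn A (𝟙 X) rfl hs hs (RingHom.id _) ?_ a).trans rfl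
    rw [Category.comp_id]
    exact (Category.id_comp _).symm.trans (congrArg (· ≫ _) (Spec.map_id _).symm)
  rw [← hid]
  exact (A.pullFun_fn A (𝟙 X) rfl hs ht (resMap p h)
    (by rw [Category.comp_id, A.chart_face s hs t h]) a).symm

theorem empty_dual {J : Type*} {M : Type} [AddCommGroup M] {p : J → M →+ ℤ} (m : M) : m ∈ dualSG p ∅ := fun _ hj => absurd hj (Finset.notMem_empty _)

/-- Characters, as rational functions. -/
noncomputable def chr : Multiplicative M →* (X.functionField)ˣ :=
  MonoidHom.toHomUnits
    { toFun := fun m => A.fn ∅ A.empty_mem (chi p ∅ m.toAdd (empty_dual _))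
      map_one' := by
        refine Eq.trans ?_ (map_one (A.fn ∅ A.empty_mem))
        rfl
      map_mul' := fun m n => by
        rw [← map_mul, chi_mul_chi]
        rfl }

theorem chr_eq {s : Finset J} (hs : s ∈ C) {m : M} (hm : m ∈ dualSG p s) :
    (A.chr (.ofAdd m) : X.functionField) = A.fn s hs (chi p s m hm) := by
  rw [← A.fn_resMap hs A.empty_mem (Finset.empty_subset s), resMap_chi]
  rfl

theorem chr_mem_unitsAt {x : X} {m : M} (h : ∀ j ∈ A.coneAt x, p j m = 0) :
    A.chr (.ofAdd m) ∈ unitsAt x := by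
  obtain ⟨P, hP⟩ := A.mem_range_coneAt x
  have := A.isDomain (A.coneAt x)
  have hm : m ∈ dualSG p (A.coneAt x) := fun j hj => (h j hj).ge
  rw [← hP]
  refine mem_unitsAt_of_notMem (A.chart _ (A.coneAt_mem x)) (A.chr_eq _ hm) fun hc => ?_
  exact P.isPrime.ne_top (Ideal.eq_top_of_isUnit_mem _ hc (isUnit_chi h))

/-- Invertibility passes to a generisation `y` that lies on the divisor of `j` alone. There the
character of `m` is, up to a unit, the power `p j m` of the coordinate of `j`, and no nonzero power
of a vanishing function is invertible. -/
theorem apply_eq_zero_of_chr_mem_unitsAt {x : X} {m : M} (h : A.chr (.ofAdd m) ∈ unitsAt x) {j : J}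
    (hj : j ∈ A.coneAt x) : p j m = 0 := by
  obtain ⟨y, hyx, hy⟩ := A.exists_specializes_coneAt_eq hj
  replace h := unitsAt_mono hyx h
  have hs := A.coneAt_mem y
  have hjy : j ∈ A.coneAt y := hy ▸ Finset.mem_singleton_self j
  obtain ⟨e, he⟩ := (A.smooth _ hs).exists_dual j
  have hej : p j e = 1 := (he j hjy).trans (if_pos rfl)
  obtain ⟨P, hP⟩ := A.exists_chart_eq y
  have hPe : chi p _ e (dual_mem he) ∈ P.asIdeal :=
    (A.mem_coneAt_iff_of_chart_eq hs hP hjy he _).1 hjy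
  have hpow : A.chr (.ofAdd e) ^ (p j m) ∈ unitsAt y := by
    have h' : A.chr (.ofAdd (m - p j m • e)) ∈ unitsAt y := A.chr_mem_unitsAt fun k hk => by
      rw [hy, Finset.mem_singleton] at hk
      rw [hk, map_sub, map_zsmul, hej, smul_eq_mul, mul_one, sub_self]
    rw [ofAdd_sub, ofAdd_zsmul, map_div, map_zpow] at h'
    simpa using div_mem h h'
  have hno : ∀ n : ℕ, n ≠ 0 → A.chr (.ofAdd e) ^ n ∉ unitsAt y := by
    intro n hn hc
    rw [← hP] at hc
    have := A.isDomain (A.coneAt y)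
    refine notMem_of_mem_unitsAt (A.chart _ hs) (a := chi p _ e (dual_mem he) ^ n) ?_ hc
      (Ideal.pow_mem_of_mem _ hPe n (Nat.pos_of_ne_zero hn))
    rw [Units.val_pow_eq_pow_val, A.chr_eq hs (dual_mem he), ← map_pow]
    rfl
  by_contra hne
  obtain ⟨n, hn | hn⟩ := Int.eq_nat_or_neg (p j m)
  · rw [hn, zpow_natCast] at hpow
    exact hno n (by omega) hpow
  · rw [hn, zpow_neg, zpow_natCast, inv_mem_iff] at hpow
    exact hno n (by omega) hpow

theorem chr_mem_unitsAt_iff {x : X} {m : M} :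
    A.chr (.ofAdd m) ∈ unitsAt x ↔ ∀ j ∈ A.coneAt x, p j m = 0 :=
  ⟨fun h _ hj => A.apply_eq_zero_of_chr_mem_unitsAt h hj, A.chr_mem_unitsAt⟩

/-- A rational function that is invertible on the torus is a character up to a function that is
invertible everywhere. -/
theorem exists_chr_mul_mem_unitsAt {f : (X.functionField)ˣ}
    (hf : ∀ x, A.coneAt x = ∅ → f ∈ unitsAt x) :
    ∃ m, ∀ x, f * A.chr (.ofAdd m) ∈ unitsAt x := by
  have := A.isDomain ∅
  obtain ⟨u, hu, hfu⟩ := exists_isUnit_chartFun_eq (A.chart ∅ A.empty_mem) (k := f)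
    fun P => hf _ (Finset.subset_empty.1 (A.coneAt_chart_subset A.empty_mem P))
  have := (A.smooth ∅ A.empty_mem).twoUniqueSums
  have := twoUniqueSums_submonoid (dualSG p ∅)
  obtain ⟨⟨n, hn⟩, c, hc, rfl⟩ := exists_single_of_isUnit hu
  -- On the torus `f` is `c` times the character `n`; cancelling the character leaves the nonzero
  -- constant `c`.
  refine ⟨-n, fun x => ?_⟩
  obtain ⟨P, hP⟩ := A.mem_range_coneAt x
  have hs := A.coneAt_mem x
  have := A.isDomain (A.coneAt x)
  rw [← hP]
  refine mem_unitsAt_of_notMem (A.chart _ hs) (a := AddMonoidAlgebra.single 0 c) ?_ fun h => ?_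
  · change _ = A.fn _ hs _
    change _ = A.fn _ _ _ at hfu
    rw [← A.fn_resMap hs A.empty_mem (Finset.empty_subset _), Units.val_mul, hfu,
      A.chr_eq A.empty_mem (empty_dual (-n)), ← map_mul, resMap_single, chi,
      AddMonoidAlgebra.single_mul_single, mul_one]
    congr 2
    ext
    exact add_neg_cancel n
  · refine P.isPrime.ne_top (Ideal.eq_top_of_isUnit_mem _ h ?_)
    exact (IsUnit.mk0 c hc).map AddMonoidAlgebra.singleZeroRingHom

/-- The toric divisor with multiplicities `a`. -/
noncomputable def toricDiv (a : J → ℤ) : CDiv X :=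
  ⟨fun x => A.chr (.ofAdd (A.exists_localEq a x).choose), fun x => by
    refine ⟨⟨_, (A.chart _ (A.coneAt_mem x)).isOpenEmbedding.isOpen_range⟩,
      A.mem_range_coneAt x, fun y hy => ?_⟩
    rw [← map_div, ← ofAdd_sub]
    refine A.chr_mem_unitsAt fun j hj => ?_
    have hjx := (A.mem_range_chart_iff (A.coneAt_mem x)).1 hy hj
    rw [map_sub, (A.exists_localEq a x).choose_spec j hjx, (A.exists_localEq a y).choose_spec j hj,
      sub_self]⟩

theorem toricDiv_apply (a : J → ℤ) (x : X) :
    ∃ m, (A.toricDiv a).1 x = A.chr (.ofAdd m) ∧ ∀ j ∈ A.coneAt x, p j m = a j :=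
  ⟨_, rfl, (A.exists_localEq a x).choose_spec⟩

/-- The line bundle of a toric divisor. -/
noncomputable def toricCls : Multiplicative (J → ℤ) →* Pic X :=
  MonoidHom.mk' (fun a => cls (A.toricDiv a.toAdd)) fun a b => by
    rw [← map_mul]
    refine cls_eq_cls ⟨1, fun x => ?_⟩
    obtain ⟨m, hm, hma⟩ := A.toricDiv_apply a.toAdd x
    obtain ⟨n, hn, hnb⟩ := A.toricDiv_apply b.toAdd x
    obtain ⟨l, hl, hlab⟩ := A.toricDiv_apply (a * b).toAdd x
    change _ / ((A.toricDiv a.toAdd).1 x * (A.toricDiv b.toAdd).1 x) * 1 ∈ _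
    rw [hm, hn, hl, mul_one, ← map_mul, ← map_div, ← ofAdd_add, ← ofAdd_sub]
    refine A.chr_mem_unitsAt fun j hj => ?_
    rw [map_sub, map_add, hma j hj, hnb j hj, hlab j hj]
    exact sub_self _

/-- Linear equivalence of toric divisors. -/
theorem toricCls_eq_one_iff {a : J → ℤ} :
    A.toricCls (.ofAdd a) = 1 ↔ ∃ m, ∀ s ∈ C, ∀ j ∈ s, p j m = a j := by
  refine cls_eq_one_iff.trans ⟨?_, ?_⟩
  · rintro ⟨f, hf⟩
    -- A toric divisor has unit local equations on the torus, so the function `f` that trivialises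
    -- it is invertible there and is the inverse of a character `n`, up to a global unit.
    obtain ⟨n, hn⟩ := A.exists_chr_mul_mem_unitsAt (f := f) fun x hx => by
      obtain ⟨m, hm, -⟩ := A.toricDiv_apply a x
      have := hf x
      change (A.toricDiv a).1 x * f ∈ _ at this
      rw [hm] at this
      refine ((unitsAt x).mul_mem_cancel_left (A.chr_mem_unitsAt (m := m) fun j hj => ?_)).1 this
      rw [hx] at hj
      exact absurd hj (Finset.notMem_empty j)
    refine ⟨n, fun s hs j hj => ?_⟩
    obtain ⟨x, rfl⟩ := A.exists_coneAt_eq hs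
    obtain ⟨m, hm, hma⟩ := A.toricDiv_apply a x
    have := div_mem (hf x) (hn x)
    change (A.toricDiv a).1 x * f / _ ∈ _ at this
    rw [hm, mul_comm, mul_div_mul_left_eq_div, ← map_div, ← ofAdd_sub, A.chr_mem_unitsAt_iff] at this
    rw [← hma j hj, ← sub_eq_zero, ← neg_sub, ← map_sub, this j hj, neg_zero]
  · rintro ⟨n, hn⟩
    refine ⟨A.chr (.ofAdd (-n)), fun x => ?_⟩
    obtain ⟨m, hm, hma⟩ := A.toricDiv_apply a x
    change (A.toricDiv a).1 x * _ ∈ _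
    rw [hm, ← map_mul, ← ofAdd_add]
    refine A.chr_mem_unitsAt fun j hj => ?_
    rw [map_add, map_neg, hma j hj, hn _ (A.coneAt_mem x) j hj, add_neg_cancel]

/-- The Picard group is generated by the toric divisors. -/
theorem toricCls_surjective : Function.Surjective A.toricCls := by
  classical
  intro L
  obtain ⟨D, rfl⟩ := cls_surjective L
  -- The coordinate rings are unique factorization domains, so `D` is principal on every chart.
  have key : ∀ s hs, ∃ f, ∀ x ∈ Set.range (A.chart s hs), D.1 x * f ∈ unitsAt x := by
    intro s hs
    have := A.isDomain s
    have := (A.smooth s hs).uniqueFactorizationMonoid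
    obtain ⟨f, hf⟩ := exists_mul_mem_unitsAt (A.chart s hs) D.2
    exact ⟨f, by rintro _ ⟨P, rfl⟩; exact hf P⟩
  choose f hf using key
  set f₀ := f ∅ A.empty_mem with hf₀
  -- The equations on the torus and on the chart of `s` have a quotient that is invertible on the
  -- torus. So a single `f₀` serves all charts after a correction by characters.
  have key2 : ∀ s (_ : s ∈ C), ∃ n, ∀ x, A.coneAt x ⊆ s → D.1 x * f₀ * A.chr (.ofAdd n) ∈ unitsAt x := by
    intro s hs
    obtain ⟨n, hn⟩ := A.exists_chr_mul_mem_unitsAt (f := f₀ / f s hs) fun x hx => by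
      have h1 := hf s hs x ((A.mem_range_chart_iff hs).2 (hx ▸ Finset.empty_subset s))
      have h2 := hf ∅ A.empty_mem x ((A.mem_range_chart_iff A.empty_mem).2 hx.le)
      simpa using div_mem h2 h1
    refine ⟨n, fun x hx => ?_⟩
    have := mul_mem (hf s hs x ((A.mem_range_chart_iff hs).2 hx)) (hn x)
    rwa [← mul_assoc, mul_assoc (D.1 x), mul_div_cancel] at this
  choose n hn using key2
  -- The multiplicity along `j` is read off from the correcting character on the chart of the ray
  -- `j`. The value `0` at indices that are not rays is arbitrary, since no cone contains them.
  refine ⟨.ofAdd fun j => if h : {j} ∈ C then - p j (n {j} h) else 0, ?_⟩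
  refine (cls_eq_cls ⟨f₀, fun x => ?_⟩).symm
  obtain ⟨m, hm, hma⟩ := A.toricDiv_apply _ x
  rw [hm]
  have hs := A.coneAt_mem x
  have h1 := hn _ hs x le_rfl
  have h2 : A.chr (.ofAdd (n _ hs + m)) ∈ unitsAt x := A.chr_mem_unitsAt fun j hj => by
    have hj' : {j} ∈ C := A.face_mem _ hs _ (Finset.singleton_subset_iff.2 hj)
    obtain ⟨y, hy⟩ := A.exists_coneAt_eq hj'
    have h3 := div_mem (hn _ hs y (by rw [hy]; exact Finset.singleton_subset_iff.2 hj))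
      (hn _ hj' y hy.le)
    rw [mul_div_mul_left_eq_div, ← map_div, ← ofAdd_sub, A.chr_mem_unitsAt_iff] at h3
    have h4 := h3 j (hy ▸ Finset.mem_singleton_self j)
    rw [map_add, hma j hj, toAdd_ofAdd, dif_pos hj', ← h4, map_sub]
    ring
  have := div_mem h1 h2
  rwa [ofAdd_add, map_mul, mul_comm (A.chr (.ofAdd (n _ hs))), mul_div_mul_right_eq_div,
    mul_div_right_comm] at this

/-- The divisor of the ray `j` is a reduced divisor on the closure of the orbit. -/
theorem isClassOfDivisor_toricCls [IsLocallyNoetherian X] (j : J) :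
    IsClassOfDivisor {x | j ∈ A.coneAt x} (A.toricCls (.ofAdd (Pi.single j 1))) := by
  refine isClassOfDivisor_cls fun z hz => ?_
  obtain ⟨m, hm, hma⟩ := A.toricDiv_apply (Pi.single j 1) z
  change (_ → Scheme.ord (((A.toricDiv (Pi.single j 1)).1 z : (X.functionField)ˣ) : X.functionField)
    z = 1) ∧ (_ → Scheme.ord (((A.toricDiv (Pi.single j 1)).1 z : (X.functionField)ˣ) :
      X.functionField) z = 0)
  rw [hm]
  have hs := A.coneAt_mem z
  constructor
  · intro hj
    have hj : j ∈ A.coneAt z := hj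
    have he : ∀ k ∈ A.coneAt z, p k m = if k = j then 1 else 0 := fun k hk => by
      rw [hma k hk, Pi.single_apply]
    obtain ⟨Q, hQ, hQj⟩ := A.exists_prime_ray hs hj he (dual_mem he)
    obtain ⟨P, hP⟩ := A.exists_chart_eq z
    -- The generic point of the ray divisor specialises to `z` and is not the generic point of `X`,
    -- so in codimension one it is `z`.
    have hQz : A.chart _ hs Q = z := by
      refine eq_of_specializes_of_coheight_eq_one hz (A.chart_specializes hs hP hQ
        ((A.mem_coneAt_iff_of_chart_eq hs hP hj he _).1 hj)) fun h => ?_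
      rw [h, A.coneAt_genericPoint] at hQj
      exact Finset.singleton_ne_empty j hQj.symm
    have := A.isDomain (A.coneAt z)
    rw [A.chr_eq hs (dual_mem he)]
    have key : ∀ w, A.chart _ hs Q = w → Order.coheight w = 1 →
        Scheme.ord (A.fn _ hs (chi p _ m (dual_mem he))) w = 1 := by
      rintro _ rfl hw
      exact ord_eq_one_of_asIdeal_eq (A.chart _ hs) hw
        (AddMonoidAlgebra.single_ne_zero.2 one_ne_zero) hQ
    exact key z hQz hz
  · intro hj
    refine ord_eq_zero_of_mem_unitsAt (A.chr_mem_unitsAt fun k hk => ?_)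
    rw [hma k hk, Pi.single_eq_of_ne]
    rintro rfl
    exact hj hk

end Integral

end TAtlas

open Limits

/-! ### Reduced closed subschemes -/

section Lift

variable {D E X : Scheme.{0}} (i : D ⟶ X) (j : E ⟶ X) [IsReduced D] [IsClosedImmersion j]

/-- The projection is a base change of the closed immersion `j` and is surjective by the inclusion
of ranges; its target is reduced. -/
theorem isIso_fst_of_range_subset (h : Set.range i ⊆ Set.range j) : IsIso (pullback.fst i j) := by
  have : Surjective (pullback.fst i j) := ⟨fun x => by
    obtain ⟨y, hy⟩ := h ⟨x, rfl⟩
    obtain ⟨z, hz, -⟩ := Scheme.Pullback.exists_preimage_pullback x y hy.symm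
    exact ⟨z, hz⟩⟩
  exact isIso_of_isClosedImmersion_of_surjective _

/-- A morphism from a reduced scheme factors through a closed subscheme that contains its image. -/
noncomputable def closedLift (h : Set.range i ⊆ Set.range j) : D ⟶ E :=
  haveI := isIso_fst_of_range_subset i j h
  inv (pullback.fst i j) ≫ pullback.snd i j

theorem closedLift_comp (h : Set.range i ⊆ Set.range j) : closedLift i j h ≫ j = i := by
  have := isIso_fst_of_range_subset i j h
  rw [closedLift, Category.assoc, ← pullback.condition, IsIso.inv_hom_id_assoc]

end Lift

/-- Reduced closed subschemes with the same support are isomorphic. -/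
noncomputable def closedIso {D E X : Scheme.{0}} (i : D ⟶ X) (j : E ⟶ X) [IsReduced D] [IsReduced E]
    [IsClosedImmersion i] [IsClosedImmersion j] (h : Set.range i = Set.range j) : D ≅ E where
  hom := closedLift i j h.le
  inv := closedLift j i h.ge
  hom_inv_id := by
    rw [← cancel_mono i, Category.assoc, closedLift_comp, closedLift_comp, Category.id_comp]
  inv_hom_id := by
    rw [← cancel_mono j, Category.assoc, closedLift_comp, closedLift_comp, Category.id_comp]

/-- A reduced closed subscheme of an open subscheme `U` of `X` that is supported on the intersection
of `U` with a reduced closed subscheme `D` is an open subscheme of `D`. -/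
theorem isOpenImmersion_closedLift {Q U D X : Scheme.{0}} (k : Q ⟶ U) (u : U ⟶ X) (i : D ⟶ X)
    [IsReduced Q] [IsReduced D] [IsClosedImmersion k] [IsOpenImmersion u] [IsClosedImmersion i]
    (h : Set.range (k ≫ u) ⊆ Set.range i) (h' : ∀ x, u x ∈ Set.range i → x ∈ Set.range k) :
    IsOpenImmersion (closedLift (k ≫ u) i h) := by
  -- The pull-back of `D` to `U` is open in `D`, hence reduced, and `q` is a surjective closed
  -- immersion into it, so `q` is an isomorphism.
  let q : Q ⟶ pullback i u := pullback.lift (closedLift (k ≫ u) i h) k (closedLift_comp _ _ _)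
  have hq : q ≫ pullback.snd i u = k := pullback.lift_snd _ _ _
  have : IsClosedImmersion (q ≫ pullback.snd i u) := by rw [hq]; infer_instance
  have : IsClosedImmersion q := IsClosedImmersion.of_comp_isClosedImmersion q (pullback.snd i u)
  have : IsReduced (pullback i u) := isReduced_of_isOpenImmersion (pullback.fst i u)
  have : Surjective q := ⟨fun z => by
    obtain ⟨w, hw⟩ := h' (pullback.snd i u z) ⟨pullback.fst i u z, by
      rw [← Scheme.Hom.comp_apply, pullback.condition, Scheme.Hom.comp_apply]⟩
    refine ⟨w, (pullback.snd i u).isClosedEmbedding.injective ?_⟩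
    rw [← Scheme.Hom.comp_apply, hq, hw]⟩
  have : IsIso q := isIso_of_isClosedImmersion_of_surjective q
  have e : q ≫ pullback.fst i u = closedLift (k ≫ u) i h := pullback.lift_fst _ _ _
  rw [← e]
  infer_instance

namespace TAtlas

variable {J : Type*} [DecidableEq J] {M : Type} [AddCommGroup M] {p : J → M →+ ℤ}
  {C : Set (Finset J)} {X : Scheme.{0}} (A : TAtlas p C X)

/-! ### Morphisms from a scheme with a toric atlas -/

/-- The open cover by the charts. -/
noncomputable def cover : X.OpenCover :=
  Scheme.Cover.mkOfCovers C (fun s => Spec (CommRingCat.of (CoordRing p s.1)))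
    (fun s => A.chart s.1 s.2) (fun x => by
      obtain ⟨s, hs, P, hP⟩ := A.covers x
      exact ⟨⟨s, hs⟩, P, hP⟩) fun s => A.isOpenImmersion s.1 s.2

theorem hom_ext {Z : Scheme.{0}} {f g : X ⟶ Z} (h : ∀ s hs, A.chart s hs ≫ f = A.chart s hs ≫ g) :
    f = g :=
  Scheme.Cover.hom_ext A.cover f g fun s => h s.1 s.2

/-- The overlap of two charts lies in the chart of the intersection of the cones, so compatibility
with faces already implies agreement on overlaps. -/
theorem exists_glue {Z : Scheme.{0}} (g : ∀ s ∈ C, Spec (CommRingCat.of (CoordRing p s)) ⟶ Z)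
    (hg : ∀ s hs t (h : t ⊆ s), Spec.map (CommRingCat.ofHom (resMap p h)) ≫ g s hs =
      g t (A.face_mem s hs t h)) : ∃ f : X ⟶ Z, ∀ s hs, A.chart s hs ≫ f = g s hs := by
  refine ⟨Scheme.Cover.glueMorphisms A.cover (fun s => g s.1 s.2) ?_, fun s hs =>
    Scheme.Cover.ι_glueMorphisms A.cover (fun s => g s.1 s.2) _ ⟨s, hs⟩⟩
  rintro ⟨s, hs⟩ ⟨t, ht⟩
  change pullback.fst (A.chart s hs) (A.chart t ht) ≫ g s hs =
    pullback.snd (A.chart s hs) (A.chart t ht) ≫ g t ht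
  have hst := A.face_mem s hs (s ∩ t) Finset.inter_subset_left
  have hr : Set.range (pullback.fst (A.chart s hs) (A.chart t ht) ≫ A.chart s hs) ⊆
      Set.range (A.chart _ hst) := by
    rw [Scheme.Pullback.range_fst_comp]
    exact A.chart_inter s hs t ht
  have hk := IsOpenImmersion.lift_fac _ _ hr
  set k := IsOpenImmersion.lift _ _ hr
  have h1 : k ≫ Spec.map (CommRingCat.ofHom (resMap p Finset.inter_subset_left)) =
      pullback.fst (A.chart s hs) (A.chart t ht) := by
    rw [← cancel_mono (A.chart s hs), Category.assoc, A.chart_face, hk]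
  have h2 : k ≫ Spec.map (CommRingCat.ofHom (resMap p Finset.inter_subset_right)) =
      pullback.snd (A.chart s hs) (A.chart t ht) := by
    rw [← cancel_mono (A.chart t ht), Category.assoc, A.chart_face, hk, pullback.condition]
  rw [← h1, ← h2, Category.assoc, Category.assoc, hg, hg]

theorem exists_iso {X' : Scheme.{0}} (A' : TAtlas p C X') :
    ∃ f : X ≅ X', ∀ s hs, A.chart s hs ≫ f.hom = A'.chart s hs := by
  obtain ⟨f, hf⟩ := A.exists_glue A'.chart A'.chart_face
  obtain ⟨g, hg⟩ := A'.exists_glue A.chart A.chart_face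
  exact ⟨⟨f, g, A.hom_ext fun s hs => by rw [reassoc_of% hf s hs, hg, Category.comp_id],
    A'.hom_ext fun s hs => by rw [reassoc_of% hg s hs, hf, Category.comp_id]⟩, hf⟩

theorem coneAt_apply {X' : Scheme.{0}} (A' : TAtlas p C X') (f : X ⟶ X') [IsIso f]
    (hf : ∀ s hs, A.chart s hs ≫ f = A'.chart s hs) (x : X) : A'.coneAt (f x) = A.coneAt x := by
  have h : ∀ s (hs : s ∈ C), A'.coneAt (f x) ⊆ s ↔ A.coneAt x ⊆ s := by
    intro s hs
    rw [← A'.mem_range_chart_iff hs, ← A.mem_range_chart_iff hs, ← hf]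
    constructor
    · rintro ⟨P, hP⟩
      exact ⟨P, f.isOpenEmbedding.injective hP⟩
    · rintro ⟨P, rfl⟩
      exact ⟨P, rfl⟩
  exact ((h _ (A.coneAt_mem x)).2 le_rfl).antisymm ((h _ (A'.coneAt_mem _)).1 le_rfl)

/-- An isomorphism that respects the charts respects the toric divisors. -/
theorem pullback_toricCls {X' : Scheme.{0}} [IsIntegral X] [IsIntegral X'] (A' : TAtlas p C X')
    (f : X ⟶ X') [IsIso f] (hf : ∀ s hs, A.chart s hs ≫ f = A'.chart s hs)
    (a : Multiplicative (J → ℤ)) : Pic.pullback f (A'.toricCls a) = A.toricCls a := by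
  have hgen : f (genericPoint X) = genericPoint X' := genericPoint_eq_of_isOpenImmersion f
  have hcone := A.coneAt_apply A' f hf
  have hchr : ∀ m, Units.map (pullFun f hgen).toMonoidHom (A'.chr m) = A.chr m := by
    intro m
    ext
    exact A'.pullFun_fn A f hgen A'.empty_mem A.empty_mem (RingHom.id _)
      ((hf _ _).trans ((Category.id_comp _).symm.trans (congrArg (· ≫ _) (Spec.map_id _).symm))) _
  refine pullback_cls f hgen fun x => ?_
  refine (hchr _).trans ?_
  change _ = A.chr _
  -- The chosen exponent of the local equation depends on the point only through its cone, so the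
  -- choices at `x` and `f x` coincide.
  simp only [hcone]

/-! ### Changing the lattice and the index set -/

section Reindex

variable {J' : Type*} {M' : Type} [AddCommGroup M'] {p' : J' → M' →+ ℤ}
  (B : M' ≃+ M) (r : J' → J) (hp : ∀ j m, p (r j) (B m) = p' j m)

theorem mem_dualSG_image {p' : J' → M' →+ ℤ} (B : M' ≃+ M) (r : J' → J)
    (hp : ∀ j m, p (r j) (B m) = p' j m) (s : Finset J') (m : M') :
    B m ∈ dualSG p (s.image r) ↔ m ∈ dualSG p' s := by
  simp only [mem_dualSG, Finset.forall_mem_image, hp]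

/-- Change of the lattice and the index set, on coordinate rings. -/
noncomputable def reindexEquiv (s : Finset J') : CoordRing p (s.image r) ≃+* CoordRing p' s :=
  (coordRingEquiv B (mem_dualSG_image B r hp s)).symm

theorem resMap_reindexEquiv {s t : Finset J'} (h : t ⊆ s) (a : CoordRing p (s.image r)) :
    resMap p' h (reindexEquiv B r hp s a) =
      reindexEquiv B r hp t (resMap p (Finset.image_subset_image h) a) := by
  obtain ⟨b, rfl⟩ := (coordRingEquiv B (mem_dualSG_image B r hp s)).surjective a
  rw [reindexEquiv, RingEquiv.symm_apply_apply, reindexEquiv, RingEquiv.eq_symm_apply]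
  induction b using AddMonoidAlgebra.induction_linear with
  | zero => simp
  | add a b ha hb => simp only [map_add, ha, hb]
  | single m c => simp only [resMap_single, coordRingEquiv_single]

theorem reindexEquiv_algebraMap (s : Finset J') (c : ℂ) :
    reindexEquiv B r hp s (algebraMap ℂ _ c) = algebraMap ℂ _ c := by
  rw [reindexEquiv, RingEquiv.symm_apply_eq]
  refine Eq.symm ((coordRingEquiv_single B (mem_dualSG_image B r hp s) 0 c).trans ?_)
  refine congrArg (fun m => AddMonoidAlgebra.single m c) (Subtype.ext ?_)
  exact map_zero B

/-- The chart after a change of the lattice and the index set. -/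
noncomputable def reindexChart (s : Finset J') (hs : s.image r ∈ C) :
    Spec (CommRingCat.of (CoordRing p' s)) ⟶ X :=
  Spec.map (CommRingCat.ofHom (reindexEquiv B r hp s).toRingHom) ≫ A.chart _ hs

theorem isIso_reindexEquiv (s : Finset J') :
    IsIso (Spec.map (CommRingCat.ofHom (reindexEquiv B r hp s).toRingHom)) :=
  inferInstanceAs (IsIso (Spec.map (reindexEquiv B r hp s).toCommRingCatIso.hom))

theorem range_reindexChart (s : Finset J') (hs : s.image r ∈ C) :
    Set.range (A.reindexChart B r hp s hs) = Set.range (A.chart _ hs) := by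
  have := isIso_reindexEquiv B r hp s
  rw [reindexChart, Scheme.Hom.comp_base, TopCat.coe_comp, Set.range_comp,
    Set.range_eq_univ.2 (Spec.map (CommRingCat.ofHom (reindexEquiv B r hp s).toRingHom)).surjective,
    Set.image_univ]

variable [DecidableEq J']

/-- Change of the lattice and the index set. -/
noncomputable def reindex (hr : Function.Injective r) (C' : Set (Finset J'))
    (hC : ∀ s, s ∈ C' ↔ s.image r ∈ C) (hC' : ∀ s ∈ C, ∃ s' : Finset J', s = s'.image r) : TAtlas p' C' X where
  chart s hs := A.reindexChart B r hp s ((hC s).1 hs)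
  isOpenImmersion s hs := by
    have := isIso_reindexEquiv B r hp s
    exact inferInstanceAs (IsOpenImmersion (_ ≫ _))
  smooth s hs := by
    obtain ⟨ι, hι, b, i, hi, hb⟩ := A.smooth _ ((hC s).1 hs)
    refine ⟨ι, hι, B.trans b, fun j => i ⟨r j, Finset.mem_image_of_mem r j.2⟩, fun j k h => ?_,
      fun j m => ?_⟩
    · exact Subtype.ext (hr (Subtype.mk.inj (hi h)))
    · rw [← hp]
      exact hb ⟨r j, Finset.mem_image_of_mem r j.2⟩ (B m)
  face_mem s hs t h := (hC t).2 (A.face_mem _ ((hC s).1 hs) _ (Finset.image_subset_image h))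
  chart_face s hs t h := by
    rw [reindexChart, reindexChart, ← A.chart_face _ ((hC s).1 hs) _ (Finset.image_subset_image h),
      ← Category.assoc, ← Category.assoc, ← Spec.map_comp, ← Spec.map_comp]
    congr 2
    exact congrArg CommRingCat.ofHom (RingHom.ext fun a => resMap_reindexEquiv B r hp h a)
  chart_inter s hs t ht := by
    rintro x ⟨hs, ht⟩
    rw [range_reindexChart, mem_range_chart_iff] at hs ht ⊢
    rw [Finset.image_inter _ _ hr]
    exact Finset.subset_inter hs ht
  covers x := by
    obtain ⟨s, hs, hx⟩ := A.covers x
    obtain ⟨s', rfl⟩ := hC' s hs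
    exact ⟨s', (hC s').2 hs, by rwa [range_reindexChart]⟩

theorem image_coneAt_reindex (hr : Function.Injective r) (C' : Set (Finset J'))
    (hC : ∀ s, s ∈ C' ↔ s.image r ∈ C) (hC' : ∀ s ∈ C, ∃ s' : Finset J', s = s'.image r) (x : X) :
    ((A.reindex B r hp hr C' hC hC').coneAt x).image r = A.coneAt x := by
  have h : ∀ s (hs : s ∈ C'), (A.reindex B r hp hr C' hC hC').coneAt x ⊆ s ↔
      A.coneAt x ⊆ s.image r := by
    intro s hs
    rw [← (A.reindex B r hp hr C' hC hC').mem_range_chart_iff hs,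
      ← A.mem_range_chart_iff ((hC s).1 hs), ← A.range_reindexChart B r hp]
    rfl
  refine Finset.Subset.antisymm ?_ ((h _ (coneAt_mem _ x)).1 le_rfl)
  obtain ⟨s', hs'⟩ := hC' _ (A.coneAt_mem x)
  rw [hs']
  refine Finset.image_subset_image ((h s' ?_).2 hs'.le)
  rw [hC, ← hs']
  exact A.coneAt_mem x

theorem mem_coneAt_reindex (hr : Function.Injective r) (C' : Set (Finset J'))
    (hC : ∀ s, s ∈ C' ↔ s.image r ∈ C) (hC' : ∀ s ∈ C, ∃ s' : Finset J', s = s'.image r) {x : X} {j : J'} :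
    j ∈ (A.reindex B r hp hr C' hC hC').coneAt x ↔ r j ∈ A.coneAt x := by
  rw [← A.image_coneAt_reindex B r hp hr C' hC hC', hr.mem_finset_image]

theorem reindex_chart_comp (hr : Function.Injective r) (C' : Set (Finset J'))
    (hC : ∀ s, s ∈ C' ↔ s.image r ∈ C) (hC' : ∀ s ∈ C, ∃ s' : Finset J', s = s'.image r)
    {str : X ⟶ Spec (CommRingCat.of ℂ)} (hstr : ∀ s hs, A.chart s hs ≫ str =
      Spec.map (CommRingCat.ofHom (algebraMap ℂ (CoordRing p s)))) (s : Finset J') (hs : s ∈ C') :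
    (A.reindex B r hp hr C' hC hC').chart s hs ≫ str =
      Spec.map (CommRingCat.ofHom (algebraMap ℂ (CoordRing p' s))) := by
  refine (Category.assoc _ _ _).trans ?_
  rw [hstr, ← Spec.map_comp]
  exact congrArg (fun φ => Spec.map (CommRingCat.ofHom φ))
    (RingHom.ext fun c => reindexEquiv_algebraMap B r hp s c)

end Reindex

/-! ### Divisors in a scheme with a toric atlas -/

/-- An integral divisor outside the torus is the divisor of a ray. -/
theorem exists_range_eq [IsIntegral X] {D : Scheme.{0}} [IsIntegral D] (i : D ⟶ X)
    [IsClosedImmersion i] (hi : Order.coheight (i (genericPoint D)) = 1)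
    (h : A.coneAt (i (genericPoint D)) ≠ ∅) : ∃ j, Set.range i = {x | j ∈ A.coneAt x} := by
  obtain ⟨j, hj⟩ := Finset.nonempty_iff_ne_empty.2 h
  refine ⟨j, Set.Subset.antisymm ?_ fun x hx => ?_⟩
  · rintro _ ⟨d, rfl⟩
    exact A.coneAt_subset_of_specializes ((genericPoint_specializes d).map i.continuous) hj
  · have hne : ∀ y, A.coneAt y = {j} → y ≠ genericPoint X := by
      rintro y hy rfl
      rw [A.coneAt_genericPoint] at hy
      exact Finset.singleton_ne_empty j hy.symm
    obtain ⟨y, hyx, hy⟩ := A.exists_specializes_coneAt_eq hx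
    obtain ⟨z, hzd, hz⟩ := A.exists_specializes_coneAt_eq hj
    -- The generic point of `D` has cone exactly `{j}`: it has a generisation with this cone, which
    -- codimension one forces to be the point itself.
    obtain rfl := eq_of_specializes_of_coheight_eq_one hi hzd (hne z hz)
    have hjC : {j} ∈ C := hz ▸ A.coneAt_mem _
    obtain ⟨e, he⟩ := (A.smooth _ hjC).exists_dual j
    obtain ⟨Q, hQ, hQj⟩ := A.exists_prime_ray hjC (Finset.mem_singleton_self j) he (dual_mem he)
    -- All points with cone `{j}` are specialisations of the single point defined by the coordinate
    -- of `j`, which is therefore the generic point of `D`.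
    have key : ∀ w, A.coneAt w = {j} → A.chart _ hjC Q ⤳ w := by
      intro w hw
      obtain ⟨P, hP⟩ := (A.mem_range_chart_iff hjC).2 hw.le
      exact A.chart_specializes hjC hP hQ ((A.mem_coneAt_iff_of_chart_eq hjC hP
        (Finset.mem_singleton_self j) he _).1 (hw ▸ Finset.mem_singleton_self j))
    have hQd := eq_of_specializes_of_coheight_eq_one hi (key _ hz) (hne _ hQj)
    have hsp := (hQd ▸ key y hy).trans hyx
    exact hsp.mem_closed i.isClosedEmbedding.isClosed_range ⟨_, rfl⟩

section Component

variable {v : J}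

/-- The cones of the star of the ray `v`. -/
def star (C : Set (Finset J)) (v : J) : Set (Finset J) := {t | v ∉ t ∧ insert v t ∈ C}

theorem isDomain_kerPairing (A : TAtlas p C X) {t : Finset J} (ht : t ∈ star C v) :
    IsDomain (CoordRing (kerPairing p v) t) := 
  ((A.smooth _ ht.2).kerPairing ht.1).isDomain t

/-- The range is the zero locus of the kernel of `faceMap`, which is generated by the coordinate of
`v`. -/
theorem range_faceMap {t : Finset J} (ht : t ∈ star C v) :
    Set.range (Spec.map (CommRingCat.ofHom (faceMap p v (rfl : insert v t = insert v t)))) =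
      {P | v ∈ A.coneAt (A.chart _ ht.2 P)} := by
  obtain ⟨e, he⟩ := (A.smooth _ ht.2).exists_dual v
  ext P
  rw [Set.mem_ofPred_eq, A.mem_coneAt_chart_iff ht.2 (Finset.mem_insert_self v t) he (dual_mem he) P]
  have h1 : Set.range (Spec.map (CommRingCat.ofHom
      (faceMap p v (rfl : insert v t = insert v t)))) = PrimeSpectrum.zeroLocus
        (RingHom.ker (faceMap p v (rfl : insert v t = insert v t))) :=
    range_comap_of_surjective _ _ (faceMap_surjective rfl)
  rw [h1]
  have h2 := fun a => mem_ker_faceMap_iff (rfl : insert v t = insert v t) ht.1 he (dual_mem he) (a := a)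
  constructor
  · intro h
    exact h ((h2 _).2 dvd_rfl)
  · intro h a ha
    exact Ideal.mem_of_dvd _ ((h2 a).1 ha) h

variable {D : Scheme.{0}} (i : D ⟶ X)

theorem range_faceMap_comp (hi : Set.range i = {x | v ∈ A.coneAt x}) {t : Finset J}
    (ht : t ∈ star C v) :
    Set.range (Spec.map (CommRingCat.ofHom (faceMap p v (rfl : insert v t = insert v t))) ≫
      A.chart _ ht.2) = Set.range i ∩ Set.range (A.chart _ ht.2) := by
  rw [Scheme.Hom.comp_base, TopCat.coe_comp, Set.range_comp, A.range_faceMap ht, hi]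
  ext x
  constructor
  · rintro ⟨P, hP, rfl⟩
    exact ⟨hP, P, rfl⟩
  · rintro ⟨hx, P, rfl⟩
    exact ⟨P, hx, rfl⟩

theorem mem_coneAt_of_range_eq (hi : Set.range i = {x | v ∈ A.coneAt x}) (d : D) :
    v ∈ A.coneAt (i d) :=
  hi.le ⟨d, rfl⟩

variable [IsClosedImmersion i] (hi : Set.range i = {x | v ∈ A.coneAt x})

/-- The chart of the divisor of the ray `v`. -/
noncomputable def divisorChart (t : Finset J) (ht : t ∈ star C v) :
    Spec (CommRingCat.of (CoordRing (kerPairing p v) t)) ⟶ D :=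
  haveI := A.isDomain_kerPairing ht
  closedLift (Spec.map (CommRingCat.ofHom (faceMap p v (rfl : insert v t = insert v t))) ≫
    A.chart _ ht.2) i ((A.range_faceMap_comp i hi ht).le.trans Set.inter_subset_left)

theorem divisorChart_comp (t : Finset J) (ht : t ∈ star C v) :
    A.divisorChart i hi t ht ≫ i =
      Spec.map (CommRingCat.ofHom (faceMap p v (rfl : insert v t = insert v t))) ≫
        A.chart _ ht.2 :=
  haveI := A.isDomain_kerPairing ht
  closedLift_comp _ _ _

theorem mem_range_divisorChart_iff {t : Finset J} (ht : t ∈ star C v) {d : D} :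
    d ∈ Set.range (A.divisorChart i hi t ht) ↔ A.coneAt (i d) ⊆ insert v t := by
  rw [← A.mem_range_chart_iff ht.2]
  have h : i d ∈ Set.range (A.divisorChart i hi t ht ≫ i) ↔
      i d ∈ Set.range (A.chart (insert v t) ht.2) := by
    rw [divisorChart_comp, A.range_faceMap_comp i hi ht]
    exact and_iff_right ⟨d, rfl⟩
  rw [← h]
  constructor
  · rintro ⟨P, rfl⟩
    exact ⟨P, rfl⟩
  · rintro ⟨P, hP⟩
    exact ⟨P, i.isClosedEmbedding.injective hP⟩

theorem face_mem_star (A : TAtlas p C X) (s : Finset J) (hs : s ∈ star C v) (t : Finset J)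
    (h : t ⊆ s) : t ∈ star C v :=
  ⟨fun hv => hs.1 (h hv), A.face_mem _ hs.2 _ (Finset.insert_subset_insert v h)⟩

variable [IsIntegral D]

/-- The divisor of the ray `v` has an atlas by the affine toric varieties of the star of `v`. -/
noncomputable def divisor : TAtlas (kerPairing p v) (star C v) D where
  chart := A.divisorChart i hi
  isOpenImmersion t ht := by
    have := A.isDomain_kerPairing ht
    have : IsClosedImmersion
        (Spec.map (CommRingCat.ofHom (faceMap p v (rfl : insert v t = insert v t)))) :=
      IsClosedImmersion.spec_of_surjective _ (faceMap_surjective rfl)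
    refine isOpenImmersion_closedLift _ _ _ _ fun x hx => ?_
    rw [hi] at hx
    rw [A.range_faceMap ht]
    exact hx
  smooth t ht := (A.smooth _ ht.2).kerPairing ht.1
  face_mem := A.face_mem_star
  chart_face s hs t h := by
    rw [← cancel_mono i, Category.assoc, divisorChart_comp, divisorChart_comp,
      ← A.chart_face _ hs.2 _ (Finset.insert_subset_insert v h), ← Category.assoc, ← Category.assoc,
      ← Spec.map_comp, ← Spec.map_comp]
    refine congrArg (fun φ => Spec.map (CommRingCat.ofHom φ) ≫ _) (RingHom.ext fun a => ?_)
    induction a using AddMonoidAlgebra.induction_linear with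
    | zero => simp
    | add a b ha hb => simp only [map_add, ha, hb]
    | single m c =>
      change resMap _ h (faceMap p v rfl (AddMonoidAlgebra.single m c)) =
        faceMap p v rfl
          (resMap p (Finset.insert_subset_insert v h) (AddMonoidAlgebra.single m c))
      rw [resMap_single]
      by_cases hm : p v m = 0
      · rw [faceMap_single _ _ _ hm, resMap_single]
        exact (faceMap_single rfl ⟨m.1, dualSG_anti p (Finset.insert_subset_insert v h) m.2⟩ c hm).symm
      · rw [faceMap_single_of_ne _ _ _ hm, map_zero]
        exact (faceMap_single_of_ne rfl ⟨m.1, dualSG_anti p (Finset.insert_subset_insert v h) m.2⟩ c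
          hm).symm
  chart_inter s hs t ht := by
    rintro d ⟨hds, hdt⟩
    rw [mem_range_divisorChart_iff] at hds hdt ⊢
    rw [Finset.insert_inter_distrib]
    exact Finset.subset_inter hds hdt
  covers d := by
    have hv := A.mem_coneAt_of_range_eq i hi d
    have hs : (A.coneAt (i d)).erase v ∈ star C v :=
      ⟨Finset.notMem_erase v _, (Finset.insert_erase hv).symm ▸ A.coneAt_mem _⟩
    refine ⟨_, hs, ?_⟩
    rw [mem_range_divisorChart_iff, Finset.insert_erase hv]

theorem coneAt_divisor (d : D) : (A.divisor i hi).coneAt d = (A.coneAt (i d)).erase v := by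
  have hv := A.mem_coneAt_of_range_eq i hi d
  have h : ∀ t (_ : t ∈ star C v), (A.divisor i hi).coneAt d ⊆ t ↔ A.coneAt (i d) ⊆ insert v t := by
    intro t ht
    rw [← (A.divisor i hi).mem_range_chart_iff ht]
    exact A.mem_range_divisorChart_iff i hi ht
  refine Finset.Subset.antisymm ((h _ ⟨Finset.notMem_erase v _, ?_⟩).2 ?_) ?_
  · rw [Finset.insert_erase hv]
    exact A.coneAt_mem _
  · rw [Finset.insert_erase hv]
  · rw [← Finset.subset_insert_iff]
    exact (h _ ((A.divisor i hi).coneAt_mem d)).1 le_rfl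

end Component

end TAtlas

/-! ### Toric pairs -/

/-- The pairing of `m` with a vector `v`. -/
def dotHom (v : Fin 3 → ℤ) : (Fin 3 → ℤ) →+ ℤ where
  toFun m := m ⬝ᵥ v
  map_zero' := zero_dotProduct v
  map_add' m n := add_dotProduct m n v

/-- The smooth toric atlas of the toric variety of a fan. -/
noncomputable def ToricAtlas.toTAtlas {F : SmoothCompleteFan} {Y : Scheme.{0}}
    {str : Y ⟶ Spec (CommRingCat.of ℂ)} (A : ToricAtlas F str) : TAtlas dotHom (F.cones : Set _) Y where
  chart := A.chart
  isOpenImmersion := A.isOpenImmersion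
  smooth σ hσ := by
    obtain ⟨b, hb⟩ := F.smooth σ hσ
    choose k hk using fun v : σ => hb v v.2
    -- Evaluation on the basis `b` that contains the generators: it turns pairing with a generator
    -- into a coordinate.
    let e := (dotProductEquiv ℤ (Fin 3)).trans (b.constr ℤ (M' := ℤ)).symm
    refine ⟨Fin 3, inferInstance, e.toAddEquiv, k, fun v w h => ?_, fun v m => ?_⟩
    · exact Subtype.ext (by rw [← hk v, ← hk w, h])
    · change m ⬝ᵥ v.1 = m ⬝ᵥ b (k v)
      rw [hk v]
  face_mem := F.face_mem
  chart_face := A.chart_face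
  chart_inter σ hσ τ hτ := (A.chart_inter σ hσ τ hτ).le
  covers := A.covers

/-- By completeness the vector `m` itself lies in some cone. It is orthogonal to the generators of
that cone, hence to itself. -/
theorem SmoothCompleteFan.eq_zero_of_dotHom_eq_zero (F : SmoothCompleteFan) {m : Fin 3 → ℤ}
    (h : ∀ σ ∈ F.cones, ∀ v ∈ σ, dotHom v m = 0) : m = 0 := by
  obtain ⟨σ, hσ, a, -, ha⟩ := F.complete fun i => (m i : ℝ)
  have h1 : (fun i => (m i : ℝ)) ⬝ᵥ (fun i => (m i : ℝ)) = 0 := by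
    conv_lhs => arg 2; rw [ha]
    rw [dotProduct_sum]
    refine Finset.sum_eq_zero fun v hv => ?_
    rw [dotProduct_smul]
    have h2 : m ⬝ᵥ v = 0 := h σ hσ v hv
    have h3 : (fun i => (m i : ℝ)) ⬝ᵥ (fun i => (v i : ℝ)) = ((m ⬝ᵥ v : ℤ) : ℝ) := by
      simp [dotProduct]
    rw [h3, h2, Int.cast_zero, smul_zero]
  funext i
  exact Int.cast_eq_zero.1 (congrFun (dotProduct_self_eq_zero.1 h1) i)

/-- The boundary pair of a toric threefold has an atlas in which the rays are the components of the
boundary. -/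
theorem BoundaryPair.IsToricThreefold.exists_tAtlas {I : Type*} [DecidableEq I] {P : BoundaryPair I}
    (hP : P.IsToricThreefold) : ∃ (p : I → (Fin 3 → ℤ) →+ ℤ) (C : Set (Finset I))
      (A : TAtlas p C P.Y), Finite I ∧ (∀ v, Set.range (P.incl v) = {x | v ∈ A.coneAt x}) ∧
      (∀ s hs, A.chart s hs ≫ P.str =
        Spec.map (CommRingCat.ofHom (algebraMap ℂ (CoordRing p s)))) ∧
      ∀ m, (∀ v, p v m = 0) → m = 0 := by
  obtain ⟨F, A₀, hA₀⟩ := hP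
  set A := A₀.toTAtlas with hA
  have htorus : ∀ x, x ∈ ⋃ v, Set.range (P.incl v) ↔ A.coneAt x ≠ ∅ := by
    intro x
    rw [hA₀, Set.mem_compl_iff, not_iff_not]
    exact (A.mem_range_chart_iff F.empty_mem).trans Finset.subset_empty
  -- Components of the boundary lie outside the torus, so each is the divisor of a ray. This ray `r
  -- v` is used to index the atlas by components.
  have hray : ∀ v, ∃ j, Set.range (P.incl v) = {x | j ∈ A.coneAt x} := fun v =>
    A.exists_range_eq (P.incl v) (P.codim_one v)
      ((htorus _).1 (Set.mem_iUnion.2 ⟨v, genericPoint (P.comp v), rfl⟩))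
  choose r hr using hray
  have hrinj : Function.Injective r := fun v w h => P.range_injective (by
    change Set.range (P.incl v) = Set.range (P.incl w)
    rw [hr, hr, h])
  -- Every ray occurs: a point with cone `{j}` lies outside the torus, hence on some component,
  -- whose ray must be `j`.
  have hrange : ∀ σ ∈ F.cones, ∀ j ∈ σ, ∃ v, r v = j := by
    intro σ hσ j hj
    obtain ⟨x, hx⟩ := A.exists_coneAt_eq (F.face_mem σ hσ {j} (Finset.singleton_subset_iff.2 hj))
    obtain ⟨v, hv⟩ := Set.mem_iUnion.1 ((htorus x).2 (by rw [hx]; exact Finset.singleton_ne_empty j))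
    rw [hr, Set.mem_ofPred_eq, hx, Finset.mem_singleton] at hv
    exact ⟨v, hv⟩
  have hcones : ∀ v, r v ∈ F.cones.biUnion id := by
    intro v
    have h : genericPoint (P.comp v) ∈ P.incl v ⁻¹' Set.range (P.incl v) := ⟨_, rfl⟩
    rw [hr] at h
    exact Finset.mem_biUnion.2 ⟨_, A.coneAt_mem _, h⟩
  have hC' : ∀ σ ∈ (F.cones : Set (Finset (Fin 3 → ℤ))), ∃ s : Finset I, σ = s.image r := by
    classical
    intro σ hσ
    refine ⟨σ.preimage r hrinj.injOn, ?_⟩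
    rw [Finset.image_preimage, Finset.filter_true_of_mem]
    exact fun j hj => hrange σ hσ j hj
  refine ⟨fun v => dotHom (r v), {s | s.image r ∈ F.cones},
    A.reindex (AddEquiv.refl _) r (fun _ _ => rfl) hrinj _ (fun _ => Iff.rfl) hC', ?_, fun v => ?_,
    ?_, fun m hm => ?_⟩
  · exact Finite.of_injective (fun v => (⟨r v, hcones v⟩ : (F.cones.biUnion id : Finset _)))
      fun v w h => hrinj (Subtype.mk.inj h)
  · rw [hr]
    ext x
    exact (A.mem_coneAt_reindex _ _ _ _ _ _ _).symm
  · exact A.reindex_chart_comp _ _ _ _ _ _ _ A₀.chart_str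
  · refine F.eq_zero_of_dotHom_eq_zero fun σ hσ v hv => ?_
    obtain ⟨w, rfl⟩ := hrange σ hσ v hv
    exact hm w

theorem monoidHom_ext_single {I : Type*} [DecidableEq I] [Finite I] {G : Type*} [CommGroup G]
    {f g : Multiplicative (I → ℤ) →* G}
    (h : ∀ v, f (.ofAdd (Pi.single v 1)) = g (.ofAdd (Pi.single v 1))) : f = g := by
  refine MonoidHom.toAdditiveRight.injective ?_
  refine AddMonoidHom.functions_ext _ _ _ fun v n => ?_
  have e : (Pi.single v n : I → ℤ) = n • Pi.single v 1 := by
    rw [← Pi.single_smul, smul_eq_mul, mul_one]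
  rw [e, map_zsmul, map_zsmul]
  exact congrArg (n • ·) (congrArg Additive.ofMul (h v))

/-- Families of homomorphisms to `ℤ` with the same image in `ℤ^I` differ by an isomorphism. -/
theorem exists_addEquiv {I M M' : Type*} [AddCommGroup M] [AddCommGroup M'] {p : I → M →+ ℤ}
    {p' : I → M' →+ ℤ} (hp : ∀ m, (∀ v, p v m = 0) → m = 0) (hp' : ∀ m, (∀ v, p' v m = 0) → m = 0)
    (h : ∀ a : I → ℤ, (∃ m, ∀ v, p v m = a v) ↔ ∃ m, ∀ v, p' v m = a v) :
    ∃ B : M ≃+ M', ∀ v m, p' v (B m) = p v m := by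
  choose f hf using fun m => (h fun v => p v m).1 ⟨m, fun _ => rfl⟩
  choose g hg using fun m => (h fun v => p' v m).2 ⟨m, fun _ => rfl⟩
  refine ⟨{ toFun := f, invFun := g, left_inv := fun m => ?_, right_inv := fun m => ?_,
            map_add' := fun m n => ?_ }, fun v m => hf m v⟩
  · exact sub_eq_zero.1 (hp _ fun v => by rw [map_sub, hg, hf, sub_self])
  · exact sub_eq_zero.1 (hp' _ fun v => by rw [map_sub, hf, hg, sub_self])
  · exact sub_eq_zero.1 (hp' _ fun v => by rw [map_sub, map_add, hf, hf, hf, map_add, sub_self])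

/-! ### Comparison of two toric pairs. -/

namespace BoundaryPair

variable {I : Type*} [DecidableEq I] {P P' : BoundaryPair I} {M M' : Type} [AddCommGroup M]
  [AddCommGroup M'] {p : I → M →+ ℤ} {p' : I → M' →+ ℤ} {C C' : Set (Finset I)}
  (A : TAtlas p C P.Y) (A' : TAtlas p' C' P'.Y)

/-- A point lies on all `D_v` with `v ∈ s` exactly when its cone contains `s`. Since every cone is
the cone of a point and faces of cones are cones, the fan is determined by the dual complex as a
combinatorial object. -/
theorem mem_cones_iff (hr : ∀ v, Set.range (P.incl v) = {x | v ∈ A.coneAt x}) (s : Finset I) :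
    s ∈ C ↔ s = ∅ ∨ s ∈ P.dualComplex := by
  have h : ∀ x, x ∈ P.stratum s ↔ s ⊆ A.coneAt x := by
    intro x
    simp only [stratum, Set.mem_iInter, hr]
    rfl
  constructor
  · intro hs
    rcases s.eq_empty_or_nonempty with rfl | hne
    · exact Or.inl rfl
    · obtain ⟨x, hx⟩ := A.exists_coneAt_eq hs
      exact Or.inr ⟨hne, x, (h x).2 hx.ge⟩
  · rintro (rfl | ⟨-, x, hx⟩)
    · exact A.empty_mem
    · exact A.face_mem _ (A.coneAt_mem x) s ((h x).1 hx)

theorem singleton_mem_cones (hr : ∀ v, Set.range (P.incl v) = {x | v ∈ A.coneAt x}) (v : I) :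
    {v} ∈ C :=
  A.face_mem _ (A.coneAt_mem _) _
    (Finset.singleton_subset_iff.2 (A.mem_coneAt_of_range_eq _ (hr v) (genericPoint (P.comp v))))

/-- An isomorphism of Picard groups that respects the classes of the components respects the classes
of all boundary divisors. -/
theorem map_toricCls [Finite I] (hr : ∀ v, Set.range (P.incl v) = {x | v ∈ A.coneAt x})
    (hr' : ∀ v, Set.range (P'.incl v) = {x | v ∈ A'.coneAt x}) (μ : Pic P.Y ≃* Pic P'.Y)
    (hcomp : ∀ v L L', IsClassOfDivisor (Set.range (P.incl v)) L →
      IsClassOfDivisor (Set.range (P'.incl v)) L' → μ L = L') (a : Multiplicative (I → ℤ)) :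
    μ (A.toricCls a) = A'.toricCls a := by
  have : μ.toMonoidHom.comp A.toricCls = A'.toricCls := monoidHom_ext_single fun v =>
    hcomp v _ _ (hr v ▸ A.isClassOfDivisor_toricCls v) (hr' v ▸ A'.isClassOfDivisor_toricCls v)
  exact congr($this a)

/-- The lattices of two toric pairs are isomorphic if there is an isomorphism of the Picard groups
that respects the classes of the components. -/
theorem exists_addEquiv_lattice [Finite I]
    (hr : ∀ v, Set.range (P.incl v) = {x | v ∈ A.coneAt x})
    (hr' : ∀ v, Set.range (P'.incl v) = {x | v ∈ A'.coneAt x}) (μ : Pic P.Y ≃* Pic P'.Y)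
    (hcomp : ∀ v L L', IsClassOfDivisor (Set.range (P.incl v)) L →
      IsClassOfDivisor (Set.range (P'.incl v)) L' → μ L = L')
    (hp : ∀ m, (∀ v, p v m = 0) → m = 0) (hp' : ∀ m, (∀ v, p' v m = 0) → m = 0) :
    ∃ B : M ≃+ M', ∀ v m, p' v (B m) = p v m := by
  refine exists_addEquiv hp hp' fun a => ?_
  -- The image of the lattice in `ℤ^I` is the group of relations among the classes of the
  -- components. Every index is a ray, so the condition on all cones is a condition on all indices.
  have h1 : (∃ m, ∀ v, p v m = a v) ↔ A.toricCls (.ofAdd a) = 1 := by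
    rw [A.toricCls_eq_one_iff]
    exact exists_congr fun m => ⟨fun h s _ j _ => h j, fun h v =>
      h _ (singleton_mem_cones A hr v) v (Finset.mem_singleton_self v)⟩
  have h2 : (∃ m, ∀ v, p' v m = a v) ↔ A'.toricCls (.ofAdd a) = 1 := by
    rw [A'.toricCls_eq_one_iff]
    exact exists_congr fun m => ⟨fun h s _ j _ => h j, fun h v =>
      h _ (singleton_mem_cones A' hr' v) v (Finset.mem_singleton_self v)⟩
  rw [h1, h2, ← map_toricCls A A' hr hr' μ hcomp, MulEquiv.map_eq_one_iff]

theorem isClassOfDivisor_doubleCurve (hr : ∀ v, Set.range (P.incl v) = {x | v ∈ A.coneAt x})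
    {v w : I} (hvw : v ≠ w) : IsClassOfDivisor (P.doubleCurve v w)
      ((A.divisor (P.incl v) (hr v)).toricCls (.ofAdd (Pi.single w 1))) := by
  have e : P.doubleCurve v w = {d | w ∈ (A.divisor (P.incl v) (hr v)).coneAt d} := by
    ext d
    rw [doubleCurve, hr w, Set.mem_ofPred_eq, A.coneAt_divisor, Finset.mem_erase]
    exact (and_iff_right hvw.symm).symm
  rw [e]
  exact (A.divisor (P.incl v) (hr v)).isClassOfDivisor_toricCls w

/-- It suffices to compare the generators `w`. If `w` lies in a cone of the star of `v`, they are
classes of double curves, to which the hypothesis applies. Otherwise they are trivial on both sides,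
since the two atlases have the same cones. -/
theorem map_toricCls_divisor [Finite I] {p' : I → M →+ ℤ} (A' : TAtlas p' C P'.Y)
    (hr : ∀ v, Set.range (P.incl v) = {x | v ∈ A.coneAt x})
    (hr' : ∀ v, Set.range (P'.incl v) = {x | v ∈ A'.coneAt x}) (v : I)
    (μ : Pic (P.comp v) ≃* Pic (P'.comp v))
    (hcurve : ∀ w, v ≠ w → (Set.range (P.incl v) ∩ Set.range (P.incl w)).Nonempty →
      ∀ L L', IsClassOfDivisor (P.doubleCurve v w) L →
        IsClassOfDivisor (P'.doubleCurve v w) L' → μ L = L') (a : Multiplicative (I → ℤ)) :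
    μ ((A.divisor (P.incl v) (hr v)).toricCls a) =
      (A'.divisor (P'.incl v) (hr' v)).toricCls a := by
  have : μ.toMonoidHom.comp (A.divisor (P.incl v) (hr v)).toricCls =
      (A'.divisor (P'.incl v) (hr' v)).toricCls := by
    refine monoidHom_ext_single fun w => ?_
    change μ _ = _
    by_cases hw : ∃ s ∈ TAtlas.star C v, w ∈ s
    · obtain ⟨s, hs, hws⟩ := hw
      have hvw : v ≠ w := fun h => hs.1 (h ▸ hws)
      obtain ⟨x, hx⟩ := A.exists_coneAt_eq hs.2
      refine hcurve w hvw ⟨x, ?_, ?_⟩ _ _ (isClassOfDivisor_doubleCurve A hr hvw)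
        (isClassOfDivisor_doubleCurve A' hr' hvw)
      · rw [hr, Set.mem_ofPred_eq, hx]
        exact Finset.mem_insert_self v s
      · rw [hr, Set.mem_ofPred_eq, hx]
        exact Finset.mem_insert_of_mem hws
    · have h : ∀ s ∈ TAtlas.star C v, ∀ j ∈ s, (Pi.single w 1 : I → ℤ) j = 0 := by
        intro s hs j hj
        rw [Pi.single_eq_of_ne]
        rintro rfl
        exact hw ⟨s, hs, hj⟩
      rw [(A.divisor (P.incl v) (hr v)).toricCls_eq_one_iff.2
          ⟨0, fun s hs j hj => by rw [h s hs j hj, map_zero]⟩,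
        (A'.divisor (P'.incl v) (hr' v)).toricCls_eq_one_iff.2
          ⟨0, fun s hs j hj => by rw [h s hs j hj, map_zero]⟩, map_one]
  exact congr($this a)

/-- Two pairs with atlases for the same fan are isomorphic. -/
theorem exists_pairIso (A' : TAtlas p C P'.Y)
    (hr : ∀ v, Set.range (P.incl v) = {x | v ∈ A.coneAt x})
    (hr' : ∀ v, Set.range (P'.incl v) = {x | v ∈ A'.coneAt x})
    (hstr : ∀ s hs, A.chart s hs ≫ P.str = A'.chart s hs ≫ P'.str) :
    ∃ f : PairIso P P', (∀ s hs, A.chart s hs ≫ f.f.hom = A'.chart s hs) ∧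
      ∀ v s hs, (A.divisor (P.incl v) (hr v)).chart s hs ≫ (f.comp v).hom =
        (A'.divisor (P'.incl v) (hr' v)).chart s hs := by
  obtain ⟨f, hf⟩ := A.exists_iso A'
  have hrange : ∀ v, Set.range (P.incl v ≫ f.hom) = Set.range (P'.incl v) := by
    intro v
    rw [Scheme.Hom.comp_base, TopCat.coe_comp, Set.range_comp, hr, hr']
    ext x
    constructor
    · rintro ⟨y, hy, rfl⟩
      rw [Set.mem_ofPred_eq, A.coneAt_apply A' f.hom hf y]
      exact hy
    · intro hx
      obtain ⟨y, rfl⟩ := f.hom.surjective x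
      rw [Set.mem_ofPred_eq, A.coneAt_apply A' f.hom hf y] at hx
      exact ⟨y, hx, rfl⟩
  -- As `f` preserves the cones of points, it maps `D_v` onto `D'_v`. A reduced closed subscheme is
  -- determined by its support, so `f` restricts to an isomorphism of the components.
  have hc : ∀ v : I, (closedIso _ _ (hrange v)).hom ≫ P'.incl v = P.incl v ≫ f.hom :=
    fun v => closedLift_comp _ _ (hrange v).le
  refine ⟨⟨f, A.hom_ext fun s hs => ?_, fun v => closedIso _ _ (hrange v), hc⟩, hf, fun v s hs => ?_⟩
  · rw [reassoc_of% hf s hs, hstr]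
  · rw [← cancel_mono (P'.incl v), Category.assoc]
    refine (congrArg (_ ≫ ·) (hc v)).trans ?_
    refine Eq.trans ?_ (A'.divisorChart_comp (P'.incl v) (hr' v) s hs).symm
    rw [← hf, ← Category.assoc, ← Category.assoc]
    exact congrArg (· ≫ f.hom) (A.divisorChart_comp (P.incl v) (hr v) s hs)

end BoundaryPair

end LogCY

theorem mainTheorem8 {I : Type*} (P P' : LogCY.BoundaryPair I)
    (hP : P.IsToricThreefold) (hP' : P'.IsToricThreefold)
    (hdual : P.dualComplex = P'.dualComplex)
    (μ : LogCY.Pic P.Y ≃* LogCY.Pic P'.Y)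
    (μv : ∀ v, LogCY.Pic (P.comp v) ≃* LogCY.Pic (P'.comp v))
    -- the isomorphisms are compatible with restriction to the components
    (hcompat : ∀ v L, LogCY.Pic.pullback (P'.incl v) (μ L) = μv v (LogCY.Pic.pullback (P.incl v) L))
    -- `μ` maps the class of `D_v` to the class of `D'_v`
    (hcomp : ∀ v L L', LogCY.IsClassOfDivisor (Set.range (P.incl v)) L →
      LogCY.IsClassOfDivisor (Set.range (P'.incl v)) L' → μ L = L')
    -- `μv v` maps the class of the 1-stratum `D_e`, where `e = vw`, to the class of `D'_e`
    (hcurve : ∀ v w, v ≠ w → (Set.range (P.incl v) ∩ Set.range (P.incl w)).Nonempty →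
      ∀ L L', LogCY.IsClassOfDivisor (P.doubleCurve v w) L →
        LogCY.IsClassOfDivisor (P'.doubleCurve v w) L' → μv v L = L')
    -- `μ` preserves the cubic form
    (hcubic : ∀ L k k', LogCY.IsIntersectionNumber 3 P.Y (fun _ => L) k →
      LogCY.IsIntersectionNumber 3 P'.Y (fun _ => μ L) k' → k = k')
    -- the `μv v` are isometries for the intersection forms
    (hisom : ∀ v L M k k', LogCY.IsIntersectionNumber 2 (P.comp v) ![L, M] k →
      LogCY.IsIntersectionNumber 2 (P'.comp v) ![μv v L, μv v M] k' → k = k') :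
    -- `μ` and the `μv v` are induced by an isomorphism of pairs
    ∃ f : LogCY.PairIso P P',
      (∀ L, LogCY.Pic.pullback f.f.hom (μ L) = L) ∧
      (∀ v L, LogCY.Pic.pullback (f.comp v).hom (μv v L) = L) := by
  classical
  obtain ⟨p, C, A, hI, hr, hstr, hp⟩ := hP.exists_tAtlas
  obtain ⟨p', C', A', -, hr', hstr', hp'⟩ := hP'.exists_tAtlas
  -- Equal dual complexes give the same cones, as sets of indices; the positions of the rays are
  -- still to be compared.
  obtain rfl : C = C' := by
    ext s
    rw [LogCY.BoundaryPair.mem_cones_iff A hr, LogCY.BoundaryPair.mem_cones_iff A' hr', hdual]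
  obtain ⟨B, hB⟩ := LogCY.BoundaryPair.exists_addEquiv_lattice A A' hr hr' μ hcomp hp hp'
  -- Transport along `B` turns the atlas of `Y'` into one with the pairing of `Y`.
  obtain ⟨A₁, hr₁, hstr₁⟩ : ∃ A₁ : LogCY.TAtlas p C P'.Y,
      (∀ v, Set.range (P'.incl v) = {x | v ∈ A₁.coneAt x}) ∧
      ∀ s hs, A₁.chart s hs ≫ P'.str =
        Spec.map (CommRingCat.ofHom (algebraMap ℂ (LogCY.CoordRing p s))) := by
    have hC : ∀ s, s ∈ C ↔ s.image id ∈ C := fun s => by rw [Finset.image_id]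
    have hC' : ∀ s ∈ C, ∃ s' : Finset I, s = s'.image id := fun s _ => ⟨s, Finset.image_id.symm⟩
    refine ⟨A'.reindex B id hB Function.injective_id C hC hC', fun v => ?_,
      A'.reindex_chart_comp B id hB Function.injective_id C hC hC' hstr'⟩
    rw [hr']
    ext x
    exact (A'.mem_coneAt_reindex B id hB Function.injective_id C hC hC').symm
  obtain ⟨f, hf, hfv⟩ := LogCY.BoundaryPair.exists_pairIso A A₁ hr hr₁ fun s hs => by
    rw [hstr, hstr₁]
  refine ⟨f, fun L => ?_, fun v L => ?_⟩
  -- Both `μ` and pull-back along `f` are known on classes of boundary divisors, and there are no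
  -- other classes.
  · obtain ⟨a, rfl⟩ := A.toricCls_surjective L
    rw [LogCY.BoundaryPair.map_toricCls A A₁ hr hr₁ μ hcomp, A.pullback_toricCls A₁ f.f.hom hf]
  · obtain ⟨a, rfl⟩ := (A.divisor (P.incl v) (hr v)).toricCls_surjective L
    rw [LogCY.BoundaryPair.map_toricCls_divisor A A₁ hr hr₁ v (μv v) (hcurve v),
      (A.divisor (P.incl v) (hr v)).pullback_toricCls (A₁.divisor (P'.incl v) (hr₁ v))
        (f.comp v).hom (hfv v)]
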